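/- **Setting.** Let $G=(V,E,w)$ be a weighted undirected simple graph with $V=\{0,\dots,n-1\}$, $n\ge 2$, and $m=|E|\ge n/2$ edges (as is the case if no vertex is isolated), whose edge weights are integers with $1\le w(e)\le n^{a}$ for a constant $a$. For $u\in V$, $\ell\ge 1$ and $W>0$ let $B^{\ell}(u,W)$ be the set of all vertices joined to $u$ by a path with at most $\ell$ edges and of weighted length at most $W$. An *$\ell$-limited $W$-neighborhood cover* of $G$ is a family of clusters $X_c\subseteq V$ such that 1. every cluster has strong diameter $O(W\log n)$, i.e. any two vertices of $X_c$ are joined by a path of weighted length $O(W\log n)$ all of whose vertices lie in $X_c$; 2. every vertex lies in $O(\log n)$ clusters; 3. for every $u\in V$ there is a cluster $X_c$ with $B^{\ell}(u,W)\subseteq X_c$. **Model.** In the MPC model there are $M$ machines with a memory of $S$ words each, a word having $O(\log n)$ bits. Initially the edges of $G$ (with their weights) are distributed arbitrarily over the machines, at most $\lfloor n^{\gamma}\rfloor$ edges on each, where $M\lfloor n^{\gamma}\rfloor\ge m$. In each synchronous round every machine performs an arbitrary local computation, with fresh private random words, on the content of its memory, and sends words to the machines (itself included); it sends at most $S$ words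 and receives at most $S$ words, and the words received are the content of its memory after the round. At the end, the machines hold pairs $(v,c)$ that say that $v\in X_c$. **Statement.** For all constants $a$ and $k$ there is a constant $C$, which also bounds all the constants hidden in $O(\cdot)$ above, such that for all $0<\gamma\le 1$ and all $n,m,\ell\ge 1$, $W>0$ (with $n\ge 2$ and $n\le 2m$) there is a randomized MPC algorithm, depending only on $a,k,\gamma,n,m,\ell,W$, that uses * at most $C\,n^{\gamma}$ words of memory per machine, * at most $C\,m\log^2 n$ words of memory overall ($M\cdot S\le C\,m\log^2 n$), * at most $C\,\frac{\ell}{\gamma}\log n$ rounds, and that, for every such graph $G$ with $n$ vertices and $m$ edges and every such distribution of its edges over the machines, always respects the memory and communication limits of the model and outputs an $\ell$-limited $W$-neighborhood cover of $G$ with probability at least $1-n^{-k}$. -/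

import Mathlib

/-! ### Weighted graphs, hop-limited balls, limited neighborhood covers -/

/-- The weighted length of a walk. -/
def walkWeight {n : ℕ} {G : SimpleGraph (Fin n)} (w : Sym2 (Fin n) → ℕ) {u v : Fin n}
    (p : G.Walk u v) : ℕ :=
  (p.edges.map w).sum

/-- The `ℓ`-hop limited ball `B^ℓ(v, r)`: all vertices that are joined to `v` by a path with at most
`ℓ` hops and of weighted length at most `r`. -/
def limitedBall {n : ℕ} (G : SimpleGraph (Fin n)) (w : Sym2 (Fin n) → ℕ) (ℓ : ℕ) (r : ℝ)
    (v : Fin n) : Set (Fin n) :=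
  {u | ∃ p : G.Walk v u, p.IsPath ∧ p.length ≤ ℓ ∧ (walkWeight w p : ℝ) ≤ r}

/-- The indexed family `X` of clusters is an `ℓ`-limited `W`-neighborhood cover of `(G, w)`, where
`K` is the constant hidden in the two `O(·)`s of the definition. -/
structure IsLimitedNeighborhoodCover {n : ℕ} (G : SimpleGraph (Fin n)) (w : Sym2 (Fin n) → ℕ)
    (ℓ : ℕ) (W K : ℝ) {ι : Type} (X : ι → Set (Fin n)) : Prop where
  /-- Every cluster has (strong) diameter `O(W log n)`: any two of its vertices are joined by a path
  of that length which stays inside the cluster. -/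
  diameter : ∀ c, ∀ x ∈ X c, ∀ y ∈ X c, ∃ p : G.Walk x y, p.IsPath ∧
    (∀ z ∈ p.support, z ∈ X c) ∧ (walkWeight w p : ℝ) ≤ K * W * Real.log n
  /-- Every vertex lies in `O(log n)` clusters. -/
  overlap : ∀ v, {c | v ∈ X c}.Finite ∧ ({c | v ∈ X c}.ncard : ℝ) ≤ K * Real.log n
  /-- The `ℓ`-hop limited ball of radius `W` around every vertex lies inside some cluster. -/
  covers : ∀ u, ∃ c, limitedBall G w ℓ W u ⊆ X c

/-! ### The model of massively parallel computation -/

/-- A randomized algorithm of the MPC model. There are `machines` machines, each with a memory of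
`memory` words, where a word is one of `0, …, wordSize - 1`; the algorithm takes `rounds` rounds.
In round `t`, machine `i` with memory content `l` and fresh private coins `ρ` (`memory` many
uniformly random words) sends the words `send t i l ρ j` to machine `j`. The content of a machine's
memory after the round is what it has received; it keeps data by sending them to itself. As usual in
this model, local computation is free. -/
structure MPCAlgorithm where
  machines : ℕ
  memory : ℕ
  wordSize : ℕ
  rounds : ℕ
  send : ℕ → Fin machines → List ℕ → (Fin memory → Fin wordSize) → Fin machines → List ℕ

namespace MPCAlgorithm

/-- The outcomes of all the coins: independent uniform words for every round and machine. -/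
abbrev Coins (A : MPCAlgorithm) : Type :=
  Fin A.rounds → Fin A.machines → Fin A.memory → Fin A.wordSize

/-- The contents of all memories after `t` rounds (nothing happens after the last round). A machine
receives its messages in the order of their senders. -/
def config (A : MPCAlgorithm) (init : Fin A.machines → List ℕ) (ω : A.Coins) :
    ℕ → Fin A.machines → List ℕ
  | 0 => init
  | t + 1 =>
    if h : t < A.rounds then
      fun j => (List.finRange A.machines).flatMap fun i =>
        A.send t i (config A init ω t i) (ω ⟨t, h⟩ i) j
    else config A init ω t

/-- The contents of all memories when the algorithm stops. -/
def output (A : MPCAlgorithm) (init : Fin A.machines → List ℕ) (ω : A.Coins) :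
    Fin A.machines → List ℕ :=
  A.config init ω A.rounds

/-- The constraints of the model hold, whatever the coins show: at any time every memory holds at
most `memory` words (so no machine ever receives more in a round), and in every round every machine
sends at most `memory` words altogether. -/
def ObeysLimits (A : MPCAlgorithm) (init : Fin A.machines → List ℕ) : Prop :=
  ∀ ω : A.Coins,
    (∀ t ≤ A.rounds, ∀ i, (A.config init ω t i).length ≤ A.memory ∧
      ∀ x ∈ A.config init ω t i, x < A.wordSize) ∧
    (∀ t : Fin A.rounds, ∀ i,
      ∑ j, (A.send t i (A.config init ω t i) (ω t i) j).length ≤ A.memory)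

/-- The probability, over the coins of the algorithm, that the output satisfies `good`. -/
noncomputable def successProb (A : MPCAlgorithm) (init : Fin A.machines → List ℕ)
    (good : (Fin A.machines → List ℕ) → Prop) : ℝ :=
  (Nat.card {ω : A.Coins // good (A.output init ω)} : ℝ) / (Nat.card A.Coins : ℝ)

end MPCAlgorithm

/-! ### Input and output formats -/

/-- `D` distributes the edges of `G` over `M` machines: every edge is recorded, in one of its two
orientations, exactly once. -/
def IsEdgeDistribution {n M : ℕ} (G : SimpleGraph (Fin n))
    (D : Fin M → List (Fin n × Fin n)) : Prop :=
  (((List.finRange M).flatMap D).map fun e => s(e.1, e.2)).Nodup ∧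
  ∀ e, e ∈ (((List.finRange M).flatMap D).map fun e => s(e.1, e.2)) ↔ e ∈ G.edgeSet

/-- The initial memory contents: an edge `uv` is stored as the three words `u`, `v`, `w(uv)`. -/
def edgeInput {n M : ℕ} (w : Sym2 (Fin n) → ℕ) (D : Fin M → List (Fin n × Fin n)) (i : Fin M) :
    List ℕ :=
  (D i).flatMap fun e => [(e.1 : ℕ), (e.2 : ℕ), w s(e.1, e.2)]

/-- A list of words, read as consecutive pairs. -/
def wordPairs : List ℕ → List (ℕ × ℕ)
  | x :: y :: l => (x, y) :: wordPairs l
  | _ => []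

/-- The clusters described by the memory contents `out`: a pair of words `v`, `c` in some memory
says that vertex `v` belongs to the cluster with name `c`. -/
def outputClusters (n : ℕ) {M : ℕ} (out : Fin M → List ℕ) (c : ℕ) : Set (Fin n) :=
  {v | ∃ i, ((v : ℕ), c) ∈ wordPairs (out i)}

/-!
Several independent copies of one clustering of `G` are computed. In a copy every vertex `v` draws a
random shift `δ_v`, namely a fixed unit times the bit length of a uniformly random word, and every
vertex `u` joins the cluster of the `v` that minimizes `δ_v + dist(u, v)`. Here the cost of an edge
of weight `x` is `ℓ * x + W`, so that a walk with at most `ℓ` hops and of weight at most `W` costs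
at most `2 * ℓ * W`, whereas a walk of cost `O(ℓ * W * log n)` has weight `O(W * log n)`.

* Clusters are connected through shortest walks to their centers, whose cost is at most the largest
  shift.
* If at `u` the minimum is attained with a gap of more than twice the radius of a ball around `u`,
  then the whole ball joins the same cluster. Halving the word of the minimizer lowers its shift by
  one unit and is a two-to-one map, so this happens with probability at least `1 / 4`; hence
  `O(log n)` copies suffice for all `u` together.
* Edge costs are at least `W`, so the minimizers are found by `O(ℓ * log n)` iterations of the
  Bellman–Ford algorithm, run in parallel in all copies. An iteration takes the minimum of the
  labels of the neighbors of every vertex. On an array of words that is spread over the machines and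
  sorted by vertices this is a prefix maximum, and prefix sums and maxima take `O(1 / γ)` rounds
  because the tree of machines with branching `n ^ γ` has height `O(1 / γ)`. Sorting is done once
  and for all, bit by bit.
-/

/-! ### Weights of walks -/

namespace ShiftedClustering

open SimpleGraph

variable {n : ℕ} {G : SimpleGraph (Fin n)}

section WalkWeight

variable {w : Sym2 (Fin n) → ℕ} {u v x : Fin n}

@[simp]
theorem walkWeight_nil : walkWeight w (Walk.nil : G.Walk u u) = 0 := by
  simp [walkWeight]

theorem walkWeight_cons (h : G.Adj u v) (p : G.Walk v x) :
    walkWeight w (Walk.cons h p) = w s(u, v) + walkWeight w p := by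
  simp [walkWeight]

theorem walkWeight_append (p : G.Walk u v) (q : G.Walk v x) :
    walkWeight w (p.append q) = walkWeight w p + walkWeight w q := by
  simp [walkWeight]

theorem walkWeight_reverse (p : G.Walk u v) : walkWeight w p.reverse = walkWeight w p := by
  simp [walkWeight, List.sum_reverse]

theorem walkWeight_eq_zero_of_length_eq_zero {p : G.Walk u v} (hp : p.length = 0) :
    walkWeight w p = 0 := by
  cases p with
  | nil => simp
  | cons => simp at hp

theorem walkWeight_bypass_le (p : G.Walk u v) : walkWeight w p.bypass ≤ walkWeight w p := by
  obtain ⟨l, hperm, hsub⟩ : p.bypass.edges.Subperm p.edges :=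
    p.bypass_isPath.isTrail.edges_nodup.subperm p.edges_bypass_subset_edges
  rw [walkWeight, walkWeight, ← (hperm.map w).sum_eq]
  exact (hsub.map w).sum_le_sum fun _ _ => Nat.zero_le _

theorem walkWeight_mul_add (h r : ℕ) (p : G.Walk u v) :
    walkWeight (fun e => h * w e + r) p = h * walkWeight w p + p.length * r := by
  induction p with
  | nil => simp
  | cons huv p ih => rw [walkWeight_cons, walkWeight_cons, ih, Walk.length_cons]; ring

theorem walkWeight_mul (ν : ℕ) (p : G.Walk u v) :
    walkWeight (fun e => ν * w e) p = ν * walkWeight w p := by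
  simpa using walkWeight_mul_add (w := w) ν 0 p

theorem length_mul_le_walkWeight {k : ℕ} (hw : ∀ e ∈ G.edgeSet, k ≤ w e) (p : G.Walk u v) :
    p.length * k ≤ walkWeight w p := by
  induction p with
  | nil => simp
  | cons huv p ih =>
    rw [walkWeight_cons, Walk.length_cons]
    have := hw _ (G.mem_edgeSet.2 huv)
    linarith

theorem walkWeight_le_length_mul {k : ℕ} (hw : ∀ e ∈ G.edgeSet, w e ≤ k) (p : G.Walk u v) :
    walkWeight w p ≤ p.length * k := by
  induction p with
  | nil => simp
  | cons huv p ih =>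
    rw [walkWeight_cons, Walk.length_cons]
    have := hw _ (G.mem_edgeSet.2 huv)
    linarith

end WalkWeight

/-- The least cost of a walk from `u` to `v`, and the default value `Z` if there is none. -/
noncomputable def walkDist (G : SimpleGraph (Fin n)) (κ : Sym2 (Fin n) → ℕ) (Z : ℕ) (u v : Fin n) :
    ℕ :=
  open Classical in
  if G.Reachable u v then sInf {x | ∃ p : G.Walk u v, x = walkWeight κ p} else Z

theorem walkDist_le (κ : Sym2 (Fin n) → ℕ) (Z : ℕ) {u v : Fin n} (p : G.Walk u v) :
    walkDist G κ Z u v ≤ walkWeight κ p := by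
  rw [walkDist, if_pos ⟨p⟩]
  exact Nat.sInf_le ⟨p, rfl⟩

theorem walkDist_self (κ : Sym2 (Fin n) → ℕ) (Z : ℕ) (u : Fin n) : walkDist G κ Z u u = 0 := by
  simpa using walkDist_le (G := G) κ Z (Walk.nil : G.Walk u u)

theorem exists_walkWeight_eq_walkDist {κ : Sym2 (Fin n) → ℕ} {Z : ℕ} {u v : Fin n}
    (h : walkDist G κ Z u v ≠ Z) : ∃ p : G.Walk u v, walkWeight κ p = walkDist G κ Z u v := by
  unfold walkDist at h ⊢
  split_ifs at h ⊢ with hr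
  · obtain ⟨q⟩ := hr
    obtain ⟨p, hp⟩ := Nat.sInf_mem (s := {x | ∃ p : G.Walk u v, x = walkWeight κ p}) ⟨_, q, rfl⟩
    exact ⟨p, hp.symm⟩
  · exact absurd rfl h

/-! ### The Bellman–Ford algorithm -/

/-- `lab u` is the minimum over `v` of `init v + dist(u, v)` for the edge costs `κ`, expressed by
local conditions. -/
structure IsShiftedDistance (G : SimpleGraph (Fin n)) (κ : Sym2 (Fin n) → ℕ)
    (init lab : Fin n → ℕ) : Prop where
  le_init : ∀ u, lab u ≤ init u
  le_adj : ∀ u v, G.Adj u v → lab u ≤ lab v + κ s(u, v)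
  attained : ∀ u, lab u = init u ∨ ∃ v, G.Adj u v ∧ lab u = lab v + κ s(u, v)

/-- `L i` are the labels after `i` iterations of the Bellman–Ford algorithm with edge costs `κ` and
initial labels `init`. -/
structure IsBellmanFord (G : SimpleGraph (Fin n)) (κ : Sym2 (Fin n) → ℕ) (init : Fin n → ℕ)
    (L : ℕ → Fin n → ℕ) : Prop where
  zero : ∀ u, L 0 u = init u
  succ : ∀ i u, IsLeast {x | x = L i u ∨ ∃ v, G.Adj u v ∧ x = L i v + κ s(u, v)} (L (i + 1) u)

namespace IsBellmanFord

variable {κ : Sym2 (Fin n) → ℕ} {init : Fin n → ℕ} {L : ℕ → Fin n → ℕ}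
  (h : IsBellmanFord G κ init L)
include h

theorem succ_le (i : ℕ) (u : Fin n) : L (i + 1) u ≤ L i u := (h.succ i u).2 (Or.inl rfl)

theorem succ_le_adj (i : ℕ) {u v : Fin n} (huv : G.Adj u v) : L (i + 1) u ≤ L i v + κ s(u, v) :=
  (h.succ i u).2 (Or.inr ⟨v, huv, rfl⟩)

theorem le_init (i : ℕ) (u : Fin n) : L i u ≤ init u := by
  induction i with
  | zero => exact (h.zero u).le
  | succ i ih => exact (h.succ_le i u).trans ih

theorem mul_le_of_lt {k : ℕ} (hk : ∀ e ∈ G.edgeSet, k ≤ κ e) (i : ℕ) (u : Fin n)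
    (hlt : L (i + 1) u < L i u) : (i + 1) * k ≤ L (i + 1) u := by
  induction i generalizing u with
  | zero =>
    obtain hu | ⟨v, huv, hu⟩ := (h.succ 0 u).1
    · omega
    · have := hk s(u, v) huv
      omega
  | succ i ih =>
    obtain hu | ⟨v, huv, hu⟩ := (h.succ (i + 1) u).1
    · omega
    · have hv : L (i + 1) v < L i v := by
        have := h.succ_le_adj i huv
        omega
      have hLv := ih v hv
      have hκ := hk s(u, v) huv
      rw [hu, Nat.succ_mul]
      omega

theorem succ_eq {k I : ℕ} (hk : ∀ e ∈ G.edgeSet, k ≤ κ e) (hI : ∀ u, init u ≤ (I + 1) * k)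
    (u : Fin n) : L (I + 1) u = L I u := by
  by_contra hne
  have hlt := lt_of_le_of_ne (h.succ_le I u) hne
  have hlower := h.mul_le_of_lt hk I u hlt
  exact (hlower.trans_lt hlt).not_ge ((h.le_init I u).trans (hI u))

theorem eq_init_or_exists_adj_le (i : ℕ) (u : Fin n) :
    L i u = init u ∨ ∃ v, G.Adj u v ∧ L i v + κ s(u, v) ≤ L i u := by
  induction i with
  | zero => exact Or.inl (h.zero u)
  | succ i ih =>
    obtain hu | ⟨v, huv, hu⟩ := (h.succ i u).1
    · rw [hu]
      exact ih.imp_right fun ⟨v, huv, hv⟩ =>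
        ⟨v, huv, (Nat.add_le_add_right (h.succ_le i v) _).trans hv⟩
    · exact Or.inr ⟨v, huv, hu ▸ Nat.add_le_add_right (h.succ_le i v) _⟩

theorem isShiftedDistance {k I : ℕ} (hk : ∀ e ∈ G.edgeSet, k ≤ κ e)
    (hI : ∀ u, init u ≤ (I + 1) * k) : IsShiftedDistance G κ init (L I) := by
  have hadj : ∀ u v, G.Adj u v → L I u ≤ L I v + κ s(u, v) := fun u v huv =>
    h.succ_eq hk hI u ▸ h.succ_le_adj I huv
  exact ⟨h.le_init I, hadj, fun u => (h.eq_init_or_exists_adj_le I u).imp_right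
    fun ⟨v, huv, hv⟩ => ⟨v, huv, le_antisymm (hadj u v huv) hv⟩⟩

end IsBellmanFord

namespace IsShiftedDistance

variable {κ : Sym2 (Fin n) → ℕ} {init lab : Fin n → ℕ}

theorem le_add_walkWeight (h : IsShiftedDistance G κ init lab) {u v : Fin n} (p : G.Walk u v) :
    lab u ≤ lab v + walkWeight κ p := by
  induction p with
  | nil => simp
  | cons huv p ih =>
    rw [walkWeight_cons]
    have := h.le_adj _ _ huv
    omega

theorem exists_walk (h : IsShiftedDistance G κ init lab) (hpos : ∀ e ∈ G.edgeSet, 0 < κ e)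
    (u : Fin n) :
    ∃ (v : Fin n) (p : G.Walk u v), lab u = init v + walkWeight κ p ∧
      ∀ z ∈ p.support, ∃ q : G.Walk z v, lab z = init v + walkWeight κ q := by
  induction hl : lab u using Nat.strong_induction_on generalizing u with
  | _ N ih =>
    subst hl
    rcases h.attained u with hu | ⟨x, hux, hu⟩
    · have hnil : lab u = init u + walkWeight κ (Walk.nil : G.Walk u u) := by simpa using hu
      refine ⟨u, Walk.nil, hnil, fun z hz => ?_⟩
      obtain rfl : z = u := by simpa using hz
      exact ⟨Walk.nil, hnil⟩
    · obtain ⟨v, p, hp, hz⟩ := ih (lab x) (by have := hpos s(u, x) hux; omega) x rfl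
      have hcons : lab u = init v + walkWeight κ (Walk.cons hux p) := by
        rw [walkWeight_cons, hu, hp]; ring
      refine ⟨v, Walk.cons hux p, hcons, fun z hz' => ?_⟩
      rw [Walk.support_cons, List.mem_cons] at hz'
      rcases hz' with rfl | hz'
      · exact ⟨_, hcons⟩
      · exact hz z hz'

end IsShiftedDistance

/-! ### Clusters of the minimizers of shifted distances -/

/-- The labels that consist of the shifted distance `lab u / ν` of `u`, for the shifts `sh` and the
edge costs `κ`, and of the name `lab u % ν` of a center that attains it: minimizing the combined
number breaks ties between centers by their names `id`. -/
abbrev IsCenterLabeling (G : SimpleGraph (Fin n)) (κ : Sym2 (Fin n) → ℕ) (ν : ℕ)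
    (sh id lab : Fin n → ℕ) : Prop :=
  IsShiftedDistance G (fun e => ν * κ e) (fun u => ν * sh u + id u) lab

namespace IsCenterLabeling

variable {κ : Sym2 (Fin n) → ℕ} {sh id lab : Fin n → ℕ} {ν S : ℕ}
  (h : IsCenterLabeling G κ ν sh id lab) (hpos : ∀ e ∈ G.edgeSet, 0 < κ e) (hid : ∀ u, id u < ν)
include h hpos hid

theorem exists_center (x : Fin n) :
    ∃ (v : Fin n) (p : G.Walk x v), lab x = ν * (sh v + walkWeight κ p) + id v ∧
      ∀ z ∈ p.support, lab z % ν = id v := by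
  have hν : 0 < ν := (Nat.zero_le _).trans_lt (hid x)
  obtain ⟨v, p, hp, hsupport⟩ := h.exists_walk (fun e he => Nat.mul_pos hν (hpos e he)) x
  refine ⟨v, p, by rw [hp, walkWeight_mul]; ring, fun z hz => ?_⟩
  obtain ⟨q, hq⟩ := hsupport z hz
  rw [hq, walkWeight_mul, add_right_comm, ← mul_add, Nat.mul_add_mod, Nat.mod_eq_of_lt (hid v)]

theorem exists_mod_eq (x : Fin n) : ∃ v, lab x % ν = id v := by
  obtain ⟨v, p, -, hp⟩ := h.exists_center hpos hid x
  exact ⟨v, hp x p.start_mem_support⟩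

theorem exists_walk_le (hS : ∀ u, sh u ≤ S) (x : Fin n) :
    ∃ (v : Fin n) (p : G.Walk x v), (∀ z ∈ p.support, lab z % ν = id v) ∧ walkWeight κ p ≤ S := by
  obtain ⟨v, p, hp, hmod⟩ := h.exists_center hpos hid x
  refine ⟨v, p, hmod, ?_⟩
  have hlt : ν * (sh v + walkWeight κ p) < ν * (S + 1) := by
    calc ν * (sh v + walkWeight κ p) ≤ ν * sh x + id x := by
          have := h.le_init x
          omega
      _ < ν * S + ν := Nat.add_lt_add_of_le_of_lt (Nat.mul_le_mul_left _ (hS x)) (hid x)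
      _ = ν * (S + 1) := by ring
  have := Nat.lt_of_mul_lt_mul_left hlt
  omega

theorem exists_path_in_cluster (hinj : Function.Injective id) (hS : ∀ u, sh u ≤ S) {x y : Fin n}
    (hxy : lab x % ν = lab y % ν) :
    ∃ p : G.Walk x y, p.IsPath ∧ (∀ z ∈ p.support, lab z % ν = lab x % ν) ∧
      walkWeight κ p ≤ 2 * S := by
  obtain ⟨v, p, hp, hpS⟩ := h.exists_walk_le hpos hid hS x
  obtain ⟨v', q, hq, hqS⟩ := h.exists_walk_le hpos hid hS y
  have hx := hp x p.start_mem_support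
  obtain rfl : v = v' := hinj (by rw [← hx, hxy, hq y q.start_mem_support])
  refine ⟨(p.append q.reverse).bypass, Walk.bypass_isPath _, fun z hz => ?_, ?_⟩
  · have hz' := Walk.support_bypass_subset_support _ hz
    rw [Walk.mem_support_append_iff, Walk.support_reverse, List.mem_reverse] at hz'
    rw [hx]
    exact hz'.elim (hp z) (hq z)
  · refine (walkWeight_bypass_le _).trans ?_
    rw [walkWeight_append, walkWeight_reverse]
    omega

omit h hpos hid in
theorem walkDist_ne_of_gap {U Z : ℕ} (hS : ∀ u, sh u ≤ S) (hZ : S < Z) {u v : Fin n}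
    (hgap : ∀ x, x ≠ v → sh v + walkDist G κ Z u v + U ≤ sh x + walkDist G κ Z u x) :
    walkDist G κ Z u v ≠ Z := by
  have hself := walkDist_self (G := G) κ Z u
  by_cases huv : u = v
  · rw [← huv, hself]
    omega
  · have := hgap u huv
    have := hS u
    omega

theorem mod_eq_of_gap {U Z : ℕ} (hS : ∀ u, sh u ≤ S) (hZ : S < Z) {u v : Fin n}
    (hgap : ∀ x, x ≠ v → sh v + walkDist G κ Z u v + (2 * U + 1) ≤ sh x + walkDist G κ Z u x)
    {y : Fin n} (p : G.Walk u y) (hp : walkWeight κ p ≤ U) : lab y % ν = id v := by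
  obtain ⟨q, hq⟩ := exists_walkWeight_eq_walkDist (walkDist_ne_of_gap hS hZ hgap)
  obtain ⟨x, r, hr, hmod⟩ := h.exists_center hpos hid y
  rw [hmod y r.start_mem_support]
  by_contra hne
  have hx := hgap x fun hxv => hne (by rw [hxv])
  have hvia_y := walkDist_le κ Z (p.append r)
  rw [walkWeight_append] at hvia_y
  have hlab : lab y ≤ ν * (sh v + walkWeight κ p + walkDist G κ Z u v) + id v := by
    have hle := h.le_add_walkWeight (p.reverse.append q)
    rw [walkWeight_mul, walkWeight_append, walkWeight_reverse, hq] at hle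
    have := h.le_init v
    linarith
  have hlt : ν * (sh v + walkWeight κ p + walkDist G κ Z u v + 1) ≤
      ν * (sh x + walkWeight κ r) := Nat.mul_le_mul_left _ (by omega)
  have := hid v
  linarith

end IsCenterLabeling

end ShiftedClustering

/-! ### Winning by a large margin -/

namespace ShiftedClustering

open Finset

theorem size_eq_size_div_two_add_one {a : ℕ} (ha : a ≠ 0) : Nat.size a = Nat.size (a / 2) + 1 := by
  conv_lhs => rw [← Nat.bit_bodd_div2 a]
  rw [Nat.size_bit (by rwa [Nat.bit_bodd_div2]), Nat.div2_val]

/-- In the choice of a center from distance `D`, where `x` is shifted by `Λ` times the bit length of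
its random word `f x`, the point `v` is ahead of all others by at least `gap`. -/
def IsWinner {ι : Type*} {Q : ℕ} (Λ gap : ℕ) (D : ι → ℕ) (f : ι → Fin Q) (v : ι) : Prop :=
  ∀ x, x ≠ v → Nat.size (f v) * Λ + D v + gap ≤ Nat.size (f x) * Λ + D x

section Winner

variable {ι : Type*} {Q Λ : ℕ} {D : ι → ℕ}

theorem IsWinner.eq {gap : ℕ} {f : ι → Fin Q} {v v' : ι} (h : IsWinner Λ gap D f v)
    (h' : IsWinner Λ gap D f v') (hgap : 0 < gap) : v = v' := by
  by_contra hne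
  have := h v' (Ne.symm hne)
  have := h' v hne
  omega

theorem exists_isWinner_zero [Finite ι] [Nonempty ι] (f : ι → Fin Q) :
    ∃ v, IsWinner Λ 0 D f v := by
  obtain ⟨v, hv⟩ := Finite.exists_min fun x => Nat.size (f x) * Λ + D x
  exact ⟨v, fun x _ => hv x⟩

variable [DecidableEq ι]

/-- The map that halves the word of `v`. -/
def halveAt (v : ι) (f : ι → Fin Q) : ι → Fin Q :=
  Function.update f v ⟨f v / 2, (Nat.div_le_self _ _).trans_lt (f v).2⟩

theorem IsWinner.halveAt {f : ι → Fin Q} {v : ι} (h : IsWinner Λ 0 D f v) (hv : (f v : ℕ) ≠ 0) :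
    IsWinner Λ Λ D (halveAt v f) v := by
  intro x hx
  have := h x hx
  rw [size_eq_size_div_two_add_one hv, Nat.succ_mul] at this
  simp only [ShiftedClustering.halveAt, Function.update_self, Function.update_of_ne hx]
  omega

theorem eq_of_halveAt_eq {f g : ι → Fin Q} {v : ι} (h : halveAt v f = halveAt v g)
    (hmod : (f v : ℕ) % 2 = (g v : ℕ) % 2) : f = g := by
  funext x
  by_cases hx : x = v
  · subst hx
    have hdiv := congrFun h x
    simp only [halveAt, Function.update_self, Fin.mk.injEq] at hdiv
    exact Fin.ext (by omega)
  · simpa [halveAt, hx] using congrFun h x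

variable [Fintype ι]

theorem card_filter_apply_eq_mul (v : ι) (a : Fin Q) :
    #{f : ι → Fin Q | f v = a} * Q = Q ^ Fintype.card ι := by
  have hcard := Fintype.card_filter_piFinset_const_eq_of_mem (univ : Finset (Fin Q)) v (mem_univ a)
  rw [Fintype.piFinset_univ, Finset.card_fin] at hcard
  have : Nonempty ι := ⟨v⟩
  rw [hcard, ← pow_succ, Nat.sub_add_cancel Fintype.card_pos]

theorem card_filter_apply_val_eq_zero_mul_le (v : ι) :
    #{f : ι → Fin Q | (f v : ℕ) = 0} * Q ≤ Q ^ Fintype.card ι := by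
  cases Q with
  | zero => exact Nat.zero_le _
  | succ Q =>
    simpa only [Fin.val_eq_zero_iff] using (card_filter_apply_eq_mul v (0 : Fin (Q + 1))).le

open Classical in
theorem card_filter_isWinner_zero_ne_zero_le (v : ι) :
    #{f : ι → Fin Q | IsWinner Λ 0 D f v ∧ (f v : ℕ) ≠ 0} ≤
      2 * #{f : ι → Fin Q | IsWinner Λ Λ D f v} := by
  refine card_le_mul_card_image_of_maps_to (f := halveAt v) (fun f hf => ?_) 2 fun g _ => ?_
  · rw [mem_filter_univ] at hf ⊢
    exact hf.1.halveAt hf.2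
  · refine (card_le_card_of_injOn (t := range 2) (fun f => (f v : ℕ) % 2)
      (fun f _ => mem_range.2 (Nat.mod_lt _ two_pos)) ?_).trans (card_range 2).le
    intro f hf f' hf' hmod
    rw [mem_coe, mem_filter] at hf hf'
    exact eq_of_halveAt_eq (hf.2.trans hf'.2.symm) hmod

open Classical in
theorem card_filter_isWinner_zero_mul_le (v : ι) :
    #{f : ι → Fin Q | IsWinner Λ 0 D f v} * Q ≤
      2 * #{f : ι → Fin Q | IsWinner Λ Λ D f v} * Q + Q ^ Fintype.card ι := by
  have hsplit : #{f : ι → Fin Q | IsWinner Λ 0 D f v} ≤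
      #{f : ι → Fin Q | IsWinner Λ 0 D f v ∧ (f v : ℕ) ≠ 0} +
        #{f : ι → Fin Q | (f v : ℕ) = 0} := by
    refine (card_le_card fun f hf => ?_).trans (card_union_le _ _)
    simp only [mem_union, mem_filter_univ] at hf ⊢
    tauto
  calc #{f : ι → Fin Q | IsWinner Λ 0 D f v} * Q
    _ ≤ (2 * #{f : ι → Fin Q | IsWinner Λ Λ D f v} + #{f : ι → Fin Q | (f v : ℕ) = 0}) * Q :=
        Nat.mul_le_mul_right _
          (hsplit.trans (Nat.add_le_add_right (card_filter_isWinner_zero_ne_zero_le v) _))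
    _ ≤ _ := by
        rw [add_mul]
        exact Nat.add_le_add_left (card_filter_apply_val_eq_zero_mul_le v) _

open Classical in
theorem sum_card_filter_isWinner (hΛ : 0 < Λ) :
    ∑ v, #{f : ι → Fin Q | IsWinner Λ Λ D f v} = #{f : ι → Fin Q | ∃ v, IsWinner Λ Λ D f v} := by
  rw [← card_biUnion]
  · congr 1
    ext f
    simp
  · intro v _ v' _ hne
    rw [Function.onFun, disjoint_left]
    intro f hf hf'
    rw [mem_filter_univ] at hf hf'
    exact hne (hf.eq hf' hΛ)

open Classical in
theorem pow_card_le_sum_card_filter_isWinner_zero [Nonempty ι] :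
    Q ^ Fintype.card ι ≤ ∑ v, #{f : ι → Fin Q | IsWinner Λ 0 D f v} := by
  calc Q ^ Fintype.card ι = #(univ : Finset (ι → Fin Q)) := by simp
    _ ≤ #(univ.biUnion fun v => ({f | IsWinner Λ 0 D f v} : Finset (ι → Fin Q))) := by
        refine card_le_card fun f _ => ?_
        simpa using exists_isWinner_zero f
    _ ≤ _ := card_biUnion_le

open Classical in
theorem pow_card_le_four_mul_card_filter_isWinner [Nonempty ι] (hQ : 2 * Fintype.card ι ≤ Q)
    (hΛ : 0 < Λ) :
    Q ^ Fintype.card ι ≤ 4 * #{f : ι → Fin Q | ∃ v, IsWinner Λ Λ D f v} := by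
  have hQ0 : 0 < Q := by have := Fintype.card_pos (α := ι); omega
  set N := Fintype.card ι with hN
  have hsum := sum_le_sum fun v (_ : v ∈ univ) =>
    card_filter_isWinner_zero_mul_le (Q := Q) (Λ := Λ) (D := D) v
  rw [sum_add_distrib, ← sum_mul, ← sum_mul, ← mul_sum, sum_card_filter_isWinner hΛ, sum_const,
    card_univ, smul_eq_mul, ← hN] at hsum
  set good := #{f : ι → Fin Q | ∃ v, IsWinner Λ Λ D f v}
  have hupper : Q ^ N * Q ≤ 2 * good * Q + N * Q ^ N :=
    (Nat.mul_le_mul_right _ pow_card_le_sum_card_filter_isWinner_zero).trans hsum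
  have hhalf : 2 * N * Q ^ N ≤ Q * Q ^ N := Nat.mul_le_mul_right _ hQ
  refine Nat.le_of_mul_le_mul_right (?_ : _ * Q ≤ _ * Q) hQ0
  linarith

omit [DecidableEq ι] in
theorem card_not_exists_isWinner_le [Nonempty ι] (hQ : 2 * Fintype.card ι ≤ Q) (hΛ : 0 < Λ) :
    (Nat.card {f : ι → Fin Q // ¬ ∃ v, IsWinner Λ Λ D f v} : ℝ) ≤
      3 / 4 * (Q : ℝ) ^ Fintype.card ι := by
  classical
  have hgood : ((Q ^ Fintype.card ι : ℕ) : ℝ) ≤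
      (4 * #{f : ι → Fin Q | ∃ v, IsWinner Λ Λ D f v} : ℕ) :=
    Nat.cast_le.2 (pow_card_le_four_mul_card_filter_isWinner hQ hΛ)
  have hall := congrArg (Nat.cast (R := ℝ)) (card_filter_add_card_filter_not
    (s := (univ : Finset (ι → Fin Q))) fun f => ∃ v, IsWinner Λ Λ D f v)
  rw [card_univ, Fintype.card_fun, Fintype.card_fin] at hall
  rw [Nat.card_eq_fintype_card, Fintype.card_subtype]
  push_cast at hgood hall
  linarith

end Winner

section Independence

theorem card_forall_curry {τ ι α : Type*} [Finite τ] (P : (ι → α) → Prop) :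
    Nat.card {g : τ × ι → α // ∀ j, P fun v => g (j, v)} =
      Nat.card {f : ι → α // P f} ^ Nat.card τ := by
  let e : {g : τ × ι → α // ∀ j, P fun v => g (j, v)} ≃ (τ → {f : ι → α // P f}) :=
    ((Equiv.curry τ ι α).subtypeEquiv fun g => Iff.rfl).trans
      (Equiv.subtypePiEquivPi (p := fun _ f => P f))
  rw [Nat.card_congr e, Nat.card_fun]

-- Exchanging the values at `κ` with a second point of `κ → α` is injective: forgetting the other
-- coordinates preserves the uniform distribution.
theorem card_comp_mul_le {Ω ι κ α : Type*} [Finite Ω] [Finite κ] [Finite α]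
    (flat : Ω ≃ (ι → α)) {e : κ → ι} (he : Function.Injective e) (P : (κ → α) → Prop) :
    Nat.card {ω : Ω // P fun k => flat ω (e k)} * Nat.card (κ → α) ≤
      Nat.card {g : κ → α // P g} * Nat.card Ω := by
  rw [← Nat.card_prod, ← Nat.card_prod]
  refine Nat.card_le_card_of_injective
    (fun x => (⟨fun k => flat x.1.1 (e k), x.1.2⟩,
      flat.symm (Function.extend e x.2 (flat x.1.1)))) ?_
  rintro ⟨⟨ω, hω⟩, g⟩ ⟨⟨ω', hω'⟩, g'⟩ heq
  simp only [Prod.mk.injEq, Subtype.mk.injEq, EmbeddingLike.apply_eq_iff_eq] at heq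
  obtain ⟨hon, hextend⟩ := heq
  obtain rfl : g = g' := by
    funext k
    have := congrFun hextend (e k)
    rwa [he.extend_apply, he.extend_apply] at this
  obtain rfl : ω = ω' := by
    apply flat.injective
    funext i
    by_cases hi : ∃ k, e k = i
    · obtain ⟨k, rfl⟩ := hi
      exact congrFun hon k
    · have := congrFun hextend i
      rwa [Function.extend_apply' _ _ _ hi, Function.extend_apply' _ _ _ hi] at this
  rfl

theorem card_exists_le_sum {Ω ι : Type*} [Finite Ω] [Fintype ι] (P : ι → Ω → Prop) :
    Nat.card {ω // ∃ u, P u ω} ≤ ∑ u, Nat.card {ω // P u ω} := by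
  rw [← Nat.card_sigma]
  refine Nat.card_le_card_of_surjective (fun x => ⟨x.2.1, x.1, x.2.2⟩) ?_
  rintro ⟨ω, u, hu⟩
  exact ⟨⟨u, ω, hu⟩, rfl⟩

variable {Ω κ τ ι : Type*} [Finite Ω] [Fintype τ] [Fintype ι] {Q Λ : ℕ}
  (flat : Ω ≃ (κ → Fin Q)) {e : τ × ι → κ} (he : Function.Injective e)

include he

theorem card_forall_not_exists_isWinner_le [Nonempty ι] (hQ : 2 * Fintype.card ι ≤ Q) (hΛ : 0 < Λ)
    (D : ι → ℕ) :
    (Nat.card {ω // ∀ j, ¬ ∃ v, IsWinner Λ Λ D (fun x => flat ω (e (j, x))) v} : ℝ) ≤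
      (3 / 4 : ℝ) ^ Fintype.card τ * Nat.card Ω := by
  have hQ0 : 0 < Q := by have := Fintype.card_pos (α := ι); omega
  have hforget := card_comp_mul_le flat he fun g : τ × ι → Fin Q =>
    ∀ j, ¬ ∃ v, IsWinner Λ Λ D (fun x => g (j, x)) v
  rw [card_forall_curry fun f => ¬ ∃ v, IsWinner Λ Λ D f v] at hforget
  replace hforget := (Nat.cast_le (α := ℝ)).2 hforget
  have htotal : (Nat.card (τ × ι → Fin Q) : ℝ) =
      ((Q : ℝ) ^ Fintype.card ι) ^ Fintype.card τ := by
    rw [Nat.card_fun, Nat.card_prod, Nat.card_fin, Nat.card_eq_fintype_card,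
      Nat.card_eq_fintype_card, ← pow_mul, mul_comm, Nat.cast_pow]
  rw [Nat.cast_mul, Nat.cast_mul, Nat.cast_pow, htotal,
    Nat.card_eq_fintype_card (α := τ)] at hforget
  have hbad := pow_le_pow_left₀ (Nat.cast_nonneg _) (card_not_exists_isWinner_le (D := D) hQ hΛ)
    (Fintype.card τ)
  refine le_of_mul_le_mul_right (hforget.trans ?_)
    (by positivity : (0 : ℝ) < ((Q : ℝ) ^ Fintype.card ι) ^ Fintype.card τ)
  calc _ ≤ (3 / 4 * (Q : ℝ) ^ Fintype.card ι) ^ Fintype.card τ * Nat.card Ω :=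
        mul_le_mul_of_nonneg_right hbad (Nat.cast_nonneg _)
    _ = _ := by rw [mul_pow]; ring

theorem card_exists_forall_not_exists_isWinner_le (hQ : 2 * Fintype.card ι ≤ Q) (hΛ : 0 < Λ)
    (D : ι → ι → ℕ) :
    (Nat.card {ω // ∃ u, ∀ j, ¬ ∃ v, IsWinner Λ Λ (D u) (fun x => flat ω (e (j, x))) v} : ℝ) ≤
      Fintype.card ι * (3 / 4 : ℝ) ^ Fintype.card τ * Nat.card Ω := by
  refine (Nat.cast_le.2 (card_exists_le_sum _)).trans ?_
  rw [Nat.cast_sum, mul_assoc, ← nsmul_eq_mul, ← card_univ, ← sum_const]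
  refine sum_le_sum fun u _ => ?_
  have : Nonempty ι := ⟨u⟩
  exact card_forall_not_exists_isWinner_le flat he hQ hΛ (D u)

end Independence

end ShiftedClustering

/-! ### Machines with a memory of slots -/

namespace CellMachine

section Encoding

variable {D : ℕ}

/-- The payload of slot `s` in a memory whose words have the form `slot + D * payload`. -/
def decode (D : ℕ) (l : List ℕ) (s : Fin D) : ℕ :=
  ((l.filter fun x => x % D = s).map (· / D)).sum

/-- The words `slot + D * payload` of all slots with a nonzero payload. -/
def encode (X : Fin D → ℕ) : List ℕ :=
  (List.finRange D).flatMap fun s : Fin D => if X s = 0 then [] else [(s : ℕ) + D * X s]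

theorem decode_nil (s : Fin D) : decode D [] s = 0 := by simp [decode]

theorem decode_append (l l' : List ℕ) (s : Fin D) :
    decode D (l ++ l') s = decode D l s + decode D l' s := by
  simp [decode]

theorem decode_singleton (s s' : Fin D) (p : ℕ) :
    decode D [(s' : ℕ) + D * p] s = if s' = s then p else 0 := by
  have hmod : ((s' : ℕ) + D * p) % D = s' := by
    rw [Nat.add_mul_mod_self_left, Nat.mod_eq_of_lt s'.2]
  have hdiv : ((s' : ℕ) + D * p) / D = p := by
    rw [Nat.add_mul_div_left _ _ s.pos, Nat.div_eq_of_lt s'.2, zero_add]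
  by_cases h : s' = s
  · subst h; simp [decode, hmod, hdiv]
  · simp [decode, hmod, h, ← Fin.ext_iff]

theorem decode_flatMap_finRange {M : ℕ} (f : Fin M → List ℕ) (s : Fin D) :
    decode D ((List.finRange M).flatMap f) s = ∑ i, decode D (f i) s := by
  rw [Fin.sum_univ_def]
  induction List.finRange M with
  | nil => exact decode_nil s
  | cons i L ih => rw [List.flatMap_cons, decode_append, ih, List.map_cons, List.sum_cons]

theorem decode_encode (X : Fin D → ℕ) : decode D (encode X) = X := by
  funext s
  rw [encode, decode_flatMap_finRange, Finset.sum_eq_single s]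
  · split_ifs with h
    · rw [decode_nil, h]
    · rw [decode_singleton, if_pos rfl]
  · intro s' _ hs'
    split_ifs
    · exact decode_nil s
    · rw [decode_singleton, if_neg hs']
  · simp

theorem length_encode (X : Fin D → ℕ) :
    (encode X).length = (Finset.univ.filter fun s => X s ≠ 0).card := by
  rw [encode, List.length_flatMap, ← Fin.sum_univ_def, Finset.card_filter]
  exact Finset.sum_congr rfl fun s _ => by split_ifs <;> simp_all

theorem length_encode_le (X : Fin D → ℕ) : (encode X).length ≤ D := by
  rw [length_encode]
  exact (Finset.card_le_univ _).trans (Fintype.card_fin D).le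

theorem lt_of_mem_encode {K Q : ℕ} {X : Fin D → ℕ} (hX : ∀ s, X s < K) (hQ : D * K ≤ Q) {x : ℕ}
    (hx : x ∈ encode X) : x < Q := by
  obtain ⟨s, -, hx⟩ := List.mem_flatMap.1 hx
  obtain rfl : x = s + D * X s := by
    split_ifs at hx
    · simp at hx
    · simpa using hx
  calc (s : ℕ) + D * X s < D + D * X s := Nat.add_lt_add_right s.2 _
    _ = D * (X s + 1) := by ring
    _ ≤ D * K := Nat.mul_le_mul_left _ (hX s)
    _ ≤ Q := hQ

theorem length_flatMap_encode_le {M : ℕ} {f : Fin M → Fin D → ℕ}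
    (h : ∀ s i i', f i s ≠ 0 → f i' s ≠ 0 → i = i') :
    ((List.finRange M).flatMap fun i => encode (f i)).length ≤ D := by
  simp only [List.length_flatMap, ← Fin.sum_univ_def, length_encode]
  rw [← Finset.card_biUnion]
  · exact (Finset.card_le_univ _).trans (Fintype.card_fin D).le
  · intro i _ i' _ hne
    rw [Function.onFun, Finset.disjoint_left]
    intro s hs hs'
    rw [Finset.mem_filter_univ] at hs hs'
    exact hne (h s i i' hs hs')

end Encoding

section Execution

/-- One synchronous round: the payloads that machine `i`, with memory content `X` and coins `c`,
sends to the slots of the other machines; a payload `0` stands for no message. -/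
abbrev Round (M D : ℕ) : Type :=
  Fin M → (Fin D → ℕ) → (ℕ → ℕ) → Fin M → Fin D → ℕ

variable {M D : ℕ}

/-- The memory contents after a round. Adding up the messages is harmless because of
`StepOK.unique`. -/
def step (r : Round M D) (c : Fin M → ℕ → ℕ) (X : Fin M → Fin D → ℕ) : Fin M → Fin D → ℕ :=
  fun j s => ∑ i, r i (X i) (c i) j s

/-- The round respects the limits: every slot receives at most one message, no machine sends more
than `mem` messages, and all payloads are less than `K`. -/
structure StepOK (mem K : ℕ) (r : Round M D) (c : Fin M → ℕ → ℕ) (X : Fin M → Fin D → ℕ) :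
    Prop where
  unique : ∀ j s i i', r i (X i) (c i) j s ≠ 0 → r i' (X i') (c i') j s ≠ 0 → i = i'
  sends : ∀ i, ∑ j, (Finset.univ.filter fun s => r i (X i) (c i) j s ≠ 0).card ≤ mem
  bound : ∀ i j s, r i (X i) (c i) j s < K

/-- Executing the rounds `rs` with coins `c` leads from `X` to `Y`, within the limits. -/
def Exec (mem K : ℕ) : List (Round M D) → (ℕ → Fin M → ℕ → ℕ) →
    (Fin M → Fin D → ℕ) → (Fin M → Fin D → ℕ) → Prop
  | [], _, X, Y => X = Y
  | r :: rs, c, X, Y => StepOK mem K r (c 0) X ∧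
      Exec mem K rs (fun t => c (t + 1)) (step r (c 0) X) Y

theorem Exec.append {mem K : ℕ} {rs rs' : List (Round M D)} {c : ℕ → Fin M → ℕ → ℕ}
    {X Y Z : Fin M → Fin D → ℕ} (h : Exec mem K rs c X Y)
    (h' : Exec mem K rs' (fun t => c (t + rs.length)) Y Z) : Exec mem K (rs ++ rs') c X Z := by
  induction rs generalizing c X with
  | nil => cases h; exact h'
  | cons r rs ih =>
    refine ⟨h.1, ih h.2 ?_⟩
    simpa only [List.length_cons, add_assoc, add_comm, add_left_comm] using h'

end Execution

section ToAlgorithm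

/-- The coins of a machine, as a function on all natural numbers. -/
def coinFun {mem Q : ℕ} (ρ : Fin mem → Fin Q) (o : ℕ) : ℕ :=
  if h : o < mem then ρ ⟨o, h⟩ else 0

/-- The algorithm that reads its input by `inp`, executes the rounds `rs` and outputs by `out`.
The first and the last round are local. -/
abbrev toAlgorithm {M D : ℕ} (mem Q : ℕ) (inp : Fin M → List ℕ → Fin D → ℕ)
    (rs : List (Round M D)) (out : (Fin D → ℕ) → List ℕ) : MPCAlgorithm where
  machines := M
  memory := mem
  wordSize := Q
  rounds := rs.length + 2
  send t i l ρ j := match t with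
    | 0 => if j = i then encode (inp i l) else []
    | t + 1 => if h : t < rs.length then encode (rs[t] i (decode D l) (coinFun ρ) j)
        else if j = i then out (decode D l) else []

variable {M D mem K Q : ℕ} {inp : Fin M → List ℕ → Fin D → ℕ} {rs : List (Round M D)}
  {out : (Fin D → ℕ) → List ℕ}

/-- The coins that are available in the rounds `rs`. -/
def roundCoins (ω : (toAlgorithm mem Q inp rs out).Coins) (t : ℕ) (i : Fin M) (o : ℕ) : ℕ :=
  if h : t + 1 < rs.length + 2 then coinFun (ω ⟨t + 1, h⟩ i) o else 0

theorem coinFun_eq_roundCoins (ω : (toAlgorithm mem Q inp rs out).Coins) {t : ℕ}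
    (h : t + 1 < rs.length + 2) (i : Fin M) : coinFun (ω ⟨t + 1, h⟩ i) = roundCoins ω t i := by
  funext o
  simp only [roundCoins, dif_pos h]

theorem flatMap_finRange_ite {α : Type*} (j : Fin M) (f : Fin M → List α) :
    ((List.finRange M).flatMap fun i => if j = i then f i else []) = f j := by
  suffices ∀ L : List (Fin M), L.Nodup →
      (L.flatMap fun i => if j = i then f i else []) = if j ∈ L then f j else [] by
    simpa using this _ (List.nodup_finRange M)
  intro L hL
  induction L with
  | nil => simp
  | cons a L ih =>
    rw [List.nodup_cons] at hL
    rw [List.flatMap_cons, ih hL.2]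
    by_cases h : j = a
    · subst h; simp [hL.1]
    · simp [h]

theorem sum_length_ite {α : Type*} (i : Fin M) (l : List α) :
    (∑ j, (if j = i then l else []).length) = l.length := by
  rw [Finset.sum_eq_single i] <;> simp +contextual

theorem config_succ (A : MPCAlgorithm) (init : Fin A.machines → List ℕ) (ω : A.Coins) {t : ℕ}
    (h : t < A.rounds) (j : Fin A.machines) :
    A.config init ω (t + 1) j = (List.finRange A.machines).flatMap fun i =>
      A.send t i (A.config init ω t i) (ω ⟨t, h⟩ i) j := by
  rw [MPCAlgorithm.config, dif_pos h]

variable (init : Fin M → List ℕ) (ω : (toAlgorithm mem Q inp rs out).Coins)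

/-- The contents of the slots after `t` of the rounds `rs`. -/
def slots (t : ℕ) (i : Fin M) : Fin D → ℕ :=
  decode D ((toAlgorithm mem Q inp rs out).config init ω (t + 1) i)

theorem send_toAlgorithm_of_lt {t : ℕ} (ht : t < rs.length) (h : t + 1 < rs.length + 2)
    (i j : Fin M) :
    (toAlgorithm mem Q inp rs out).send (t + 1) i
      ((toAlgorithm mem Q inp rs out).config init ω (t + 1) i) (ω ⟨t + 1, h⟩ i) j =
        encode (rs[t] i (slots init ω t i) (roundCoins ω t i) j) := by
  rw [← coinFun_eq_roundCoins ω h]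
  exact dif_pos ht

theorem send_toAlgorithm_length (h : rs.length + 1 < rs.length + 2) (i j : Fin M) :
    (toAlgorithm mem Q inp rs out).send (rs.length + 1) i
      ((toAlgorithm mem Q inp rs out).config init ω (rs.length + 1) i)
      (ω ⟨rs.length + 1, h⟩ i) j = if j = i then out (slots init ω rs.length i) else [] :=
  dif_neg (lt_irrefl _)

theorem config_toAlgorithm_one (i : Fin M) :
    (toAlgorithm mem Q inp rs out).config init ω 1 i = encode (inp i (init i)) :=
  (config_succ (toAlgorithm mem Q inp rs out) init ω (Nat.succ_pos _) i).trans
    (flatMap_finRange_ite i fun i' => encode (inp i' (init i')))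

theorem config_toAlgorithm_of_lt {t : ℕ} (ht : t < rs.length) (j : Fin M) :
    (toAlgorithm mem Q inp rs out).config init ω (t + 2) j =
      (List.finRange M).flatMap fun i =>
        encode (rs[t] i (slots init ω t i) (roundCoins ω t i) j) := by
  have h : t + 1 < rs.length + 2 := by omega
  refine (config_succ (toAlgorithm mem Q inp rs out) init ω h j).trans ?_
  exact congrArg (List.flatMap · _) (funext fun i => send_toAlgorithm_of_lt init ω ht h i j)

theorem output_toAlgorithm (j : Fin M) :
    (toAlgorithm mem Q inp rs out).output init ω j = out (slots init ω rs.length j) := by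
  have h : rs.length + 1 < rs.length + 2 := Nat.lt_succ_self _
  refine (config_succ (toAlgorithm mem Q inp rs out) init ω h j).trans ?_
  refine (congrArg (List.flatMap · _)
    (funext fun i => send_toAlgorithm_length init ω h i j)).trans ?_
  exact flatMap_finRange_ite j fun i => out (slots init ω rs.length i)

theorem slots_zero : slots init ω 0 = fun i => inp i (init i) :=
  funext fun i => by rw [slots, config_toAlgorithm_one, decode_encode]

theorem slots_succ {t : ℕ} (ht : t < rs.length) :
    slots init ω (t + 1) = step rs[t] (roundCoins ω t) (slots init ω t) := by
  funext j s
  rw [slots, config_toAlgorithm_of_lt init ω ht, decode_flatMap_finRange, step]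
  simp only [decode_encode]

variable {init ω} {Y : Fin M → Fin D → ℕ}
  (hY : Exec mem K rs (roundCoins ω) (fun i => inp i (init i)) Y)

include hY

theorem exec_drop {t : ℕ} (ht : t ≤ rs.length) :
    Exec mem K (rs.drop t) (fun u => roundCoins ω (u + t)) (slots init ω t) Y := by
  induction t with
  | zero => simpa only [List.drop_zero, slots_zero, Nat.add_zero] using hY
  | succ t ih =>
    have hexec := ih (Nat.le_of_succ_le ht)
    rw [List.drop_eq_getElem_cons ht] at hexec
    rw [slots_succ init ω ht]
    simpa only [Nat.add_right_comm, Nat.zero_add, Nat.add_assoc, Nat.add_comm 1] using hexec.2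

theorem slots_length : slots init ω rs.length = Y := by
  have hexec := exec_drop hY le_rfl
  rwa [List.drop_length] at hexec

theorem stepOK_slots {t : ℕ} (ht : t < rs.length) :
    StepOK mem K rs[t] (roundCoins ω t) (slots init ω t) := by
  have hexec := exec_drop hY ht.le
  rw [List.drop_eq_getElem_cons ht] at hexec
  simpa only [Nat.zero_add] using hexec.1

theorem config_toAlgorithm_limits (hQ : D * K ≤ Q) (hinp : ∀ i s, inp i (init i) s < K) {t : ℕ}
    (ht : t ≤ rs.length) (i : Fin M) :
    ((toAlgorithm mem Q inp rs out).config init ω (t + 1) i).length ≤ D ∧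
      ∀ x ∈ (toAlgorithm mem Q inp rs out).config init ω (t + 1) i, x < Q := by
  cases t with
  | zero =>
    rw [config_toAlgorithm_one]
    exact ⟨length_encode_le _, fun x => lt_of_mem_encode (hinp i) hQ⟩
  | succ t =>
    have hstep := stepOK_slots hY ht
    rw [config_toAlgorithm_of_lt init ω ht]
    refine ⟨length_flatMap_encode_le fun s i' i'' => hstep.unique i s i' i'', fun x hx => ?_⟩
    obtain ⟨i', -, hx⟩ := List.mem_flatMap.1 hx
    exact lt_of_mem_encode (hstep.bound i' i) hQ hx

theorem sum_length_send_toAlgorithm_le (hDm : D ≤ mem) (hout : ∀ i, (out (Y i)).length ≤ mem)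
    {t : ℕ} (ht : t < rs.length + 2) (i : Fin M) :
    ∑ j, ((toAlgorithm mem Q inp rs out).send t i
      ((toAlgorithm mem Q inp rs out).config init ω t i) (ω ⟨t, ht⟩ i) j).length ≤ mem := by
  rcases t with _ | t
  · exact (sum_length_ite i (encode (inp i (init i)))).le.trans ((length_encode_le _).trans hDm)
  rcases Nat.lt_or_ge t rs.length with h | h
  · refine (Finset.sum_congr rfl fun j _ => ?_).trans_le ((stepOK_slots hY h).sends i)
    rw [← length_encode]
    exact congrArg List.length (send_toAlgorithm_of_lt init ω h ht i j)
  · obtain rfl : t = rs.length := by omega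
    refine (Finset.sum_congr rfl fun j _ => ?_).trans_le
      ((sum_length_ite i (out (Y i))).le.trans (hout i))
    rw [← slots_length hY]
    exact congrArg List.length (send_toAlgorithm_length init ω ht i j)

omit hY in
theorem toAlgorithm_obeysLimits (hDm : D ≤ mem) (hQ : D * K ≤ Q)
    (hlen : ∀ i, (init i).length ≤ mem) (hword : ∀ i, ∀ x ∈ init i, x < Q)
    (hinp : ∀ i s, inp i (init i) s < K)
    {Y : (toAlgorithm mem Q inp rs out).Coins → Fin M → Fin D → ℕ}
    (hY : ∀ ω, Exec mem K rs (roundCoins ω) (fun i => inp i (init i)) (Y ω))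
    (hout : ∀ ω i, (out (Y ω i)).length ≤ mem ∧ ∀ x ∈ out (Y ω i), x < Q) :
    (toAlgorithm mem Q inp rs out).ObeysLimits init := by
  refine fun ω => ⟨fun t ht i => ?_, fun ⟨t, ht⟩ i =>
    sum_length_send_toAlgorithm_le (hY ω) hDm (fun i => (hout ω i).1) ht i⟩
  rcases t with _ | t
  · exact ⟨hlen i, hword i⟩
  rcases Nat.lt_or_ge rs.length t with h | h
  · obtain rfl : t = rs.length + 1 := le_antisymm (Nat.le_of_succ_le_succ ht) h
    have hlast := hout ω i
    rwa [← slots_length (hY ω), ← output_toAlgorithm init ω] at hlast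
  · obtain ⟨hlength, hlt⟩ := config_toAlgorithm_limits (hY ω) hQ hinp h i
    exact ⟨hlength.trans hDm, hlt⟩

theorem output_toAlgorithm_eq :
    (toAlgorithm mem Q inp rs out).output init ω = fun i => out (Y i) :=
  funext fun i => by rw [output_toAlgorithm, slots_length hY]

end ToAlgorithm

end CellMachine

/-! ### Routing and prefix sums of distributed arrays -/

namespace CellMachine

section Blocks

variable {M d : ℕ}

/-- Slot `o` of the main half of a memory. -/
def mainSlot (o : Fin d) : Fin (2 * d) := ⟨o, by omega⟩

/-- Slot `o` of the auxiliary half of a memory. -/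
def auxSlot (o : Fin d) : Fin (2 * d) := ⟨d + o, by omega⟩

/-- The array `x`, distributed over the main halves of the memories in blocks of length `d`. -/
def ofArray (M d : ℕ) (x : ℕ → ℕ) : Fin M → Fin (2 * d) → ℕ :=
  fun i s => if (s : ℕ) < d then x (i * d + s) else 0

theorem ofArray_mainSlot (x : ℕ → ℕ) (i : Fin M) (o : Fin d) :
    ofArray M d x i (mainSlot o) = x (i * d + o) := by
  simp [ofArray, mainSlot]

theorem address_div {i o : ℕ} (ho : o < d) : (i * d + o) / d = i := by
  rw [mul_comm, Nat.mul_add_div (Nat.zero_lt_of_lt ho), Nat.div_eq_of_lt ho, add_zero]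

theorem address_mod {i o : ℕ} (ho : o < d) : (i * d + o) % d = o := by
  rw [mul_comm, Nat.mul_add_mod, Nat.mod_eq_of_lt ho]

theorem address_lt (i : Fin M) {o : ℕ} (ho : o < d) : i * d + o < M * d :=
  (Nat.div_lt_iff_lt_mul (Nat.zero_lt_of_lt ho)).1 ((address_div ho).trans_lt i.2)

theorem address_inj {i i' o o' : ℕ} (ho : o < d) (ho' : o' < d)
    (h : i * d + o = i' * d + o') : i = i' ∧ o = o' := by
  obtain rfl : i = i' :=
    (address_div ho).symm.trans ((congrArg (· / d) h).trans (address_div ho'))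
  exact ⟨rfl, Nat.add_left_cancel h⟩

theorem ofArray_congr {x y : ℕ → ℕ} (h : ∀ p < M * d, x p = y p) :
    ofArray M d x = ofArray M d y := by
  funext i s
  unfold ofArray
  split_ifs with hs
  · exact h _ (address_lt i hs)
  · rfl

theorem sum_blocks {α : Type*} [AddCommMonoid α] (F : ℕ → α) :
    ∑ i : Fin M, ∑ o : Fin d, F (i * d + o) = ∑ p ∈ Finset.range (M * d), F p := by
  rw [Finset.sum_range, ← Fintype.sum_prod_type', ← finProdFinEquiv.sum_comp]
  refine Finset.sum_congr rfl fun x _ => ?_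
  simp [finProdFinEquiv, mul_comm, add_comm]

end Blocks

section Limits

variable {M D : ℕ}

theorem sum_card_ne_zero_le {κ : Type*} [Fintype κ] {msg : Fin M → Fin D → ℕ}
    (src : Fin M → Fin D → κ → Prop) (hsrc : ∀ j s, msg j s ≠ 0 → ∃ b, src j s b)
    (hinj : ∀ b j s j' s', src j s b → src j' s' b → j = j' ∧ s = s') :
    ∑ j, (Finset.univ.filter fun s => msg j s ≠ 0).card ≤ Fintype.card κ := by
  rw [← Finset.card_sigma]
  refine Finset.card_le_card_of_forall_subsingleton (t := Finset.univ)
    (fun a b => src a.1 a.2 b) (fun a ha => ?_) fun b _ a ha a' ha' => ?_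
  · obtain ⟨b, hb⟩ := hsrc _ _ (Finset.mem_filter.1 (Finset.mem_sigma.1 ha).2).2
    exact ⟨b, Finset.mem_univ _, hb⟩
  · obtain ⟨hj, hs⟩ := hinj b _ _ _ _ ha.2 ha'.2
    exact Sigma.ext hj (heq_of_eq hs)

theorem stepOK_of_shift {mem K : ℕ} {r : Round M D} {c : Fin M → ℕ → ℕ} {X : Fin M → Fin D → ℕ}
    (hmem : D ≤ mem) (shift : Fin D → ℕ)
    (hshift : ∀ i j s, r i (X i) (c i) j s ≠ 0 → (j : ℕ) = i + shift s)
    (hbound : ∀ i j s, r i (X i) (c i) j s < K) : StepOK mem K r c X where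
  unique j s i i' h h' := by
    have := hshift i j s h
    have := hshift i' j s h'
    exact Fin.ext (by omega)
  sends i := by
    refine (sum_card_ne_zero_le (κ := Fin D) (fun j s b => s = b ∧ (j : ℕ) = i + shift b)
      (fun j s h => ⟨s, rfl, hshift i j s h⟩) ?_).trans ((Fintype.card_fin D).trans_le hmem)
    rintro b j s j' s' ⟨rfl, hj⟩ ⟨rfl, hj'⟩
    exact ⟨Fin.ext (hj.trans hj'.symm), rfl⟩
  bound := hbound

end Limits

section Route

/-- Every cell `p` with content `v` and coin `c` sends `f p v c` to the cell `dst p v`. -/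
def routeRound (M d : ℕ) (dst : ℕ → ℕ → ℕ) (f : ℕ → ℕ → ℕ → ℕ) : Round M (2 * d) :=
  fun i X c j s => if (s : ℕ) < d then
    ∑ o : Fin d, if dst (i * d + o) (X (mainSlot o)) = j * d + s then
      f (i * d + o) (X (mainSlot o)) (c o) else 0
  else 0

/-- The array after `routeRound`. -/
def routeArray (P : ℕ) (dst : ℕ → ℕ → ℕ) (f : ℕ → ℕ → ℕ → ℕ) (c x : ℕ → ℕ) : ℕ → ℕ :=
  fun q => ∑ p ∈ Finset.range P, if dst p (x p) = q then f p (x p) (c p) else 0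

variable {dst : ℕ → ℕ → ℕ} {f : ℕ → ℕ → ℕ → ℕ} {x : ℕ → ℕ}

theorem routeArray_apply {P : ℕ} {c : ℕ → ℕ}
    (hinj : Set.InjOn (fun p => dst p (x p)) {p | p < P ∧ f p (x p) (c p) ≠ 0})
    {p : ℕ} (hp : p < P) (hf : f p (x p) (c p) ≠ 0) :
    routeArray P dst f c x (dst p (x p)) = f p (x p) (c p) := by
  rw [routeArray, Finset.sum_eq_single p]
  · rw [if_pos rfl]
  · intro q hq hqp
    by_contra h
    simp only [ite_eq_right_iff, Classical.not_imp] at h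
    exact hqp (hinj ⟨Finset.mem_range.1 hq, h.2⟩ ⟨hp, hf⟩ h.1)
  · exact fun h => absurd (Finset.mem_range.2 hp) h

theorem routeArray_eq_zero {P : ℕ} {c : ℕ → ℕ} {q : ℕ}
    (h : ∀ p < P, f p (x p) (c p) ≠ 0 → dst p (x p) ≠ q) : routeArray P dst f c x q = 0 := by
  refine Finset.sum_eq_zero fun p hp => ?_
  by_contra hne
  simp only [ite_eq_right_iff, Classical.not_imp] at hne
  exact h p (Finset.mem_range.1 hp) hne.2 hne.1

variable {M d : ℕ} {c : Fin M → ℕ → ℕ} {c' : ℕ → ℕ}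
  (hc : ∀ (i : Fin M) (o : Fin d), c i o = c' (i * d + o))

include hc

theorem routeRound_ofArray (i j : Fin M) (s : Fin (2 * d)) :
    routeRound M d dst f i (ofArray M d x i) (c i) j s = if (s : ℕ) < d then
      ∑ o : Fin d, if dst (i * d + o) (x (i * d + o)) = j * d + s then
        f (i * d + o) (x (i * d + o)) (c' (i * d + o)) else 0
    else 0 := by
  simp only [routeRound, ofArray_mainSlot, hc]

theorem exists_of_routeRound_ne_zero {i j : Fin M} {s : Fin (2 * d)}
    (h : routeRound M d dst f i (ofArray M d x i) (c i) j s ≠ 0) :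
    (s : ℕ) < d ∧ ∃ o : Fin d, dst (i * d + o) (x (i * d + o)) = j * d + s ∧
      f (i * d + o) (x (i * d + o)) (c' (i * d + o)) ≠ 0 := by
  rw [routeRound_ofArray hc] at h
  obtain ⟨hs, hsum⟩ := ite_ne_right_iff.1 h
  obtain ⟨o, -, ho⟩ := Finset.exists_ne_zero_of_sum_ne_zero hsum
  exact ⟨hs, o, ite_ne_right_iff.1 ho⟩

theorem step_routeRound :
    step (routeRound M d dst f) c (ofArray M d x) =
      ofArray M d (routeArray (M * d) dst f c' x) := by
  funext j s
  simp only [step, routeRound_ofArray hc, ofArray]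
  split_ifs
  · exact sum_blocks fun p => if dst p (x p) = j * d + s then f p (x p) (c' p) else 0
  · exact Finset.sum_const_zero

variable {mem K : ℕ}
  (hinj : Set.InjOn (fun p => dst p (x p)) {p | p < M * d ∧ f p (x p) (c' p) ≠ 0})

include hinj

theorem routeRound_lt (hK : 0 < K) (hf : ∀ p < M * d, f p (x p) (c' p) < K) (i j : Fin M)
    (s : Fin (2 * d)) : routeRound M d dst f i (ofArray M d x i) (c i) j s < K := by
  by_cases h : routeRound M d dst f i (ofArray M d x i) (c i) j s = 0
  · rwa [h]
  obtain ⟨hs, o, ho, hfo⟩ := exists_of_routeRound_ne_zero hc h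
  rw [routeRound_ofArray hc, if_pos hs, Finset.sum_eq_single o]
  · rw [if_pos ho]
    exact hf _ (address_lt i o.2)
  · intro o' _ hne
    by_contra hne'
    obtain ⟨ho', hfo'⟩ := ite_ne_right_iff.1 hne'
    have := hinj ⟨address_lt i o.2, hfo⟩ ⟨address_lt i o'.2, hfo'⟩ (ho.trans ho'.symm)
    exact hne (Fin.ext (address_inj o.2 o'.2 this).2).symm
  · exact fun h => absurd (Finset.mem_univ _) h

theorem stepOK_routeRound (hmem : d ≤ mem) (hK : 0 < K)
    (hf : ∀ p < M * d, f p (x p) (c' p) < K) :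
    StepOK mem K (routeRound M d dst f) c (ofArray M d x) where
  unique j s i i' h h' := by
    obtain ⟨-, o, ho, hfo⟩ := exists_of_routeRound_ne_zero hc h
    obtain ⟨-, o', ho', hfo'⟩ := exists_of_routeRound_ne_zero hc h'
    have := hinj ⟨address_lt i o.2, hfo⟩ ⟨address_lt i' o'.2, hfo'⟩ (ho.trans ho'.symm)
    exact Fin.ext (address_inj o.2 o'.2 this).1
  sends i := by
    refine (sum_card_ne_zero_le (κ := Fin d)
      (fun j s o => dst (i * d + o) (x (i * d + o)) = j * d + s ∧ (s : ℕ) < d) ?_ ?_).trans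
      ((Fintype.card_fin d).trans_le hmem)
    · intro j s h
      obtain ⟨hs, o, ho, -⟩ := exists_of_routeRound_ne_zero hc h
      exact ⟨o, ho, hs⟩
    · rintro o j s j' s' ⟨hdst, hs⟩ ⟨hdst', hs'⟩
      exact (address_inj hs hs' (hdst.symm.trans hdst')).imp Fin.ext Fin.ext
  bound := routeRound_lt hc hinj hK hf

end Route

section Scan

/-- Every machine sends the sum over its block to the next machine. -/
def scanFirst (M d : ℕ) {α : Type*} [AddCommMonoid α] (e : α ≃ ℕ) (g : ℕ → ℕ → α) :
    Round M (2 * d) := fun i X _ j s =>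
  if (s : ℕ) < d then (if j = i then X s else 0)
  else if (s : ℕ) = d ∧ (j : ℕ) = i + 1 then
    e (∑ o : Fin d, g (i * d + o) (X (mainSlot o))) else 0

/-- Every machine sends the sum over its window to the machines at the distances
`0, z, 2 * z, …`. -/
def scanMiddle (M d : ℕ) {α : Type*} [AddCommMonoid α] (e : α ≃ ℕ) (z : ℕ) : Round M (2 * d) :=
  fun i X _ j s =>
  if (s : ℕ) < d then (if j = i then X s else 0)
  else if (j : ℕ) = i + (s - d) * z then e (∑ o : Fin d, e.symm (X (auxSlot o))) else 0

/-- Every machine updates its block, given the sum over all preceding blocks. -/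
def scanLast (M d : ℕ) {α : Type*} [AddCommMonoid α] (e : α ≃ ℕ) (g : ℕ → ℕ → α)
    (f : ℕ → ℕ → α → ℕ) : Round M (2 * d) := fun i X _ j s =>
  if (s : ℕ) < d then (if j = i then f (i * d + s) (X s)
    ((∑ o : Fin d, e.symm (X (auxSlot o))) +
      ∑ o : Fin d, if (o : ℕ) < s then g (i * d + o) (X (mainSlot o)) else 0) else 0)
  else 0

/-- The rounds that replace the content `v` of each cell `p` by `f p v b`, where `b` is the sum of
the values `g q u` over all preceding cells `q` with contents `u`; here `d ^ H` is at least `M`, and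
`e` encodes the values as payloads. -/
def scanRounds (M d H : ℕ) {α : Type*} [AddCommMonoid α] (e : α ≃ ℕ) (g : ℕ → ℕ → α)
    (f : ℕ → ℕ → α → ℕ) : List (Round M (2 * d)) :=
  scanFirst M d e g :: ((List.range H).map fun h => scanMiddle M d e (d ^ h)) ++
    [scanLast M d e g f]

variable {M d : ℕ} {α : Type*} [AddCommMonoid α] (e : α ≃ ℕ) (g : ℕ → ℕ → α)

theorem length_scanRounds (H : ℕ) (f : ℕ → ℕ → α → ℕ) :
    (scanRounds M d H e g f).length = H + 2 := by
  simp [scanRounds]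

/-- The sum over the `z` blocks before block `i`. -/
def windowSum (M d : ℕ) (g : ℕ → ℕ → α) (x : ℕ → ℕ) (z i : ℕ) : α :=
  ∑ p ∈ (Finset.range (M * d)).filter fun p => p / d < i ∧ i ≤ p / d + z, g p (x p)

/-- The main halves hold `x`, the auxiliary halves the sums over windows of length `z`. -/
structure ScanInv (M d : ℕ) (e : α ≃ ℕ) (g : ℕ → ℕ → α) (x : ℕ → ℕ) (z : ℕ)
    (X : Fin M → Fin (2 * d) → ℕ) : Prop where
  main : ∀ i (s : Fin (2 * d)), (s : ℕ) < d → X i s = x (i * d + s)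
  aux : ∀ i, ∑ o : Fin d, e.symm (X i (auxSlot o)) = windowSum M d g x z i

section WindowSum

-- A window of `z * d` blocks consists of `d` windows of `z` blocks.
theorem windowSum_mul {z : ℕ} (hz : 0 < z) (x : ℕ → ℕ) (j : ℕ) :
    windowSum M d g x (z * d) j =
      ∑ o : Fin d, if o * z ≤ j then windowSum M d g x z (j - o * z) else 0 := by
  rw [← Finset.sum_range fun o => if o * z ≤ j then windowSum M d g x z (j - o * z) else 0]
  unfold windowSum
  rw [← Finset.sum_fiberwise_of_maps_to (t := Finset.range d) (g := fun p => (j - 1 - p / d) / z)]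
  · refine Finset.sum_congr rfl fun o ho => ?_
    rw [Finset.mem_range] at ho
    have hle : (o + 1) * z ≤ z * d := by rw [mul_comm]; exact Nat.mul_le_mul_left z ho
    have hsucc : (o + 1) * z = o * z + z := Nat.succ_mul _ _
    rw [Finset.filter_filter]
    split_ifs with h
    · refine Finset.sum_congr (Finset.filter_congr fun p _ => ?_) fun _ _ => rfl
      rw [Nat.div_eq_iff hz]
      generalize p / d = q
      omega
    · refine Finset.sum_eq_zero fun p hp => ?_
      rw [Finset.mem_filter, Nat.div_eq_iff hz] at hp
      generalize p / d = q at hp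
      omega
  · intro p hp
    rw [Finset.mem_filter] at hp
    rw [Finset.mem_range, Nat.div_lt_iff_lt_mul hz, mul_comm]
    omega

theorem windowSum_one_succ (i : ℕ) (hi : i < M) (x : ℕ → ℕ) :
    windowSum M d g x 1 (i + 1) = ∑ o : Fin d, g (i * d + o) (x (i * d + o)) := by
  rw [← Finset.sum_range fun o => g (i * d + o) (x (i * d + o))]
  symm
  refine Finset.sum_bij (fun o _ => i * d + o) ?_ ?_ ?_ fun _ _ => rfl
  · intro o ho
    rw [Finset.mem_range] at ho
    rw [Finset.mem_filter, Finset.mem_range, address_div ho]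
    exact ⟨address_lt ⟨i, hi⟩ ho, Nat.lt_succ_self i, le_rfl⟩
  · exact fun o _ o' _ h => Nat.add_left_cancel h
  · intro p hp
    rw [Finset.mem_filter, Finset.mem_range] at hp
    have hd : 0 < d := Nat.pos_of_ne_zero fun h => by simp [h] at hp
    have hdiv : p / d = i := by omega
    exact ⟨p % d, Finset.mem_range.2 (Nat.mod_lt _ hd), by
      rw [← hdiv, mul_comm]; exact Nat.div_add_mod p d⟩

theorem windowSum_zero_right (x : ℕ → ℕ) (z : ℕ) : windowSum M d g x z 0 = 0 := by
  simp [windowSum]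

theorem windowSum_eq_sum_range {z : ℕ} (hz : M ≤ z) (x : ℕ → ℕ) (i : Fin M) :
    windowSum M d g x z i = ∑ p ∈ Finset.range (i * d), g p (x p) := by
  rcases Nat.eq_zero_or_pos d with rfl | hd
  · simp [windowSum]
  unfold windowSum
  congr 1
  ext p
  rw [Finset.mem_filter, Finset.mem_range, Finset.mem_range, Nat.div_lt_iff_lt_mul hd]
  have hle : (i : ℕ) * d ≤ M * d := Nat.mul_le_mul_right d i.2.le
  have := i.2
  generalize p / d = q
  omega

end WindowSum

theorem sum_ite_eq_add {M : ℕ} (j : Fin M) (k : ℕ) (F : ℕ → ℕ) :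
    (∑ i : Fin M, if (j : ℕ) = i + k then F i else 0) = if k ≤ j then F (j - k) else 0 := by
  split_ifs with h
  · rw [Finset.sum_eq_single ⟨j - k, by omega⟩]
    · rw [if_pos (by simp only; omega)]
    · exact fun i _ hi => if_neg fun h' => hi (Fin.ext (by simp only; omega))
    · simp
  · exact Finset.sum_eq_zero fun i _ => if_neg (by omega)

variable {e} (he : e 0 = 0)

include he

theorem symm_ite (p : Prop) [Decidable p] (a : α) :
    e.symm (if p then e a else 0) = if p then a else 0 := by
  split_ifs
  · exact e.symm_apply_apply a
  · rw [Equiv.symm_apply_eq, he]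

variable {g} {mem K : ℕ} (hmem : 2 * d ≤ mem) {x : ℕ → ℕ} (hx : ∀ p, x p < K)
  (hg : ∀ s : Finset ℕ, s ⊆ Finset.range (M * d) → e (∑ p ∈ s, g p (x p)) < K)

include hg in
omit he in
theorem windowSum_lt (z i : ℕ) : e (windowSum M d g x z i) < K :=
  hg _ (Finset.filter_subset _ _)

section First

include hx hg hmem in
omit he in
theorem stepOK_scanFirst (c : Fin M → ℕ → ℕ) :
    StepOK mem K (scanFirst M d e g) c (ofArray M d x) := by
  have hK : 0 < K := (Nat.zero_le _).trans_lt (hx 0)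
  refine stepOK_of_shift hmem (fun s => if (s : ℕ) < d then 0 else 1) ?_ ?_
  · intro i j s h
    simp only [scanFirst] at h
    split_ifs at h ⊢ <;> simp_all
  · intro i j s
    simp only [scanFirst]
    split_ifs with hs
    · simpa only [ofArray, if_pos hs] using hx _
    · exact hK
    · simp only [ofArray_mainSlot, ← windowSum_one_succ g i i.2 x]
      exact windowSum_lt hg _ _
    · exact hK

omit he in
theorem scanFirst_ofArray_auxSlot (c : Fin M → ℕ → ℕ) (i j : Fin M) (o : Fin d) :
    scanFirst M d e g i (ofArray M d x i) (c i) j (auxSlot o) =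
      if (o : ℕ) = 0 then (if (j : ℕ) = i + 1 then e (windowSum M d g x 1 (i + 1)) else 0)
      else 0 := by
  simp only [scanFirst, ofArray_mainSlot, ← windowSum_one_succ g i i.2 x]
  rw [if_neg (by simp [auxSlot])]
  by_cases h : (o : ℕ) = 0 <;> simp [auxSlot, h]

theorem scanInv_scanFirst (hd : 0 < d) (c : Fin M → ℕ → ℕ) :
    ScanInv M d e g x 1 (step (scanFirst M d e g) c (ofArray M d x)) where
  main j s hs := by simp [step, scanFirst, hs, ofArray]
  aux j := by
    have haux (o : Fin d) : step (scanFirst M d e g) c (ofArray M d x) j (auxSlot o) =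
        if (o : ℕ) = 0 then e (windowSum M d g x 1 j) else 0 := by
      simp only [step, scanFirst_ofArray_auxSlot]
      split_ifs
      · rw [sum_ite_eq_add j 1 fun i => e (windowSum M d g x 1 (i + 1))]
        split_ifs with hj
        · rw [Nat.sub_add_cancel hj]
        · rw [Nat.eq_zero_of_not_pos hj, windowSum_zero_right, he]
      · exact Finset.sum_const_zero
    simp only [haux, symm_ite he]
    rw [Finset.sum_eq_single ⟨0, hd⟩]
    · rfl
    · exact fun o _ ho => if_neg fun h => ho (Fin.ext h)
    · simp

end First

section Middle

variable {z : ℕ} {X : Fin M → Fin (2 * d) → ℕ} (hX : ScanInv M d e g x z X)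

include hX

omit he in
include hmem hx hg in
theorem stepOK_scanMiddle (c : Fin M → ℕ → ℕ) : StepOK mem K (scanMiddle M d e z) c X := by
  have hK : 0 < K := (Nat.zero_le _).trans_lt (hx 0)
  refine stepOK_of_shift hmem (fun s => if (s : ℕ) < d then 0 else (s - d) * z) ?_ ?_
  · intro i j s h
    simp only [scanMiddle] at h
    split_ifs at h ⊢ <;> simp_all
  · intro i j s
    simp only [scanMiddle]
    split_ifs with hs
    · rw [hX.main i s hs]
      exact hx _
    · exact hK
    · rw [hX.aux]
      exact windowSum_lt hg _ _
    · exact hK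

theorem scanInv_scanMiddle (hz : 0 < z) (c : Fin M → ℕ → ℕ) :
    ScanInv M d e g x (z * d) (step (scanMiddle M d e z) c X) where
  main j s hs := by simp [step, scanMiddle, hs, hX.main]
  aux j := by
    have haux (i : Fin M) (o : Fin d) : scanMiddle M d e z i (X i) (c i) j (auxSlot o) =
        if (j : ℕ) = i + o * z then e (windowSum M d g x z i) else 0 := by
      simp only [scanMiddle, hX.aux]
      rw [if_neg (by simp [auxSlot])]
      simp [auxSlot]
    rw [windowSum_mul g hz x j]
    refine Finset.sum_congr rfl fun o _ => ?_
    simp only [step, haux]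
    rw [sum_ite_eq_add j (o * z) fun i => e (windowSum M d g x z i), symm_ite he]

end Middle

include hmem hx hg in
theorem exists_exec_scanMiddle (hd : 0 < d) (H : ℕ) (c : ℕ → Fin M → ℕ → ℕ)
    {X : Fin M → Fin (2 * d) → ℕ} (hX : ScanInv M d e g x 1 X) :
    ∃ Y, Exec mem K ((List.range H).map fun h => scanMiddle M d e (d ^ h)) c X Y ∧
      ScanInv M d e g x (d ^ H) Y := by
  induction H with
  | zero => exact ⟨X, rfl, by rwa [pow_zero]⟩
  | succ H ih =>
    obtain ⟨Y, hexec, hY⟩ := ih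
    rw [List.range_succ, List.map_append, pow_succ]
    exact ⟨_, hexec.append ⟨stepOK_scanMiddle hmem hx hg hY _, rfl⟩,
      scanInv_scanMiddle he hY (pow_pos hd H) _⟩

section Last

variable {f : ℕ → ℕ → α → ℕ} {z : ℕ} (hz : M ≤ z) {X : Fin M → Fin (2 * d) → ℕ}
  (hX : ScanInv M d e g x z X)

include hz hX

omit he in
theorem scanLast_apply (c : ℕ → ℕ) (i j : Fin M) (s : Fin (2 * d)) :
    scanLast M d e g f i (X i) c j s = if (s : ℕ) < d then (if j = i then
      f (i * d + s) (x (i * d + s)) (∑ q ∈ Finset.range (i * d + s), g q (x q)) else 0)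
      else 0 := by
  unfold scanLast
  refine if_ctx_congr Iff.rfl (fun hs => ?_) fun _ => rfl
  have hmain (o : Fin d) : X i (mainSlot o) = x (i * d + o) := hX.main i _ o.2
  have hfilter : (Finset.range d).filter (· < (s : ℕ)) = Finset.range s := by
    ext o
    simp only [Finset.mem_filter, Finset.mem_range]
    omega
  rw [hX.main i s hs, hX.aux, windowSum_eq_sum_range g hz, Finset.sum_range_add]
  simp only [hmain]
  rw [← Finset.sum_range fun o => if o < (s : ℕ) then g (i * d + o) (x (i * d + o)) else 0,
    ← Finset.sum_filter, hfilter]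

omit he in
include hmem in
theorem stepOK_scanLast (hK : 0 < K)
    (hf : ∀ p < M * d, f p (x p) (∑ q ∈ Finset.range p, g q (x q)) < K) (c : Fin M → ℕ → ℕ) :
    StepOK mem K (scanLast M d e g f) c X := by
  refine stepOK_of_shift hmem (fun _ => 0) ?_ ?_
  · intro i j s h
    simp only [scanLast] at h
    split_ifs at h <;> simp_all
  · intro i j s
    rw [scanLast_apply hz hX]
    split_ifs with hs
    · exact hf _ (address_lt i hs)
    · exact hK
    · exact hK

omit he in
theorem step_scanLast (c : Fin M → ℕ → ℕ) : step (scanLast M d e g f) c X =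
    ofArray M d fun p => f p (x p) (∑ q ∈ Finset.range p, g q (x q)) := by
  funext j s
  simp only [step, scanLast_apply hz hX, ofArray]
  split_ifs
  · rw [Finset.sum_ite_eq, if_pos (Finset.mem_univ _)]
  · exact Finset.sum_const_zero

end Last

include hmem hx hg in
theorem exec_scanRounds (hd : 0 < d) {H : ℕ} (hH : M ≤ d ^ H) {f : ℕ → ℕ → α → ℕ}
    (hf : ∀ p < M * d, f p (x p) (∑ q ∈ Finset.range p, g q (x q)) < K)
    (c : ℕ → Fin M → ℕ → ℕ) :
    Exec mem K (scanRounds M d H e g f) c (ofArray M d x)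
      (ofArray M d fun p => f p (x p) (∑ q ∈ Finset.range p, g q (x q))) := by
  have hK : 0 < K := (Nat.zero_le _).trans_lt (hx 0)
  obtain ⟨Y, hexec, hY⟩ := exists_exec_scanMiddle he hmem hx hg hd H (fun t => c (t + 1))
    (scanInv_scanFirst he hd (c 0))
  exact ⟨stepOK_scanFirst hmem hx hg _, hexec.append ⟨stepOK_scanLast hmem hH hY hK hf _,
    step_scanLast hH hY _⟩⟩

end Scan

end CellMachine

namespace CellMachine

/-- The parameters of the array machine fit together. -/
structure Params (M d H mem K : ℕ) : Prop where
  block_pos : 0 < d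
  mem_le : 2 * d ≤ mem
  height : M ≤ d ^ H
  size_lt : M * d < K

/-- Without using coins, the rounds `rs` turn the array `x` into the array `y`. -/
def Computes {M d : ℕ} (mem K : ℕ) (rs : List (Round M (2 * d))) (x y : ℕ → ℕ) : Prop :=
  ∀ c, Exec mem K rs c (ofArray M d x) (ofArray M d y)

theorem Computes.append {M d mem K : ℕ} {rs rs' : List (Round M (2 * d))} {x y z : ℕ → ℕ}
    (h : Computes mem K rs x y) (h' : Computes mem K rs' y z) : Computes mem K (rs ++ rs') x z :=
  fun c => (h c).append (h' _)

theorem Computes.congr_right {M d mem K : ℕ} {rs : List (Round M (2 * d))} {x y y' : ℕ → ℕ}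
    (h : Computes mem K rs x y) (hy : ∀ p < M * d, y p = y' p) : Computes mem K rs x y' := by
  intro c
  rw [← ofArray_congr hy]
  exact h c

/-- The natural numbers with `max` as addition. -/
@[ext]
structure MaxNat where
  val : ℕ

instance : Add MaxNat := ⟨fun a b => ⟨max a.val b.val⟩⟩

instance : Zero MaxNat := ⟨⟨0⟩⟩

instance : AddCommMonoid MaxNat where
  add_assoc a b c := MaxNat.ext (max_assoc a.val b.val c.val)
  add_comm a b := MaxNat.ext (max_comm a.val b.val)
  zero_add a := MaxNat.ext (max_eq_right (Nat.zero_le a.val))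
  add_zero a := MaxNat.ext (max_eq_left (Nat.zero_le a.val))
  nsmul := nsmulRec

/-- The value of an element of `MaxNat`. -/
def MaxNat.equiv : MaxNat ≃ ℕ where
  toFun := MaxNat.val
  invFun := MaxNat.mk
  left_inv _ := rfl
  right_inv _ := rfl

theorem MaxNat.val_sum {ι : Type*} (s : Finset ι) (f : ι → ℕ) :
    (∑ i ∈ s, MaxNat.mk (f i)).val = s.sup f := by
  classical
  induction s using Finset.induction_on with
  | empty => rfl
  | insert a s ha ih =>
    rw [Finset.sum_insert ha, Finset.sup_insert, ← ih]
    rfl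

/-- Scanning with respect to addition. -/
def scanSum (M d H : ℕ) (g : ℕ → ℕ → ℕ) (f : ℕ → ℕ → ℕ → ℕ) : List (Round M (2 * d)) :=
  scanRounds M d H (Equiv.refl ℕ) g f

/-- Scanning with respect to the maximum. -/
def scanMax (M d H : ℕ) (g : ℕ → ℕ → ℕ) (f : ℕ → ℕ → ℕ → ℕ) : List (Round M (2 * d)) :=
  scanRounds M d H MaxNat.equiv (fun p v => ⟨g p v⟩) fun p v b => f p v b.val

theorem length_scanSum (M d H : ℕ) (g : ℕ → ℕ → ℕ) (f : ℕ → ℕ → ℕ → ℕ) :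
    (scanSum M d H g f).length = H + 2 :=
  length_scanRounds _ _ _ _

theorem length_scanMax (M d H : ℕ) (g : ℕ → ℕ → ℕ) (f : ℕ → ℕ → ℕ → ℕ) :
    (scanMax M d H g f).length = H + 2 :=
  length_scanRounds _ _ _ _

section

variable {M d H mem K : ℕ} (hP : Params M d H mem K)
include hP

theorem Params.pos : 0 < K := (Nat.zero_le _).trans_lt hP.size_lt

theorem scanSum_computes {x : ℕ → ℕ} {g : ℕ → ℕ → ℕ} {f : ℕ → ℕ → ℕ → ℕ} (hx : ∀ p, x p < K)
    (hg : ∀ p v, g p v ≤ 1)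
    (hf : ∀ p < M * d, f p (x p) (∑ q ∈ Finset.range p, g q (x q)) < K) :
    Computes mem K (scanSum M d H g f) x
      fun p => f p (x p) (∑ q ∈ Finset.range p, g q (x q)) := by
  refine exec_scanRounds rfl hP.mem_le hx ?_ hP.block_pos hP.height hf
  intro s hs
  refine lt_of_le_of_lt ?_ hP.size_lt
  calc (∑ p ∈ s, g p (x p)) ≤ ∑ p ∈ s, 1 := Finset.sum_le_sum fun _ _ => hg _ _
    _ = s.card := by simp
    _ ≤ (Finset.range (M * d)).card := Finset.card_le_card hs
    _ = M * d := Finset.card_range _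

theorem scanMax_computes {x : ℕ → ℕ} {g : ℕ → ℕ → ℕ} {f : ℕ → ℕ → ℕ → ℕ} (hx : ∀ p, x p < K)
    (hg : ∀ p, g p (x p) < K)
    (hf : ∀ p < M * d, f p (x p) ((Finset.range p).sup fun q => g q (x q)) < K) :
    Computes mem K (scanMax M d H g f) x
      fun p => f p (x p) ((Finset.range p).sup fun q => g q (x q)) := by
  have hexec := exec_scanRounds (mem := mem) (K := K) (x := x) (e := MaxNat.equiv)
    (g := fun p v => ⟨g p v⟩) (f := fun p v b => f p v b.val) rfl hP.mem_le hx ?_ hP.block_pos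
    hP.height ?_
  · simp only [MaxNat.val_sum] at hexec
    exact hexec
  · intro s _
    change (∑ p ∈ s, MaxNat.mk (g p (x p))).val < K
    rw [MaxNat.val_sum]
    exact (Finset.sup_lt_iff hP.pos).2 fun p _ => hg p
  · intro p hp
    simp only [MaxNat.val_sum]
    exact hf p hp

theorem route_computes {x : ℕ → ℕ} {dst f : ℕ → ℕ → ℕ} (hf : ∀ p < M * d, f p (x p) < K)
    (hinj : Set.InjOn (fun p => dst p (x p)) {p | p < M * d ∧ f p (x p) ≠ 0}) :
    Computes mem K [routeRound M d dst fun p v _ => f p v] x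
      (routeArray (M * d) dst (fun p v _ => f p v) 0 x) := by
  intro c
  -- The round does not look at its coins, so that we may pretend that they are all zero.
  have hok := stepOK_routeRound (M := M) (f := fun p v _ => f p v) (c := fun _ _ => 0)
    (c' := 0) (fun _ _ => rfl) hinj ((Nat.le_mul_of_pos_left d two_pos).trans hP.mem_le) hP.pos hf
  exact ⟨⟨hok.1, hok.2, hok.3⟩,
    step_routeRound (f := fun p v _ => f p v) (c := fun _ _ => 0) (c' := 0) fun _ _ => rfl⟩

end

/-- The array with the entries `a`, followed by empty cells. -/
def pad {N : ℕ} (a : Fin N → ℕ) (p : ℕ) : ℕ := if h : p < N then a ⟨p, h⟩ else 0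

theorem pad_val {N : ℕ} (a : Fin N → ℕ) (p : Fin N) : pad a p = a p := by simp [pad]

theorem pad_of_le {N : ℕ} (a : Fin N → ℕ) {p : ℕ} (h : N ≤ p) : pad a p = 0 := by
  simp [pad, h]

theorem pad_lt {N K : ℕ} {a : Fin N → ℕ} (hK : 0 < K) (ha : ∀ p, a p < K) (p : ℕ) :
    pad a p < K := by
  unfold pad
  split_ifs
  exacts [ha _, hK]

theorem sum_range_pad {N : ℕ} (a : Fin N → ℕ) (g : ℕ → ℕ → ℕ) (p : Fin N) :
    ∑ q ∈ Finset.range p, g q (pad a q) = ∑ q ∈ Finset.Iio p, g q (a q) := by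
  symm
  refine Finset.sum_bij (fun q _ => (q : ℕ)) ?_ ?_ ?_ ?_
  · intro q hq
    simpa using hq
  · intro q _ q' _ h; exact Fin.ext h
  · intro q hq
    rw [Finset.mem_range] at hq
    exact ⟨⟨q, by omega⟩, Finset.mem_Iio.2 hq, rfl⟩
  · intro q _; rw [pad_val]

theorem sup_range_pad {N : ℕ} (a : Fin N → ℕ) (g : ℕ → ℕ → ℕ) (p : Fin N) :
    ((Finset.range p).sup fun q => g q (pad a q)) = (Finset.Iio p).sup fun q => g q (a q) := by
  apply le_antisymm
  · refine Finset.sup_le fun q hq => ?_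
    rw [Finset.mem_range] at hq
    have h := Finset.le_sup (f := fun q : Fin N => g q (a q)) (s := Finset.Iio p)
      (b := ⟨q, by omega⟩) (Finset.mem_Iio.2 hq)
    simpa [← pad_val a] using h
  · refine Finset.sup_le fun q hq => ?_
    have h := Finset.le_sup (f := fun q : ℕ => g q (pad a q)) (s := Finset.range p)
      (b := q) (by simpa using hq)
    simpa [pad_val] using h

section

variable {M d H mem K N : ℕ} (hP : Params M d H mem K) {a b : Fin N → ℕ}
include hP

theorem scanSum_pad {g : ℕ → ℕ → ℕ} {f : ℕ → ℕ → ℕ → ℕ} (ha : ∀ p, a p < K)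
    (hb : ∀ p, b p < K) (hg : ∀ p v, g p v ≤ 1)
    (hf0 : ∀ p z, f p 0 z = 0) (hf : ∀ p : Fin N, f p (a p) (∑ q ∈ Finset.Iio p, g q (a q)) = b p) :
    Computes mem K (scanSum M d H g f) (pad a) (pad b) := by
  have key : ∀ p, f p (pad a p) (∑ q ∈ Finset.range p, g q (pad a q)) = pad b p := by
    intro p
    by_cases h : p < N
    · have := hf ⟨p, h⟩
      rw [← sum_range_pad, ← pad_val a, ← pad_val b] at this
      exact this
    · rw [pad_of_le a (by omega), pad_of_le b (by omega), hf0]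
  refine (scanSum_computes hP (pad_lt hP.pos ha) hg ?_).congr_right fun p _ => key p
  intro p _
  rw [key]
  exact pad_lt hP.pos hb p

theorem scanMax_pad {g : ℕ → ℕ → ℕ} {f : ℕ → ℕ → ℕ → ℕ} (ha : ∀ p, a p < K)
    (hb : ∀ p, b p < K) (hg0 : ∀ p, g p 0 = 0) (hg : ∀ p : Fin N, g p (a p) < K)
    (hf0 : ∀ p z, f p 0 z = 0)
    (hf : ∀ p : Fin N, f p (a p) ((Finset.Iio p).sup fun q => g q (a q)) = b p) :
    Computes mem K (scanMax M d H g f) (pad a) (pad b) := by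
  have key : ∀ p, f p (pad a p) ((Finset.range p).sup fun q => g q (pad a q)) = pad b p := by
    intro p
    by_cases h : p < N
    · have := hf ⟨p, h⟩
      rw [← sup_range_pad, ← pad_val a, ← pad_val b] at this
      exact this
    · rw [pad_of_le a (by omega), pad_of_le b (by omega), hf0]
  refine (scanMax_computes hP (pad_lt hP.pos ha) ?_ ?_).congr_right fun p _ => key p
  · intro p
    by_cases h : p < N
    · have := hg ⟨p, h⟩
      rw [← pad_val a] at this
      exact this
    · rw [pad_of_le a (by omega), hg0]
      exact hP.pos
  · intro p _
    rw [key]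
    exact pad_lt hP.pos hb p

omit hP in
theorem injOn_dst_pad {dst f : ℕ → ℕ → ℕ} (τ : Equiv.Perm (Fin N)) (hf0 : ∀ p, f p 0 = 0)
    (hdst : ∀ p : Fin N, dst p (a p) = τ p) :
    Set.InjOn (fun p => dst p (pad a p)) {p | f p (pad a p) ≠ 0} := by
  have hlt : ∀ p, f p (pad a p) ≠ 0 → p < N := by
    intro p hp
    by_contra! h
    exact hp (by rw [pad_of_le a h, hf0])
  intro p hp q hq hpq
  lift p to Fin N using hlt p hp
  lift q to Fin N using hlt q hq
  simp only [pad_val, hdst] at hpq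
  rw [τ.injective (Fin.ext hpq)]

omit hP in
theorem routeArray_pad {P : ℕ} (hN : N ≤ P) {dst f : ℕ → ℕ → ℕ} {c : ℕ → ℕ}
    (τ : Equiv.Perm (Fin N)) (hf0 : ∀ p, f p 0 = 0) (hdst : ∀ p : Fin N, dst p (a p) = τ p)
    (hf : ∀ p : Fin N, f p (a p) = b (τ p)) :
    routeArray P dst (fun p v _ => f p v) c (pad a) = pad b := by
  funext q
  calc routeArray P dst (fun p v _ => f p v) c (pad a) q
      = ∑ p ∈ Finset.range N, if dst p (pad a p) = q then f p (pad a p) else 0 := by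
        refine (Finset.sum_subset (Finset.range_subset_range.2 hN) fun p _ hp => ?_).symm
        have hfp : f p (pad a p) = 0 := by
          rw [pad_of_le a (not_lt.1 fun h => hp (Finset.mem_range.2 h)), hf0]
        simp only [hfp, ite_self]
    _ = ∑ p : Fin N, if (τ p : ℕ) = q then b (τ p) else 0 := by
        simp only [Finset.sum_range, pad_val, hdst, hf]
    _ = ∑ p : Fin N, if (p : ℕ) = q then b p else 0 :=
        Equiv.sum_comp τ fun p => if (p : ℕ) = q then b p else 0
    _ = pad b q := by
        unfold pad
        split_ifs with hq
        · simp [← Fin.ext_iff (b := ⟨q, hq⟩)]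
        · exact Finset.sum_eq_zero fun p _ => if_neg fun hp : (p : ℕ) = q => hq (hp ▸ p.2)

theorem route_pad (hN : N ≤ M * d) {dst f : ℕ → ℕ → ℕ} (τ : Equiv.Perm (Fin N))
    (hb : ∀ p, b p < K) (hf0 : ∀ p, f p 0 = 0) (hdst : ∀ p : Fin N, dst p (a p) = τ p)
    (hf : ∀ p : Fin N, f p (a p) = b (τ p)) :
    Computes mem K [routeRound M d dst fun p v _ => f p v] (pad a) (pad b) := by
  rw [← routeArray_pad hN τ hf0 hdst hf]
  refine route_computes hP (fun p _ => ?_)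
    ((injOn_dst_pad τ hf0 hdst).mono fun p hp => hp.2)
  by_cases hp : p < N
  · lift p to Fin N using hp
    rw [pad_val, hf]
    exact hb _
  · rw [pad_of_le a (not_lt.1 hp), hf0]
    exact hP.pos

end

/-- The number of indices before `p` that satisfy `b`. -/
def countBefore {N : ℕ} (b : Fin N → Prop) [DecidablePred b] (p : Fin N) : ℕ :=
  ∑ q ∈ Finset.Iio p, if b q then 1 else 0

section Split

variable {N : ℕ} (b : Fin N → Prop) [DecidablePred b]

theorem countBefore_eq_card (p : Fin N) :
    countBefore b p = ((Finset.Iio p).filter b).card := by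
  rw [countBefore, Finset.card_filter]

theorem countBefore_add_not (p : Fin N) :
    countBefore b p + countBefore (fun q => ¬ b q) p = p := by
  rw [countBefore_eq_card, countBefore_eq_card, Finset.card_filter_add_card_filter_not,
    Fin.card_Iio]

variable {b}

theorem countBefore_lt {p q : Fin N} (hp : b p) (hpq : p < q) :
    countBefore b p < countBefore b q := by
  rw [countBefore_eq_card, countBefore_eq_card]
  refine Finset.card_lt_card (Finset.ssubset_iff_of_subset ?_ |>.2 ⟨p, ?_, ?_⟩)
  · intro r hr
    simp only [Finset.mem_filter, Finset.mem_Iio] at hr ⊢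
    exact ⟨hr.1.trans hpq, hr.2⟩
  · simp [hp, hpq]
  · simp

theorem countBefore_lt_card {p : Fin N} (hp : b p) :
    countBefore b p < (Finset.univ.filter b).card := by
  rw [countBefore_eq_card]
  refine Finset.card_lt_card (Finset.ssubset_iff_of_subset ?_ |>.2 ⟨p, ?_, ?_⟩)
  · intro r hr
    simp only [Finset.mem_filter, Finset.mem_Iio, Finset.mem_univ, true_and] at hr ⊢
    exact hr.2
  · simp [hp]
  · simp

variable (b)

/-- The new place of the index `p` when the indices satisfying `b` move to the front, in order, and
the others to the back, in reversed order. -/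
def splitIndex (p : Fin N) : ℕ :=
  if b p then countBefore b p else N - 1 - (p - countBefore b p)

theorem splitIndex_add_countBefore_not {p : Fin N} (hp : ¬ b p) :
    splitIndex b p + countBefore (fun q => ¬ b q) p + 1 = N := by
  have hlt := countBefore_lt_card (b := fun q => ¬ b q) hp
  have hle := (Finset.univ.filter fun q => ¬ b q).card_le_univ
  have hadd := countBefore_add_not b p
  rw [splitIndex, if_neg hp]
  rw [Fintype.card_fin] at hle
  omega

variable {b}

theorem splitIndex_lt_of_lt {p q : Fin N} (hp : b p) (hq : b q) (hpq : p < q) :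
    splitIndex b p < splitIndex b q := by
  rw [splitIndex, splitIndex, if_pos hp, if_pos hq]
  exact countBefore_lt hp hpq

theorem splitIndex_lt_of_not {p q : Fin N} (hp : b p) (hq : ¬ b q) :
    splitIndex b p < splitIndex b q := by
  have hcard := Finset.card_filter_add_card_filter_not (s := .univ) b
  rw [Finset.card_univ, Fintype.card_fin] at hcard
  have hltp := countBefore_lt_card hp
  have hltq := countBefore_lt_card (b := fun q => ¬ b q) hq
  have hq' := splitIndex_add_countBefore_not b hq
  rw [splitIndex, if_pos hp]
  omega

theorem splitIndex_lt_of_not_of_lt {p q : Fin N} (hp : ¬ b p) (hq : ¬ b q) (hpq : p < q) :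
    splitIndex b q < splitIndex b p := by
  have hlt := countBefore_lt (b := fun q => ¬ b q) hp hpq
  have hp' := splitIndex_add_countBefore_not b hp
  have hq' := splitIndex_add_countBefore_not b hq
  omega

theorem splitIndex_lt (p : Fin N) : splitIndex b p < N := by
  by_cases hp : b p
  · have hle := (Finset.univ.filter b).card_le_univ
    rw [Fintype.card_fin] at hle
    rw [splitIndex, if_pos hp]
    exact (countBefore_lt_card hp).trans_le hle
  · have := splitIndex_add_countBefore_not b hp
    omega

theorem splitIndex_ne_of_lt {p q : Fin N} (hpq : p < q) : splitIndex b p ≠ splitIndex b q := by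
  by_cases hp : b p <;> by_cases hq : b q
  · exact (splitIndex_lt_of_lt hp hq hpq).ne
  · exact (splitIndex_lt_of_not hp hq).ne
  · exact (splitIndex_lt_of_not hq hp).ne'
  · exact (splitIndex_lt_of_not_of_lt hp hq hpq).ne'

theorem injective_splitIndex : Function.Injective (splitIndex b) := fun _ _ h =>
  by_contra fun hne => (lt_or_gt_of_ne hne).elim (splitIndex_ne_of_lt · h)
    (splitIndex_ne_of_lt · h.symm)

variable (b)

/-- The permutation that moves the indices satisfying `b` to the front and reverses the others. -/
noncomputable def splitPerm : Equiv.Perm (Fin N) :=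
  Equiv.ofBijective (fun p => ⟨splitIndex b p, splitIndex_lt p⟩) <|
    Finite.injective_iff_bijective.1 fun _ _ h => injective_splitIndex (congrArg Fin.val h)

theorem val_splitPerm (p : Fin N) : (splitPerm b p : ℕ) = splitIndex b p := rfl

end Split

/-- Moves the records among the first `N` cells whose key is less than `t` to the front, and the
others, in reversed order, to the back. Records are nonzero and less than `K₁`. -/
def splitRounds (M d H N K₁ : ℕ) (key : ℕ → ℕ) (t : ℕ) : List (Round M (2 * d)) :=
  scanSum M d H (fun _ v => if v ≠ 0 ∧ key v < t then 1 else 0)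
    (fun p v z => if v = 0 then 0 else
      v + K₁ * if key v < t then z else N - 1 - (p - z)) ++
  [routeRound M d (fun _ v => v / K₁) fun _ v _ => v % K₁]

/-- Reverses the order of the keys in `[2 ^ B, 2 ^ (B + 1))` while deleting their leading bit. -/
def reflectKey (B k : ℕ) : ℕ := if k < 2 ^ B then k else 2 ^ (B + 1) - 1 - k

theorem reflectKey_lt {B k : ℕ} (hk : k < 2 ^ (B + 1)) : reflectKey B k < 2 ^ B := by
  rw [pow_succ] at hk
  rw [reflectKey, pow_succ]
  split_ifs <;> omega

/-- Sorts the first `N` cells by a key that is less than `2 ^ B`: a radix sort, one bit after the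
other. Splitting by a bit reverses the upper half, whence the reflection. -/
def sortRounds (M d H N K₁ : ℕ) : ℕ → (ℕ → ℕ) → List (Round M (2 * d))
  | 0, _ => []
  | B + 1, key =>
    sortRounds M d H N K₁ B (fun v => reflectKey B (key v)) ++ splitRounds M d H N K₁ key (2 ^ B)

theorem length_sortRounds (M d H N K₁ B : ℕ) (key : ℕ → ℕ) :
    (sortRounds M d H N K₁ B key).length = B * (H + 3) := by
  induction B generalizing key with
  | zero => simp [sortRounds]
  | succ B ih =>
    rw [sortRounds, List.length_append, ih, splitRounds, List.length_append, length_scanSum]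
    simp
    ring

section

variable {M d H mem K N K₁ : ℕ} (hP : Params M d H mem K)
include hP

theorem splitRounds_computes (hN : N ≤ M * d) (hK : K₁ * N < K) {a : Fin N → ℕ}
    (ha0 : ∀ p, a p ≠ 0) (ha : ∀ p, a p < K₁) (key : ℕ → ℕ) (t : ℕ) :
    Computes mem K (splitRounds M d H N K₁ key t) (pad a)
      (pad fun p => a ((splitPerm fun q => key (a q) < t).symm p)) := by
  set τ := splitPerm fun q => key (a q) < t with hτ
  have hpair : ∀ p : Fin N, a p + K₁ * (τ p : ℕ) < K := fun p =>
    calc a p + K₁ * (τ p : ℕ) < K₁ + K₁ * (τ p : ℕ) := Nat.add_lt_add_right (ha p) _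
      _ = K₁ * (τ p + 1) := by ring
      _ ≤ K₁ * N := Nat.mul_le_mul_left _ (τ p).2
      _ ≤ K := hK.le
  have haK : ∀ p, a p < K := fun p => (Nat.le_add_right _ _).trans_lt (hpair p)
  refine Computes.append (y := pad fun p => a p + K₁ * (τ p : ℕ)) ?_ ?_
  · refine scanSum_pad hP haK hpair (fun _ _ => by split_ifs <;> simp) (fun _ _ => if_pos rfl) ?_
    intro p
    rw [if_neg (ha0 p), hτ, val_splitPerm, splitIndex]
    simp [ha0, countBefore]
  · refine route_pad hP hN τ (fun _ => haK _) (fun _ => Nat.zero_mod _) ?_ ?_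
    · intro p
      rw [Nat.add_mul_div_left _ _ (Nat.zero_lt_of_lt (ha p)), Nat.div_eq_of_lt (ha p), zero_add]
    · intro p
      rw [Nat.add_mul_mod_self_left, Nat.mod_eq_of_lt (ha p), Equiv.symm_apply_apply]

omit hP in
theorem splitPerm_lt_of_reflectKey_lt {B : ℕ} {key : Fin N → ℕ} (hkey : ∀ p, key p < 2 ^ (B + 1))
    (hord : ∀ p q, reflectKey B (key p) < reflectKey B (key q) → p < q) {p q : Fin N}
    (h : key p < key q) :
    splitPerm (fun r => key r < 2 ^ B) p < splitPerm (fun r => key r < 2 ^ B) q := by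
  have hqk := hkey q
  rw [Fin.lt_def, val_splitPerm, val_splitPerm]
  by_cases hp : key p < 2 ^ B <;> by_cases hq : key q < 2 ^ B
  · refine splitIndex_lt_of_lt hp hq (hord p q ?_)
    rwa [reflectKey, reflectKey, if_pos hp, if_pos hq]
  · exact splitIndex_lt_of_not hp hq
  · omega
  · refine splitIndex_lt_of_not_of_lt hq hp (hord q p ?_)
    rw [reflectKey, reflectKey, if_neg hp, if_neg hq]
    rw [pow_succ] at hqk ⊢
    omega

theorem exists_sortRounds_computes (hN : N ≤ M * d) (hK : K₁ * N < K) {a : Fin N → ℕ}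
    (ha0 : ∀ p, a p ≠ 0) (ha : ∀ p, a p < K₁) (B : ℕ) (key : ℕ → ℕ)
    (hkey : ∀ p, key (a p) < 2 ^ B) :
    ∃ σ : Equiv.Perm (Fin N),
      Computes mem K (sortRounds M d H N K₁ B key) (pad a) (pad fun p => a (σ p)) ∧
      ∀ p q, key (a (σ p)) < key (a (σ q)) → p < q := by
  induction B generalizing key with
  | zero =>
    refine ⟨1, fun _ => rfl, fun p q h => ?_⟩
    have := hkey ((1 : Equiv.Perm (Fin N)) q)
    rw [pow_zero] at this
    omega
  | succ B ih =>
    obtain ⟨σ, hσ, hord⟩ := ih (fun v => reflectKey B (key v)) fun p => reflectKey_lt (hkey p)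
    set τ := splitPerm fun p => key (a (σ p)) < 2 ^ B
    refine ⟨τ.symm.trans σ, hσ.append (splitRounds_computes hP hN hK (fun p => ha0 _)
      (fun p => ha _) key _), fun p q h => ?_⟩
    obtain ⟨p, rfl⟩ := τ.surjective p
    obtain ⟨q, rfl⟩ := τ.surjective q
    simp only [Equiv.trans_apply, Equiv.symm_apply_apply] at h
    exact splitPerm_lt_of_reflectKey_lt (fun p => hkey (σ p)) hord h

end

end CellMachine

namespace CellMachine

/-- A record that describes one orientation of an edge (or a vertex, as an edge from the vertex to
itself) together with the current label of its source and the position of the reversed record. -/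
@[ext]
structure Entry where
  src : ℕ
  tgt : ℕ
  cost : ℕ
  lab : ℕ
  ptr : ℕ

namespace Entry

/-- All fields are less than `β`. -/
structure Bounded (β : ℕ) (e : Entry) : Prop where
  src : e.src < β
  tgt : e.tgt < β
  cost : e.cost < β
  lab : e.lab < β
  ptr : e.ptr < β

theorem Bounded.updateLab {β l : ℕ} {e : Entry} (h : e.Bounded β) (hl : l < β) :
    Bounded β { e with lab := l } :=
  ⟨h.src, h.tgt, h.cost, hl, h.ptr⟩

/-- The number that represents a record. It is positive because `0` stands for an empty cell. -/
def code (β : ℕ) (e : Entry) : ℕ :=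
  1 + (e.src + β * (e.tgt + β * (e.cost + β * (e.lab + β * e.ptr))))

/-- The record that a number represents. -/
def dec (β : ℕ) (v : ℕ) : Entry where
  src := (v - 1) % β
  tgt := (v - 1) / β % β
  cost := (v - 1) / β / β % β
  lab := (v - 1) / β / β / β % β
  ptr := (v - 1) / β / β / β / β

theorem code_ne_zero (β : ℕ) (e : Entry) : e.code β ≠ 0 := by
  simp [code]

theorem add_mul_lt {β x y k : ℕ} (hx : x < β) (hy : y < k) : x + β * y < β * k :=
  calc x + β * y < β + β * y := Nat.add_lt_add_right hx _
    _ = β * (y + 1) := by ring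
    _ ≤ β * k := Nat.mul_le_mul_left _ hy

theorem code_lt {β : ℕ} {e : Entry} (h : e.Bounded β) : e.code β < β ^ 5 + 1 := by
  have := add_mul_lt h.src (add_mul_lt h.tgt (add_mul_lt h.cost (add_mul_lt h.lab h.ptr)))
  rw [code, show β ^ 5 = β * (β * (β * (β * β))) by ring]
  omega

theorem dec_code {β : ℕ} {e : Entry} (h : e.Bounded β) : dec β (e.code β) = e := by
  have hβ : 0 < β := (Nat.zero_le _).trans_lt h.src
  have hd : ∀ x y, x < β → (x + β * y) / β = y := by
    intro x y hx
    rw [Nat.add_mul_div_left _ _ hβ, Nat.div_eq_of_lt hx, zero_add]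
  have hm : ∀ x y, x < β → (x + β * y) % β = x := by
    intro x y hx
    rw [Nat.add_mul_mod_self_left, Nat.mod_eq_of_lt hx]
  ext <;> simp only [dec, code, Nat.add_sub_cancel_left, hd _ _ h.src, hd _ _ h.tgt,
    hd _ _ h.cost, hd _ _ h.lab, hm _ _ h.src, hm _ _ h.tgt, hm _ _ h.cost, hm _ _ h.lab]

end Entry

/-- The array of the codes of records. -/
def entryArray {N : ℕ} (β : ℕ) (E : Fin N → Entry) : ℕ → ℕ := pad fun p => (E p).code β

/-- The function on codes that corresponds to a function on records. -/
def liftEntry (β : ℕ) (φ : Entry → Entry) (v : ℕ) : ℕ :=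
  if v = 0 then 0 else (φ (Entry.dec β v)).code β

/-- Every cell updates its record. -/
def mapRound (M d β : ℕ) (φ : ℕ → Entry → Entry) : Round M (2 * d) :=
  routeRound M d (fun p _ => p) fun p v _ => liftEntry β (φ p) v

/-- Reversal of the first `N` cells. -/
def reverseRound (M d N : ℕ) : Round M (2 * d) :=
  routeRound M d (fun p _ => N - (p + 1)) fun _ v _ => v

/-- The pair of `k` and `l < β`, encoded so that larger numbers have a larger `k` or the same `k`
and a smaller `l`. -/
def packKey (β k l : ℕ) : ℕ := k * β + (β - 1 - l)

/-- The number whose maximum among the preceding cells is computed by `minPass`. -/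
def minKey (β : ℕ) (κ : Entry → ℕ) (v : ℕ) : ℕ :=
  if v = 0 then 0 else packKey β (κ (Entry.dec β v)) (Entry.dec β v).lab

/-- Every label is replaced by the minimum of the labels of all records with the same key that are
not after it. -/
def minPass (M d H β : ℕ) (κ : Entry → ℕ) : List (Round M (2 * d)) :=
  scanMax M d H (fun _ v => minKey β κ v) fun _ v z =>
    liftEntry β (fun e => { e with lab := β - 1 - max z (minKey β κ v) % β }) v

/-- Every label is replaced by the minimum of the labels of all records with the same source. -/
def minRounds (M d H N β : ℕ) : List (Round M (2 * d)) :=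
  minPass M d H β Entry.src ++ [reverseRound M d N] ++ minPass M d H β (fun e => β - 1 - e.src) ++
    [reverseRound M d N]

/-- Every record is sent to the position of its reversed record and becomes the latter. -/
def relaxRound (M d β : ℕ) : Round M (2 * d) :=
  routeRound M d (fun _ v => (Entry.dec β v).ptr) fun p v _ =>
    liftEntry β (fun e => ⟨e.tgt, e.src, e.cost, e.lab + e.cost, p⟩) v

/-- The Bellman–Ford algorithm with `I` iterations. -/
def bellmanFordRounds (M d H N β : ℕ) : ℕ → List (Round M (2 * d))
  | 0 => minRounds M d H N β
  | I + 1 => bellmanFordRounds M d H N β I ++ ([relaxRound M d β] ++ minRounds M d H N β)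

/-- Sorts the records by their sources and finds the positions of the reversed records. -/
def linkRounds (M d H N β B ν : ℕ) : List (Round M (2 * d)) :=
  sortRounds M d H N (β ^ 5 + 1) B
    (fun v => (Entry.dec β v).src * ν + (Entry.dec β v).tgt) ++
  [mapRound M d β fun p e => { e with ptr := p }] ++
  sortRounds M d H N (β ^ 5 + 1) B
    (fun v => (Entry.dec β v).tgt * ν + (Entry.dec β v).src) ++
  [mapRound M d β fun _ e => { e with src := e.tgt, tgt := e.src }]

theorem length_minRounds (M d H N β : ℕ) : (minRounds M d H N β).length = 2 * H + 6 := by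
  simp only [minRounds, minPass, List.length_append, length_scanMax, List.length_singleton]
  ring

theorem length_bellmanFordRounds (M d H N β I : ℕ) :
    (bellmanFordRounds M d H N β I).length = (2 * H + 7) * I + (2 * H + 6) := by
  induction I with
  | zero => simp [bellmanFordRounds, length_minRounds]
  | succ I ih =>
    simp only [bellmanFordRounds, List.length_append, ih, length_minRounds, List.length_singleton]
    ring

theorem length_linkRounds (M d H N β B ν : ℕ) :
    (linkRounds M d H N β B ν).length = 2 * (B * (H + 3)) + 2 := by
  simp only [linkRounds, List.length_append, length_sortRounds, List.length_singleton]
  ring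

theorem max_sup_Iio {N : ℕ} (g : Fin N → ℕ) (p : Fin N) :
    max ((Finset.Iio p).sup g) (g p) = (Finset.Iic p).sup g := by
  rw [← Finset.Iio_insert, Finset.sup_insert, max_comm]

theorem packKey_mod {β k l : ℕ} (hl : l < β) : packKey β k l % β = β - 1 - l := by
  rw [packKey, mul_comm, Nat.mul_add_mod, Nat.mod_eq_of_lt (by omega)]

theorem le_of_packKey_le {β k l k' l' : ℕ} (hl : l < β)
    (h : packKey β k l ≤ packKey β k' l') : k ≤ k' := by
  by_contra! hlt
  have hmul : (k' + 1) * β ≤ k * β := Nat.mul_le_mul_right _ hlt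
  rw [Nat.succ_mul] at hmul
  unfold packKey at h
  omega

theorem isLeast_of_sup_packKey {N β : ℕ} {κ lab : Fin N → ℕ} (hκ : Monotone κ)
    (hlab : ∀ p, lab p < β) (p : Fin N) :
    IsLeast {x | ∃ q ≤ p, κ q = κ p ∧ x = lab q}
      (β - 1 - ((Finset.Iic p).sup fun q => packKey β (κ q) (lab q)) % β) := by
  obtain ⟨q₀, hq₀, hsup⟩ := Finset.exists_mem_eq_sup (Finset.Iic p) ⟨p, Finset.mem_Iic.2 le_rfl⟩
    fun q => packKey β (κ q) (lab q)
  have hle : ∀ q ≤ p, packKey β (κ q) (lab q) ≤ packKey β (κ q₀) (lab q₀) := fun q hq =>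
    (Finset.le_sup (f := fun q => packKey β (κ q) (lab q)) (Finset.mem_Iic.2 hq)).trans hsup.le
  have hκq : κ q₀ = κ p :=
    (hκ (Finset.mem_Iic.1 hq₀)).antisymm (le_of_packKey_le (hlab p) (hle p le_rfl))
  have hβ := hlab q₀
  rw [hsup, packKey_mod hβ]
  refine ⟨⟨q₀, Finset.mem_Iic.1 hq₀, hκq, by omega⟩, ?_⟩
  rintro x ⟨q, hq, hκ', rfl⟩
  have hqle := hle q hq
  rw [hκq, hκ', packKey, packKey] at hqle
  have := hlab q
  omega

/-- The minimum of `l` over all indices with the same value of `s`. -/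
def fiberMin {N : ℕ} (s l : Fin N → ℕ) (p : Fin N) : ℕ :=
  (Finset.univ.filter fun q => s q = s p).inf' ⟨p, by simp⟩ l

theorem isLeast_fiberMin {N : ℕ} (s l : Fin N → ℕ) (p : Fin N) :
    IsLeast {x | ∃ q, s q = s p ∧ x = l q} (fiberMin s l p) := by
  refine ⟨?_, ?_⟩
  · obtain ⟨q, hq, hmin⟩ := Finset.exists_mem_eq_inf' (s := Finset.univ.filter fun q => s q = s p)
      ⟨p, by simp⟩ l
    exact ⟨q, (Finset.mem_filter.1 hq).2, hmin⟩
  · rintro x ⟨q, hq, rfl⟩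
    exact Finset.inf'_le _ (Finset.mem_filter.2 ⟨Finset.mem_univ q, hq⟩)

theorem fiberMin_congr {N : ℕ} {s l : Fin N → ℕ} {p q : Fin N} (h : s p = s q) :
    fiberMin s l p = fiberMin s l q := by
  simp only [fiberMin, h]

section

variable {M d H mem K N β : ℕ} (hP : Params M d H mem K) (hN : N ≤ M * d)
  (hK : (β ^ 5 + 1) * (N + 1) < K)
include hP

omit hP in
theorem liftEntry_zero (φ : Entry → Entry) : liftEntry β φ 0 = 0 := if_pos rfl

omit hP in
theorem liftEntry_code (φ : Entry → Entry) {e : Entry} (he : e.Bounded β) :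
    liftEntry β φ (e.code β) = (φ e).code β := by
  rw [liftEntry, if_neg (e.code_ne_zero β), Entry.dec_code he]

include hK

omit hP in
theorem code_lt_of_bounded {e : Entry} (he : e.Bounded β) : e.code β < K :=
  (Entry.code_lt he).trans_le ((Nat.le_mul_of_pos_right _ (Nat.succ_pos _)).trans hK.le)

omit hP in
theorem packKey_lt {k l : ℕ} (hk : k < β) : packKey β k l < K := by
  have hβ : 0 < β := Nat.zero_lt_of_lt hk
  calc packKey β k l = β - 1 - l + β * k := by rw [packKey, mul_comm, add_comm]
    _ < β * β := Entry.add_mul_lt (by omega) hk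
    _ = β ^ 2 := (sq β).symm
    _ ≤ β ^ 5 := Nat.pow_le_pow_right hβ (by norm_num)
    _ ≤ (β ^ 5 + 1) * (N + 1) :=
      (Nat.le_succ _).trans (Nat.le_mul_of_pos_right _ (Nat.succ_pos _))
    _ ≤ K := hK.le

theorem exists_minPass_computes {E : Fin N → Entry} (hE : ∀ p, (E p).Bounded β) {κ : Entry → ℕ}
    (hκβ : ∀ p, κ (E p) < β) (hκ : Monotone fun p => κ (E p)) :
    ∃ l : Fin N → ℕ, Computes mem K (minPass M d H β κ) (entryArray β E)
        (entryArray β fun p => { E p with lab := l p }) ∧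
      ∀ p, IsLeast {x | ∃ q ≤ p, κ (E q) = κ (E p) ∧ x = (E q).lab} (l p) := by
  have hkey : ∀ p, minKey β κ ((E p).code β) = packKey β (κ (E p)) (E p).lab := by
    intro p
    rw [minKey, if_neg ((E p).code_ne_zero β), Entry.dec_code (hE p)]
  refine ⟨fun p => β - 1 - ((Finset.Iic p).sup fun q => packKey β (κ (E q)) (E q).lab) % β, ?_,
    isLeast_of_sup_packKey hκ fun p => (hE p).lab⟩
  refine scanMax_pad hP ?_ ?_ (fun _ => if_pos rfl) ?_ (fun _ _ => liftEntry_zero _) ?_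
  · exact fun p => code_lt_of_bounded hK (hE p)
  · intro p
    have hβ : 0 < β := Nat.zero_lt_of_lt (hE p).src
    exact code_lt_of_bounded hK ((hE p).updateLab (by simp only; omega))
  · intro p
    rw [hkey]
    exact packKey_lt hK (hκβ p)
  · intro p
    simp only [hkey, max_sup_Iio fun q => packKey β (κ (E q)) (E q).lab]
    rw [liftEntry_code _ (hE p)]

include hN

theorem reverseRound_computes {E : Fin N → Entry} (hE : ∀ p, (E p).Bounded β) :
    Computes mem K [reverseRound M d N] (entryArray β E) (entryArray β fun p => E (Fin.rev p)) := by
  refine route_pad hP hN Fin.revPerm (fun p => code_lt_of_bounded hK (hE _)) (fun _ => rfl) ?_ ?_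
  · intro p; simp [Fin.val_rev]
  · intro p; simp

omit hP hN hK in
theorem isLeast_of_forward_of_backward {s lab l₁ l₂ : Fin N → ℕ}
    (hl₁ : ∀ p, IsLeast {x | ∃ q ≤ p, s q = s p ∧ x = lab q} (l₁ p))
    (hl₂ : ∀ p, IsLeast {x | ∃ q ≥ p, s q = s p ∧ x = l₁ q} (l₂ p)) (p : Fin N) :
    IsLeast {x | ∃ q, s q = s p ∧ x = lab q} (l₂ p) := by
  refine ⟨?_, ?_⟩
  · obtain ⟨q, -, hqs, hq⟩ := (hl₂ p).1
    obtain ⟨r, -, hrs, hr⟩ := (hl₁ q).1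
    exact ⟨r, hrs.trans hqs, hq.trans hr⟩
  · rintro x ⟨q, hqs, rfl⟩
    rcases le_total q p with h | h
    · exact ((hl₂ p).2 ⟨p, le_rfl, rfl, rfl⟩).trans ((hl₁ p).2 ⟨q, h, hqs, rfl⟩)
    · exact ((hl₂ p).2 ⟨q, h, hqs, rfl⟩).trans ((hl₁ q).2 ⟨q, le_rfl, rfl, rfl⟩)

omit hP hN hK in
theorem isLeast_rev {s l₁ l₂ : Fin N → ℕ} (hs : ∀ p, s p < β)
    (hl₂ : ∀ p, IsLeast {x | ∃ q ≤ p, β - 1 - s q.rev = β - 1 - s p.rev ∧ x = l₁ q.rev} (l₂ p))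
    (p : Fin N) : IsLeast {x | ∃ q ≥ p, s q = s p ∧ x = l₁ q} (l₂ p.rev) := by
  convert hl₂ p.rev using 1
  ext x
  constructor
  · rintro ⟨q, hpq, hqs, rfl⟩
    exact ⟨q.rev, Fin.rev_le_rev.2 hpq, by simp [hqs], by simp⟩
  · rintro ⟨q, hpq, hqs, rfl⟩
    have hp := hs p
    have hq := hs q.rev
    simp only [Fin.rev_rev] at hqs
    exact ⟨q.rev, Fin.le_rev_iff.1 hpq, by omega, rfl⟩

theorem minRounds_computes {E : Fin N → Entry} (hE : ∀ p, (E p).Bounded β)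
    (hs : Monotone fun p => (E p).src) :
    Computes mem K (minRounds M d H N β) (entryArray β E) (entryArray β fun p =>
      { E p with lab := fiberMin (fun q => (E q).src) (fun q => (E q).lab) p }) := by
  obtain ⟨l₁, hfwd, hl₁⟩ := exists_minPass_computes hP hK hE (fun p => (hE p).src) hs
  have hE₁ : ∀ p, Entry.Bounded β { E p with lab := l₁ p } := by
    intro p
    obtain ⟨q, -, -, hq⟩ := (hl₁ p).1
    exact (hE p).updateLab (hq ▸ (hE q).lab)
  obtain ⟨l₂, hbwd, hl₂⟩ := exists_minPass_computes (κ := fun e => β - 1 - e.src) hP hK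
    (fun p => hE₁ (Fin.rev p)) (fun p => by have := (hE p.rev).src; simp only; omega)
    (fun p q hpq => Nat.sub_le_sub_left (hs (Fin.rev_le_rev.2 hpq)) _)
  have hE₂ : ∀ p, Entry.Bounded β { E (Fin.rev p) with lab := l₂ p } := by
    intro p
    obtain ⟨q, -, -, hq⟩ := (hl₂ p).1
    exact (hE p.rev).updateLab (hq ▸ (hE₁ _).lab)
  have hrev := reverseRound_computes hP hN hK hE₂
  simp only [Fin.rev_rev] at hrev
  have hl : ∀ p : Fin N, l₂ p.rev = fiberMin (fun q => (E q).src) (fun q => (E q).lab) p := fun p =>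
    (isLeast_of_forward_of_backward hl₁ (isLeast_rev (fun p => (hE p).src) hl₂) p).unique
      (isLeast_fiberMin _ _ p)
  simp only [hl] at hrev
  exact ((hfwd.append (reverseRound_computes hP hN hK hE₁)).append hbwd).append hrev

theorem mapRound_computes {φ : ℕ → Entry → Entry} {E : Fin N → Entry} (hE : ∀ p, (E p).Bounded β)
    (hφ : ∀ p : Fin N, (φ p (E p)).Bounded β) :
    Computes mem K [mapRound M d β φ] (entryArray β E) (entryArray β fun p => φ p (E p)) := by
  refine route_pad hP hN (Equiv.refl _) (fun p => code_lt_of_bounded hK (hφ p))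
    (fun _ => liftEntry_zero _) (fun _ => rfl) ?_
  intro p
  rw [liftEntry_code _ (hE p)]
  rfl

end

/-- The records that are used by the Bellman–Ford algorithm: the reversed record of the record at
position `p` is at position `τ p`, and the records are sorted by their sources. -/
structure LinkedEntries (N : ℕ) where
  s : Fin N → ℕ
  t : Fin N → ℕ
  c : Fin N → ℕ
  τ : Equiv.Perm (Fin N)
  mono : Monotone s
  invol : ∀ p, τ (τ p) = p
  s_link : ∀ p, s (τ p) = t p
  c_link : ∀ p, c (τ p) = c p

namespace LinkedEntries

/-- The records with labels `l`. -/
def entry {N : ℕ} (R : LinkedEntries N) (l : Fin N → ℕ) (p : Fin N) : Entry :=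
  ⟨R.s p, R.t p, R.c p, l p, R.τ p⟩

theorem t_link {N : ℕ} (R : LinkedEntries N) (p : Fin N) : R.t (R.τ p) = R.s p := by
  rw [← R.s_link, R.invol]

variable {M d H mem K N β : ℕ} (hP : Params M d H mem K) (hN : N ≤ M * d)
  (hK : (β ^ 5 + 1) * (N + 1) < K) (R : LinkedEntries N)
include hP hN hK

theorem relaxRound_computes {l : Fin N → ℕ} (hb : ∀ p, (R.entry l p).Bounded β)
    (hl : ∀ p, l p + R.c p < β) :
    Computes mem K [relaxRound M d β] (entryArray β (R.entry l))
      (entryArray β (R.entry fun p => l (R.τ p) + R.c p)) := by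
  have hb' : ∀ p, (R.entry (fun p => l (R.τ p) + R.c p) p).Bounded β := by
    intro p
    refine ⟨(hb p).src, (hb p).tgt, (hb p).cost, ?_, (hb p).ptr⟩
    have := hl (R.τ p)
    rw [R.c_link] at this
    exact this
  refine route_pad hP hN R.τ (fun p => code_lt_of_bounded hK (hb' p))
    (fun _ => liftEntry_zero _) ?_ ?_
  · intro p
    rw [Entry.dec_code (hb p)]
    rfl
  · intro p
    rw [liftEntry_code _ (hb p)]
    congr 1
    simp only [entry, R.s_link, R.t_link, R.invol, R.c_link]

omit hP hN hK in
/-- The labels after `i` iterations of the Bellman–Ford algorithm from the labels `l`. -/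
def label (R : LinkedEntries N) (l : Fin N → ℕ) : ℕ → Fin N → ℕ
  | 0 => fiberMin R.s l
  | i + 1 => fiberMin R.s fun p => label R l i (R.τ p) + R.c p

omit hP hN hK in
theorem label_le {l : Fin N → ℕ} {A : ℕ}
    (hself : ∀ p, ∃ q, R.s q = R.s p ∧ R.τ q = q ∧ R.c q = 0 ∧ l q ≤ A) (i : ℕ) (p : Fin N) :
    R.label l i p ≤ A := by
  induction i generalizing p with
  | zero =>
    obtain ⟨q, hq, -, -, hqA⟩ := hself p
    exact ((isLeast_fiberMin _ _ p).2 ⟨q, hq, rfl⟩).trans hqA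
  | succ i ih =>
    obtain ⟨q, hq, hτ, hc, -⟩ := hself p
    refine ((isLeast_fiberMin _ _ p).2 ⟨q, hq, rfl⟩).trans ?_
    simp only [hτ, hc, add_zero]
    exact ih q

omit hP hN hK in
theorem label_congr (l : Fin N → ℕ) (i : ℕ) {p q : Fin N} (h : R.s p = R.s q) :
    R.label l i p = R.label l i q := by
  cases i with
  | zero => exact fiberMin_congr h
  | succ i => exact fiberMin_congr h

omit hP hN hK in
/-- The common label of the records with source `s` after `i` iterations, and `0` if there are no
such records. -/
noncomputable def nodeLabel (R : LinkedEntries N) (l : Fin N → ℕ) (i : ℕ) : ℕ → ℕ :=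
  Function.extend R.s (R.label l i) 0

omit hP hN hK in
theorem nodeLabel_s (l : Fin N → ℕ) (i : ℕ) (p : Fin N) :
    R.nodeLabel l i (R.s p) = R.label l i p :=
  Function.FactorsThrough.extend_apply (fun _ _ => R.label_congr l i) 0 p

theorem minRounds_computes {l : Fin N → ℕ} (hb : ∀ p, (R.entry l p).Bounded β) :
    Computes mem K (minRounds M d H N β) (entryArray β (R.entry l))
      (entryArray β (R.entry (fiberMin R.s l))) :=
  CellMachine.minRounds_computes hP hN hK hb R.mono

theorem bellmanFordRounds_computes {l : Fin N → ℕ} (hb : ∀ p, (R.entry l p).Bounded β) {A : ℕ}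
    (hA : ∀ p, A + R.c p < β)
    (hself : ∀ p, ∃ q, R.s q = R.s p ∧ R.τ q = q ∧ R.c q = 0 ∧ l q ≤ A) (I : ℕ) :
    Computes mem K (bellmanFordRounds M d H N β I) (entryArray β (R.entry l))
      (entryArray β (R.entry (R.label l I))) := by
  induction I with
  | zero => exact R.minRounds_computes hP hN hK hb
  | succ I ih =>
    have hlt : ∀ p, R.label l I p + R.c p < β := fun p =>
      (Nat.add_le_add_right (R.label_le hself I p) _).trans_lt (hA p)
    have hlink : ∀ p, R.label l I (R.τ p) + R.c p < β := fun p => R.c_link p ▸ hlt (R.τ p)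
    refine ih.append ((R.relaxRound_computes hP hN hK (fun p => (hb p).updateLab ?_) hlt).append
      (R.minRounds_computes hP hN hK fun p => (hb p).updateLab (hlink p)))
    exact (Nat.le_add_right _ _).trans_lt (hlt p)

end LinkedEntries

/-- The records are the arcs of a digraph on `{0, …, ν - 1}`, without repetition, and the reversal
of every arc is an arc of the same cost. -/
structure IsArcList {N : ℕ} (ν : ℕ) (E : Fin N → Entry) : Prop where
  src_lt : ∀ p, (E p).src < ν
  tgt_lt : ∀ p, (E p).tgt < ν
  inj : ∀ {p q}, (E p).src = (E q).src → (E p).tgt = (E q).tgt → p = q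
  exists_reverse : ∀ p, ∃ q, (E q).src = (E p).tgt ∧ (E q).tgt = (E p).src ∧
    (E q).cost = (E p).cost

theorem strictMono_of_lt_imp_lt {α β : Type*} [LinearOrder α] [LinearOrder β] {k : α → β}
    (hk : Function.Injective k) (h : ∀ p q, k p < k q → p < q) : StrictMono k := fun p q hpq =>
  (lt_trichotomy (k p) (k q)).resolve_right fun hor =>
    hor.elim (fun heq => hpq.ne (hk heq)) fun hgt => hpq.asymm (h q p hgt)

namespace IsArcList

variable {N ν : ℕ} {E : Fin N → Entry}

theorem comp_perm (h : IsArcList ν E) (σ : Equiv.Perm (Fin N)) : IsArcList ν (E ∘ σ) where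
  src_lt p := h.src_lt _
  tgt_lt p := h.tgt_lt _
  inj hs ht := σ.injective (h.inj hs ht)
  exists_reverse p := by
    obtain ⟨q, hq⟩ := h.exists_reverse (σ p)
    exact ⟨σ.symm q, by simpa using hq⟩

variable (h : IsArcList ν E)
  (hsorted : ∀ p q, (E p).src * ν + (E p).tgt < (E q).src * ν + (E q).tgt → p < q)

include h hsorted

theorem monotone_src : Monotone fun p => (E p).src := by
  intro p q hpq
  by_contra! hlt
  have hmul : ((E q).src + 1) * ν ≤ (E p).src * ν := Nat.mul_le_mul_right _ hlt
  rw [Nat.succ_mul] at hmul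
  have hq := h.tgt_lt q
  exact absurd (hsorted q p (by omega)) hpq.not_gt

variable {τ : Equiv.Perm (Fin N)}
  (hτ : ∀ p q, (E (τ p)).tgt * ν + (E (τ p)).src < (E (τ q)).tgt * ν + (E (τ q)).src → p < q)

include hτ

-- Both sorted sequences of pairs are strictly increasing and, by symmetry, have the same range.
theorem tgt_eq_and_src_eq (p : Fin N) :
    (E (τ p)).tgt = (E p).src ∧ (E (τ p)).src = (E p).tgt := by
  have hbwd : StrictMono fun p => (E (τ p)).tgt * ν + (E (τ p)).src :=
    strictMono_of_lt_imp_lt (fun p q hpq => by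
      obtain ⟨ht, hs⟩ := address_inj (h.src_lt _) (h.src_lt _) hpq
      exact τ.injective (h.inj hs ht)) hτ
  have hfwd : StrictMono fun p => (E p).src * ν + (E p).tgt :=
    strictMono_of_lt_imp_lt (fun p q hpq => by
      obtain ⟨hs, ht⟩ := address_inj (h.tgt_lt _) (h.tgt_lt _) hpq
      exact h.inj hs ht) hsorted
  suffices hrange : _ by
    exact address_inj (h.src_lt _) (h.tgt_lt _) (congrFun ((hbwd.range_inj hfwd).1 hrange) p)
  refine Set.Subset.antisymm ?_ ?_
  · rintro _ ⟨p, rfl⟩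
    obtain ⟨q, hqs, hqt, -⟩ := h.exists_reverse (τ p)
    exact ⟨q, by simp [hqs, hqt]⟩
  · rintro _ ⟨p, rfl⟩
    obtain ⟨q, hqs, hqt, -⟩ := h.exists_reverse p
    exact ⟨τ.symm q, by simp [hqs, hqt]⟩

theorem cost_eq (p : Fin N) : (E (τ p)).cost = (E p).cost := by
  obtain ⟨ht, hs⟩ := h.tgt_eq_and_src_eq hsorted hτ p
  obtain ⟨q, hqs, hqt, hqc⟩ := h.exists_reverse p
  rw [← hqc, h.inj (hqs.trans hs.symm) (hqt.trans ht.symm)]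

/-- Sorted arcs, linked by the permutation that sorts them by their targets. -/
def linkedEntries : LinkedEntries N where
  s p := (E p).src
  t p := (E p).tgt
  c p := (E p).cost
  τ := τ
  mono := h.monotone_src hsorted
  invol p := by
    obtain ⟨ht, hs⟩ := h.tgt_eq_and_src_eq hsorted hτ p
    obtain ⟨ht', hs'⟩ := h.tgt_eq_and_src_eq hsorted hτ (τ p)
    exact h.inj (hs'.trans ht) (ht'.trans hs)
  s_link p := (h.tgt_eq_and_src_eq hsorted hτ p).2
  c_link := h.cost_eq hsorted hτ

end IsArcList

/-- Every record has the label that `lab` assigns to its source, and there is a self-loop at each of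
the nodes `0, …, ν - 1`. -/
structure IsLabeledBy {N : ℕ} (ν β : ℕ) (E : Fin N → Entry) (lab : ℕ → ℕ) : Prop where
  bounded : ∀ p, (E p).Bounded β
  src_lt : ∀ p, (E p).src < ν
  lab_eq : ∀ p, (E p).lab = lab (E p).src
  exists_self : ∀ s < ν, ∃ p, (E p).src = s ∧ (E p).tgt = s

/-- `L i` are the labels of the nodes after `i` iterations of the Bellman–Ford algorithm. The first
label of a node is the least one among those of the arcs that enter it. -/
structure IsArcBellmanFord {N : ℕ} (ν : ℕ) (E : Fin N → Entry) (L : ℕ → ℕ → ℕ) : Prop where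
  zero : ∀ s < ν, IsLeast {x | ∃ p, (E p).tgt = s ∧ x = (E p).lab} (L 0 s)
  succ : ∀ i, ∀ s < ν,
    IsLeast {x | ∃ p, (E p).src = s ∧ x = L i (E p).tgt + (E p).cost} (L (i + 1) s)

section LinkedArcs

variable {N ν β : ℕ} {E : Fin N → Entry} {R : LinkedEntries N} {σ : Equiv.Perm (Fin N)}
  (harc : IsArcList ν E)
  (hR : ∀ p, R.s p = (E (σ p)).src ∧ R.t p = (E (σ p)).tgt ∧ R.c p = (E (σ p)).cost)

include harc hR in
theorem link_symm_eq_self {p : Fin N} (h : (E p).src = (E p).tgt) :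
    R.τ (σ.symm p) = σ.symm p := by
  have hs : R.s (σ.symm p) = (E p).src := by rw [(hR _).1, σ.apply_symm_apply]
  have ht : R.t (σ.symm p) = (E p).tgt := by rw [(hR _).2.1, σ.apply_symm_apply]
  refine σ.injective (harc.inj ?_ ?_)
  · rw [← (hR _).1, R.s_link, ht, σ.apply_symm_apply, h]
  · rw [← (hR _).2.1, R.t_link, hs, σ.apply_symm_apply, h]

include hR in
theorem isLeast_nodeLabel_zero (q : Fin N) :
    IsLeast {x | ∃ p, (E p).tgt = R.s q ∧ x = (E p).lab}
      (R.nodeLabel (fun p => (E (σ (R.τ p))).lab) 0 (R.s q)) := by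
  rw [R.nodeLabel_s]
  refine (Set.ext fun x => ?_ : {x | _} = {x | _}) ▸ isLeast_fiberMin R.s _ q
  refine (R.τ.trans σ).exists_congr fun p => ?_
  rw [Equiv.trans_apply, ← (hR _).2.1, R.t_link]

include hR in
theorem isLeast_nodeLabel_succ (l : Fin N → ℕ) (i : ℕ) (q : Fin N) :
    IsLeast {x | ∃ p, (E p).src = R.s q ∧ x = R.nodeLabel l i (E p).tgt + (E p).cost}
      (R.nodeLabel l (i + 1) (R.s q)) := by
  rw [R.nodeLabel_s]
  refine (Set.ext fun x => ?_ : {x | _} = {x | _}) ▸ isLeast_fiberMin R.s _ q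
  refine σ.exists_congr fun p => ?_
  rw [← (hR p).1, ← (hR p).2.1, ← (hR p).2.2, ← R.s_link, R.nodeLabel_s]

end LinkedArcs

section Link

variable {M d H mem K N β B ν : ℕ} (hP : Params M d H mem K) (hN : N ≤ M * d)
  (hK : (β ^ 5 + 1) * (N + 1) < K)
include hP hN hK

theorem exists_sortRounds_computes_entryArray {E : Fin N → Entry} (hE : ∀ p, (E p).Bounded β)
    (key : Entry → ℕ) (hkey : ∀ p, key (E p) < 2 ^ B) :
    ∃ σ : Equiv.Perm (Fin N),
      Computes mem K (sortRounds M d H N (β ^ 5 + 1) B fun v => key (Entry.dec β v))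
        (entryArray β E) (entryArray β (E ∘ σ)) ∧
      ∀ p q, key (E (σ p)) < key (E (σ q)) → p < q := by
  obtain ⟨σ, hσ, hord⟩ := exists_sortRounds_computes hP hN
    (lt_of_le_of_lt (Nat.mul_le_mul_left _ (Nat.le_succ N)) hK) (a := fun p => (E p).code β)
    (fun _ => Entry.code_ne_zero _ _) (fun p => Entry.code_lt (hE p)) B
    (fun v => key (Entry.dec β v)) fun p => by simp only [Entry.dec_code (hE p), hkey p]
  simp only [Entry.dec_code (hE _)] at hord
  exact ⟨σ, hσ, hord⟩

theorem exists_linkRounds_computes (hβ : N ≤ β) (hB : ν * ν ≤ 2 ^ B) {E : Fin N → Entry}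
    (hE : ∀ p, (E p).Bounded β) (harc : IsArcList ν E) :
    ∃ (R : LinkedEntries N) (σ : Equiv.Perm (Fin N)),
      (∀ p, R.s p = (E (σ p)).src ∧ R.t p = (E (σ p)).tgt ∧ R.c p = (E (σ p)).cost) ∧
      Computes mem K (linkRounds M d H N β B ν) (entryArray β E)
        (entryArray β (R.entry fun p => (E (σ (R.τ p))).lab)) := by
  have hpair : ∀ {x y : ℕ}, x < ν → y < ν → x * ν + y < 2 ^ B := fun {x y} hx hy => by
    rw [add_comm, mul_comm]
    exact (Entry.add_mul_lt hy hx).trans_le hB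
  obtain ⟨σ, hsort, hσ⟩ := exists_sortRounds_computes_entryArray hP hN hK hE
    (fun e => e.src * ν + e.tgt) fun p => hpair (harc.src_lt p) (harc.tgt_lt p)
  have hE₁ : ∀ p : Fin N, Entry.Bounded β { E (σ p) with ptr := p } := fun p =>
    ⟨(hE _).src, (hE _).tgt, (hE _).cost, (hE _).lab, p.2.trans_le hβ⟩
  obtain ⟨τ, hsort', hτ⟩ := exists_sortRounds_computes_entryArray hP hN hK hE₁
    (fun e => e.tgt * ν + e.src) fun p => hpair (harc.tgt_lt _) (harc.src_lt _)
  have harc' : IsArcList ν (E ∘ σ) := harc.comp_perm σ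
  have hptr := mapRound_computes hP hN hK (φ := fun p e => { e with ptr := p })
    (fun p => hE (σ p)) hE₁
  have hswap := mapRound_computes hP hN hK
    (φ := fun _ e => { e with src := e.tgt, tgt := e.src }) (fun p => hE₁ (τ p)) fun p =>
    ⟨(hE₁ _).tgt, (hE₁ _).src, (hE₁ _).cost, (hE₁ _).lab, (hE₁ (τ p)).ptr⟩
  refine ⟨harc'.linkedEntries hσ hτ, σ, fun p => ⟨rfl, rfl, rfl⟩,
    ((hsort.append hptr).append hsort').append ?_⟩
  have hentry : ((harc'.linkedEntries hσ hτ).entry fun p => (E (σ (τ p))).lab) = fun p =>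
      ⟨(E (σ (τ p))).tgt, (E (σ (τ p))).src, (E (σ (τ p))).cost, (E (σ (τ p))).lab, τ p⟩ := by
    funext p
    obtain ⟨ht, hs⟩ := harc'.tgt_eq_and_src_eq hσ hτ p
    exact Entry.ext ht.symm hs.symm (harc'.cost_eq hσ hτ p).symm rfl rfl
  exact (congrArg (fun F => Computes mem K _ _ (entryArray β F)) hentry).mpr hswap

theorem exists_bellmanFord_computes (hβ : N ≤ β) (hB : ν * ν ≤ 2 ^ B) {E : Fin N → Entry}
    (hE : ∀ p, (E p).Bounded β) (harc : IsArcList ν E) {A : ℕ}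
    (hcost : ∀ p, A + (E p).cost < β)
    (hself : ∀ s < ν, ∃ p, (E p).src = s ∧ (E p).tgt = s ∧ (E p).cost = 0 ∧ (E p).lab ≤ A)
    (I : ℕ) : ∃ (E' : Fin N → Entry) (L : ℕ → ℕ → ℕ),
      Computes mem K (linkRounds M d H N β B ν ++ bellmanFordRounds M d H N β I)
        (entryArray β E) (entryArray β E') ∧
      IsLabeledBy ν β E' (L I) ∧ IsArcBellmanFord ν E L := by
  obtain ⟨R, σ, hR, hlink⟩ := exists_linkRounds_computes hP hN hK hβ hB hE harc
  set l : Fin N → ℕ := fun p => (E (σ (R.τ p))).lab with hl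
  have hbounded : ∀ p, (R.entry l p).Bounded β := fun p =>
    ⟨(hR p).1.trans_lt (hE _).src, (hR p).2.1.trans_lt (hE _).tgt,
      (hR p).2.2.trans_lt (hE _).cost, (hE _).lab, (R.τ p).2.trans_le hβ⟩
  have hs : ∀ p, R.s p < ν := fun p => (hR p).1 ▸ harc.src_lt _
  have hA : ∀ p, A + R.c p < β := fun p => (hR p).2.2 ▸ hcost _
  have hloop : ∀ s < ν, ∃ q, R.s q = s ∧ R.t q = s ∧ R.τ q = q ∧ R.c q = 0 ∧ l q ≤ A := by
    intro s hsν
    obtain ⟨p, hsrc, htgt, hcost, hlab⟩ := hself s hsν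
    have hτ := link_symm_eq_self harc hR (hsrc.trans htgt.symm)
    refine ⟨σ.symm p, ?_, ?_, hτ, ?_, ?_⟩
    · rw [(hR _).1, σ.apply_symm_apply, hsrc]
    · rw [(hR _).2.1, σ.apply_symm_apply, htgt]
    · rw [(hR _).2.2, σ.apply_symm_apply, hcost]
    · simpa only [hl, hτ, σ.apply_symm_apply] using hlab
  have hloop' : ∀ p, ∃ q, R.s q = R.s p ∧ R.τ q = q ∧ R.c q = 0 ∧ l q ≤ A := fun p =>
    have ⟨q, hsq, _, hq⟩ := hloop _ (hs p)
    ⟨q, hsq, hq⟩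
  have hlab : ∀ p, R.label l I p < β := fun p =>
    (R.label_le hloop' I p).trans_lt ((Nat.le_add_right _ _).trans_lt (hA p))
  refine ⟨R.entry (R.label l I), R.nodeLabel l,
    hlink.append (R.bellmanFordRounds_computes hP hN hK hbounded hA hloop' I),
    ⟨fun p => (hbounded p).updateLab (hlab p), hs, fun p => (R.nodeLabel_s l I p).symm, ?_⟩, ?_, ?_⟩
  · exact fun s hsν => have ⟨q, hsq, htq, _⟩ := hloop s hsν
      ⟨q, hsq, htq⟩
  · intro s hsν
    obtain ⟨q, rfl, -⟩ := hloop s hsν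
    exact isLeast_nodeLabel_zero hR q
  · intro i s hsν
    obtain ⟨q, rfl, -⟩ := hloop s hsν
    exact isLeast_nodeLabel_succ hR l i q

end Link

end CellMachine

/-! ### Reading the input -/

namespace CellMachine

section Spread

/-- Moves the `r`-th nonempty cell to the positions from `r * w` to `r * w + w - 1`, for all `r`
that are less than `m`. -/
def spreadRounds (M d H m w K₁ : ℕ) : List (Round M (2 * d)) :=
  scanSum M d H (fun _ v => if v ≠ 0 then 1 else 0)
    (fun _ v z => if v = 0 then 0 else v + K₁ * z) ++
  [routeRound M d (fun _ v => v / K₁ * w) fun _ v _ => v] ++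
  scanMax M d H (fun _ v => v) fun p v z => if p < w * m then max z v % K₁ else 0

theorem length_spreadRounds (M d H m w K₁ : ℕ) :
    (spreadRounds M d H m w K₁).length = 2 * H + 5 := by
  simp only [spreadRounds, List.length_append, length_scanMax, length_scanSum,
    List.length_singleton]
  ring

theorem nth_mem_of_lt_count {P : ℕ → Prop} [DecidablePred P] {r N : ℕ} (h : r < Nat.count P N) :
    P (Nat.nth P r) :=
  Nat.nth_mem r fun hf => h.trans_le (Nat.count_le_card hf N)

theorem count_nth_of_lt_count {P : ℕ → Prop} [DecidablePred P] {r N : ℕ}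
    (h : r < Nat.count P N) : Nat.count P (Nat.nth P r) = r :=
  Nat.count_nth fun hf => h.trans_le (Nat.count_le_card hf N)

/-- Every nonempty cell of `x` also holds the number of nonempty cells before it. -/
def rankArray (K₁ : ℕ) (x : ℕ → ℕ) (p : ℕ) : ℕ :=
  if x p = 0 then 0 else x p + K₁ * Nat.count (x · ≠ 0) p

/-- Cell `r * w` holds the `r`-th nonempty cell of `x` together with `r`, for all `r < m`. -/
noncomputable def headArray (m w K₁ : ℕ) (x : ℕ → ℕ) (q : ℕ) : ℕ :=
  if w ∣ q ∧ q / w < m then x (Nat.nth (x · ≠ 0) (q / w)) + K₁ * (q / w) else 0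

variable {m w K₁ : ℕ} {x : ℕ → ℕ}

theorem ne_zero_of_rankArray_ne_zero {p : ℕ} (h : rankArray K₁ x p ≠ 0) : x p ≠ 0 :=
  fun hp => h (if_pos hp)

section Bounded

variable (hx : ∀ p, x p < K₁)
include hx

theorem rankArray_div {p : ℕ} (hp : x p ≠ 0) :
    rankArray K₁ x p / K₁ = Nat.count (x · ≠ 0) p := by
  rw [rankArray, if_neg hp, Nat.add_mul_div_left _ _ ((Nat.zero_le _).trans_lt (hx 0)),
    Nat.div_eq_of_lt (hx p), zero_add]

theorem injOn_rankArray (hw : 0 < w) :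
    Set.InjOn (fun p => rankArray K₁ x p / K₁ * w) {p | rankArray K₁ x p ≠ 0} := by
  intro p hp q hq h
  have hp := ne_zero_of_rankArray_ne_zero hp
  have hq := ne_zero_of_rankArray_ne_zero hq
  refine Nat.count_injective (p := (x · ≠ 0)) hp hq ?_
  simpa only [rankArray_div hx hp, rankArray_div hx hq] using Nat.eq_of_mul_eq_mul_right hw h

theorem rankArray_lt {p : ℕ} (hp : Nat.count (x · ≠ 0) p ≤ m) :
    rankArray K₁ x p < K₁ * (m + 1) := by
  unfold rankArray
  split_ifs
  · exact Nat.mul_pos ((Nat.zero_le _).trans_lt (hx 0)) m.succ_pos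
  · exact Entry.add_mul_lt (hx p) (Nat.lt_succ_of_le hp)

theorem headArray_lt (q : ℕ) : headArray m w K₁ x q < K₁ * (m + 1) := by
  unfold headArray
  split_ifs with h
  · exact Entry.add_mul_lt (hx _) (h.2.trans m.lt_succ_self)
  · exact Nat.mul_pos ((Nat.zero_le _).trans_lt (hx 0)) m.succ_pos

theorem routeArray_rankArray {N : ℕ} (hw : 0 < w) (hm : Nat.count (x · ≠ 0) N = m) :
    routeArray N (fun _ v => v / K₁ * w) (fun _ v _ => v) 0 (rankArray K₁ x) =
      headArray m w K₁ x := by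
  funext q
  by_cases hq : w ∣ q ∧ q / w < m
  · obtain ⟨⟨r, rfl⟩, hr⟩ := hq
    rw [Nat.mul_div_cancel_left _ hw] at hr
    have hlt : r < Nat.count (x · ≠ 0) N := hm ▸ hr
    have hne := nth_mem_of_lt_count hlt
    have hval : rankArray K₁ x (Nat.nth (x · ≠ 0) r) = x (Nat.nth (x · ≠ 0) r) + K₁ * r := by
      rw [rankArray, if_neg hne, count_nth_of_lt_count hlt]
    have happly := routeArray_apply (c := 0) (dst := fun _ v => v / K₁ * w) (f := fun _ v _ => v)
      ((injOn_rankArray hx hw).mono fun p hp => hp.2) (Nat.nth_lt_of_lt_count hlt)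
      (by rw [hval]; omega)
    rw [rankArray_div hx hne, count_nth_of_lt_count hlt, hval, mul_comm] at happly
    rw [happly, headArray, Nat.mul_div_cancel_left _ hw, if_pos ⟨dvd_mul_right _ _, hr⟩]
  · rw [headArray, if_neg hq]
    refine routeArray_eq_zero fun p hp hne hdst => hq ?_
    have hxp := ne_zero_of_rankArray_ne_zero hne
    rw [rankArray_div hx hxp] at hdst
    rw [← hdst, Nat.mul_div_cancel _ hw]
    exact ⟨dvd_mul_left _ _, hm ▸ Nat.count_strict_mono hxp hp⟩

theorem headArray_le {p q : ℕ} (hqp : q ≤ p) (hp : p < w * m) :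
    headArray m w K₁ x q ≤ headArray m w K₁ x (p / w * w) := by
  have hw : 0 < w := Nat.pos_of_mul_pos_right ((Nat.zero_le p).trans_lt hp)
  by_cases hq : w ∣ q ∧ q / w < m
  · have hhead : headArray m w K₁ x (p / w * w) = x (Nat.nth (x · ≠ 0) (p / w)) + K₁ * (p / w) := by
      rw [headArray, Nat.mul_div_cancel _ hw, if_pos ⟨dvd_mul_left _ _, Nat.div_lt_of_lt_mul hp⟩]
    rw [hhead, headArray, if_pos hq]
    rcases (Nat.div_le_div_right (c := w) hqp).eq_or_lt with h | h
    · rw [h]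
    · exact (Entry.add_mul_lt (hx _) h).le.trans (Nat.le_add_left _ _)
  · rw [headArray, if_neg hq]
    exact Nat.zero_le _

theorem max_sup_headArray {p : ℕ} (hp : p < w * m) :
    max ((Finset.range p).sup (headArray m w K₁ x)) (headArray m w K₁ x p) =
      headArray m w K₁ x (p / w * w) := by
  refine le_antisymm (max_le (Finset.sup_le fun q hq => headArray_le hx (Finset.mem_range.1 hq).le
    hp) (headArray_le hx le_rfl hp)) ?_
  rcases (Nat.div_mul_le_self p w).lt_or_eq with h | h
  · exact le_max_of_le_left (Finset.le_sup (Finset.mem_range.2 h))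
  · rw [h]
    exact le_max_right _ _

theorem headArray_mod {p : ℕ} (hp : p < w * m) :
    headArray m w K₁ x (p / w * w) % K₁ = x (Nat.nth (x · ≠ 0) (p / w)) := by
  have hw : 0 < w := Nat.pos_of_mul_pos_right ((Nat.zero_le p).trans_lt hp)
  rw [headArray, Nat.mul_div_cancel _ hw, if_pos ⟨dvd_mul_left _ _, Nat.div_lt_of_lt_mul hp⟩,
    Nat.add_mul_mod_self_left, Nat.mod_eq_of_lt (hx _)]

theorem spreadRounds_computes {M d H mem K : ℕ} (hP : Params M d H mem K) (hw : 0 < w)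
    (hK : K₁ * (m + 1) < K) (hm : Nat.count (x · ≠ 0) (M * d) = m) :
    Computes mem K (spreadRounds M d H m w K₁) x
      fun p => if p < w * m then x (Nat.nth (x · ≠ 0) (p / w)) else 0 := by
  have hK₁ : 0 < K₁ := (Nat.zero_le _).trans_lt (hx 0)
  have hK₁K : K₁ < K := (Nat.le_mul_of_pos_right _ m.succ_pos).trans_lt hK
  have hcount : ∀ p, (∑ q ∈ Finset.range p, if x q ≠ 0 then 1 else 0) = Nat.count (x · ≠ 0) p :=
    fun p => by rw [Nat.count_eq_card_filter_range, Finset.card_filter]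
  have hrankK : ∀ p < M * d, rankArray K₁ x p < K := fun p hp =>
    (rankArray_lt hx (hm ▸ Nat.count_monotone _ hp.le)).trans hK
  have hheadK : ∀ q, headArray m w K₁ x q < K := fun q => (headArray_lt hx q).trans hK
  have hrank : Computes mem K _ x (rankArray K₁ x) :=
    (scanSum_computes hP (g := fun _ v => if v ≠ 0 then 1 else 0)
      (f := fun _ v z => if v = 0 then 0 else v + K₁ * z) (fun p => (hx p).trans hK₁K)
      (fun _ v => by split_ifs <;> simp) fun p hp => by
        rw [hcount]
        exact hrankK p hp).congr_right fun p _ => by rw [hcount, rankArray]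
  have hroute := route_computes hP (dst := fun _ v => v / K₁ * w) (f := fun _ v => v) hrankK
    ((injOn_rankArray hx hw).mono fun p hp => hp.2)
  rw [routeArray_rankArray hx hw hm] at hroute
  have hmax := scanMax_computes hP (g := fun _ v => v)
    (f := fun p v z => if p < w * m then max z v % K₁ else 0) hheadK hheadK fun p _ => by
      split_ifs
      · exact (Nat.mod_lt _ hK₁).trans hK₁K
      · exact hP.pos
  refine ((hrank.append hroute).append hmax).congr_right fun p _ => ?_
  refine if_ctx_congr Iff.rfl (fun hp => ?_) fun _ => rfl
  rw [max_sup_headArray hx hp, headArray_mod hx hp]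

end Bounded

end Spread

section Input

/-- The code of the `o`-th edge in a list of words that holds three words for each edge. -/
def edgeCell (β : ℕ) (l : List ℕ) (o : ℕ) : ℕ :=
  if 3 * o + 2 < l.length then
    1 + (l.getD (3 * o) 0 + β * (l.getD (3 * o + 1) 0 + β * l.getD (3 * o + 2) 0)) else 0

/-- The code of an edge. It is positive because `0` stands for an empty cell. -/
def edgeCode {n : ℕ} (β : ℕ) (w : Sym2 (Fin n) → ℕ) (e : Fin n × Fin n) : ℕ :=
  1 + (e.1 + β * (e.2 + β * w s(e.1, e.2)))

/-- The cells in which a machine stores the edges of its input. -/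
def readInput (M d β : ℕ) (_ : Fin M) (l : List ℕ) (s : Fin (2 * d)) : ℕ :=
  if (s : ℕ) < d then edgeCell β l s else 0

/-- The array of the codes of all edges of a distribution. -/
def inputArray {n M : ℕ} (d β : ℕ) (w : Sym2 (Fin n) → ℕ) (D : Fin M → List (Fin n × Fin n))
    (p : ℕ) : ℕ :=
  if h : p / d < M then
    if h' : p % d < (D ⟨p / d, h⟩).length then edgeCode β w (D ⟨p / d, h⟩)[p % d] else 0
  else 0

variable {n M d β m : ℕ} {w : Sym2 (Fin n) → ℕ} {D : Fin M → List (Fin n × Fin n)}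
  {G : SimpleGraph (Fin n)}

theorem edgeCell_flatMap (β : ℕ) (w : Sym2 (Fin n) → ℕ) (L : List (Fin n × Fin n)) (o : ℕ) :
    edgeCell β (L.flatMap fun e => [(e.1 : ℕ), (e.2 : ℕ), w s(e.1, e.2)]) o =
      if h : o < L.length then edgeCode β w L[o] else 0 := by
  induction L generalizing o with
  | nil => simp [edgeCell]
  | cons a L ih =>
    cases o with
    | zero => simp [edgeCell, edgeCode]
    | succ o =>
      have hshift : 3 * (o + 1) = 3 * o + 1 + 1 + 1 := by ring
      simp only [List.length_cons, Nat.add_lt_add_iff_right, List.getElem_cons_succ, ← ih o,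
        edgeCell, List.flatMap_cons, List.cons_append, List.nil_append, hshift,
        List.getD_cons_succ, show 3 * o + 1 + 1 + 1 + 2 = 3 * o + 2 + 1 + 1 + 1 by ring]

theorem inputArray_address (i : Fin M) {o : ℕ} (ho : o < d) :
    inputArray d β w D (i * d + o) =
      if h : o < (D i).length then edgeCode β w (D i)[o] else 0 := by
  simp only [inputArray, address_div ho, address_mod ho, i.2, dif_pos]

theorem readInput_eq (w : Sym2 (Fin n) → ℕ) (D : Fin M → List (Fin n × Fin n)) :
    (fun i => readInput M d β i (edgeInput w D i)) = ofArray M d (inputArray d β w D) := by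
  funext i s
  unfold readInput ofArray
  split_ifs with hs
  · rw [edgeInput, edgeCell_flatMap, inputArray_address i hs]
  · rfl

theorem edgeCode_lt {e : Fin n × Fin n} (hn : n ≤ β) (hw : w s(e.1, e.2) < β) :
    edgeCode β w e < β ^ 3 + 1 := by
  have := Entry.add_mul_lt (e.1.2.trans_le hn) (Entry.add_mul_lt (e.2.2.trans_le hn) hw)
  rw [edgeCode, show β ^ 3 = β * (β * β) by ring]
  omega

theorem exists_of_inputArray_ne_zero {p : ℕ} (hp : inputArray d β w D p ≠ 0) :
    ∃ (i : Fin M) (o : ℕ) (h : o < (D i).length), p = d * i + o ∧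
      inputArray d β w D p = edgeCode β w (D i)[o] := by
  unfold inputArray at hp ⊢
  split_ifs at hp ⊢ with h h'
  · exact ⟨⟨p / d, h⟩, p % d, h', (Nat.div_add_mod p d).symm, rfl⟩
  · exact absurd rfl hp
  · exact absurd rfl hp

section Distribution

variable (hD : IsEdgeDistribution G D)
include hD

theorem edge_mem_of_mem {i : Fin M} {e : Fin n × Fin n} (he : e ∈ D i) :
    s(e.1, e.2) ∈ G.edgeSet :=
  (hD.2 _).1 (List.mem_map.2 ⟨e, List.mem_flatMap.2 ⟨i, List.mem_finRange i, he⟩, rfl⟩)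

theorem inputArray_lt (hn : n ≤ β) (hw : ∀ e ∈ G.edgeSet, w e < β) (p : ℕ) :
    inputArray d β w D p < β ^ 3 + 1 := by
  by_cases hp : inputArray d β w D p = 0
  · omega
  · obtain ⟨i, o, ho, -, hval⟩ := exists_of_inputArray_ne_zero hp
    rw [hval]
    exact edgeCode_lt hn (hw _ (edge_mem_of_mem hD (List.getElem_mem ho)))

theorem index_eq_of_edge_eq {i i' : Fin M} {o o' : ℕ} {h : o < (D i).length}
    {h' : o' < (D i').length}
    (heq : s((D i)[o].1, (D i)[o].2) = s((D i')[o'].1, (D i')[o'].2)) : i = i' ∧ o = o' := by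
  have hnodup := hD.1
  rw [List.map_flatMap, List.nodup_flatMap] at hnodup
  obtain rfl : i = i' := by
    by_contra hne
    have : Std.Symm (Function.onFun List.Disjoint
        fun a => List.map (fun e => s(e.1, e.2)) (D a)) := ⟨fun _ _ h => List.Disjoint.symm h⟩
    have hdisj := hnodup.2.forall (List.mem_finRange i) (List.mem_finRange i') hne
    refine hdisj (List.mem_map_of_mem (List.getElem_mem h)) ?_
    rw [heq]
    exact List.mem_map_of_mem (List.getElem_mem h')
  refine ⟨rfl, ((hnodup.1 i (List.mem_finRange i)).getElem_inj_iff (hi := by simpa using h)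
    (hj := by simpa using h')).1 ?_⟩
  simpa only [List.getElem_map] using heq

theorem sum_length_eq_ncard_edgeSet : ∑ i, (D i).length = G.edgeSet.ncard := by
  classical
  have hset : G.edgeSet = ↑(((List.finRange M).flatMap D).map fun e => s(e.1, e.2)).toFinset := by
    ext e
    rw [List.coe_toFinset]
    exact (hD.2 e).symm
  rw [hset, Set.ncard_coe_finset, List.toFinset_card_of_nodup hD.1, List.length_map,
    List.length_flatMap, Fin.sum_univ_def]

theorem count_inputArray (hlen : ∀ i, (D i).length ≤ d) :
    Nat.count (inputArray d β w D · ≠ 0) (M * d) = G.edgeSet.ncard := by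
  rw [Nat.count_eq_card_filter_range, Finset.card_filter,
    ← sum_blocks fun p => if inputArray d β w D p ≠ 0 then 1 else 0,
    ← sum_length_eq_ncard_edgeSet hD]
  refine Finset.sum_congr rfl fun i _ => ?_
  have hne : ∀ o : Fin d, inputArray d β w D (i * d + o) ≠ 0 ↔ (o : ℕ) < (D i).length := by
    intro o
    rw [inputArray_address i o.2]
    split_ifs with h <;> simp [h, edgeCode]
  simp only [hne]
  have hfilter : (Finset.range d).filter (· < (D i).length) = Finset.range (D i).length := by
    ext o
    have := hlen i
    simp only [Finset.mem_filter, Finset.mem_range]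
    omega
  rw [← Finset.sum_range fun o => if o < (D i).length then 1 else 0, ← Finset.card_filter,
    hfilter, Finset.card_range]

end Distribution

/-- `ed` lists the edges of `G`, each of them once and in one of its two orientations. -/
structure IsEdgeEnumeration (G : SimpleGraph (Fin n)) (ed : Fin m → Fin n × Fin n) : Prop where
  adj : ∀ r, G.Adj (ed r).1 (ed r).2
  inj : ∀ {r r'}, s((ed r).1, (ed r).2) = s((ed r').1, (ed r').2) → r = r'
  exists_eq : ∀ {u v}, G.Adj u v → ∃ r, s((ed r).1, (ed r).2) = s(u, v)

theorem isEdgeEnumeration_of_injective {ed : Fin m → Fin n × Fin n}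
    (hadj : ∀ r, G.Adj (ed r).1 (ed r).2)
    (hinj : ∀ {r r'}, s((ed r).1, (ed r).2) = s((ed r').1, (ed r').2) → r = r')
    (hm : G.edgeSet.ncard = m) : IsEdgeEnumeration G ed where
  adj := hadj
  inj := hinj
  exists_eq {u v} huv := by
    have : Fintype G.edgeSet := Fintype.ofFinite _
    have hcard : Fintype.card (Fin m) = Fintype.card G.edgeSet := by
      rw [Fintype.card_fin, ← hm, ← Nat.card_eq_fintype_card, Nat.card_coe_set_eq]
    have hbij : Function.Bijective fun r => (⟨s((ed r).1, (ed r).2), hadj r⟩ : G.edgeSet) :=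
      (Fintype.bijective_iff_injective_and_card _).2
        ⟨fun r r' h => hinj (congrArg Subtype.val h), hcard⟩
    obtain ⟨r, hr⟩ := hbij.2 ⟨s(u, v), huv⟩
    exact ⟨r, congrArg Subtype.val hr⟩

theorem exists_isEdgeEnumeration (hD : IsEdgeDistribution G D) (hlen : ∀ i, (D i).length ≤ d)
    (hm : G.edgeSet.ncard = m) :
    ∃ ed : Fin m → Fin n × Fin n, IsEdgeEnumeration G ed ∧ ∀ r : Fin m,
      inputArray d β w D (Nat.nth (inputArray d β w D · ≠ 0) r) = edgeCode β w (ed r) := by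
  have hcount : ∀ r : Fin m, r < Nat.count (inputArray d β w D · ≠ 0) (M * d) := fun r => by
    rw [count_inputArray hD hlen, hm]
    exact r.2
  choose i o h hpos hval using fun r : Fin m =>
    exists_of_inputArray_ne_zero (nth_mem_of_lt_count (hcount r))
  refine ⟨fun r => (D (i r))[o r]'(h r), isEdgeEnumeration_of_injective
    (fun r => edge_mem_of_mem hD (List.getElem_mem (h r))) (fun {r r'} heq => ?_) hm, hval⟩
  obtain ⟨hi, ho⟩ := index_eq_of_edge_eq hD heq
  have haddr : d * (i r : ℕ) + o r = d * i r' + o r' := by rw [hi, ho]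
  have hnth := (hpos r).trans (haddr.trans (hpos r').symm)
  have hr := congrArg (Nat.count (inputArray d β w D · ≠ 0)) hnth
  rw [count_nth_of_lt_count (hcount r), count_nth_of_lt_count (hcount r')] at hr
  exact Fin.ext hr

end Input

end CellMachine

/-! ### The copies of the graph and their labels -/

namespace CellMachine

open ShiftedClustering

/-- The initial label of node `s`: the shift, determined by the coin `c`, and the name of the node.
There are `ν` nodes. -/
def initLabel (ν Λ c s : ℕ) : ℕ := ν * (Nat.size c * Λ) + s

/-- The two orientations of an edge. -/
def orient {α : Type*} (b : ℕ) (e : α × α) : α × α := if b = 0 then e else e.swap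

theorem sym2_mk_orient {α : Type*} (b : ℕ) (e : α × α) :
    s((orient b e).1, (orient b e).2) = s(e.1, e.2) := by
  unfold orient
  split_ifs
  exacts [rfl, Sym2.eq_swap]

theorem orient_natCast {n : ℕ} (b : ℕ) (e : Fin n × Fin n) :
    orient b ((e.1 : ℕ), (e.2 : ℕ)) = (((orient b e).1 : ℕ), ((orient b e).2 : ℕ)) := by
  unfold orient
  split_ifs <;> rfl

/-- The record of the arc `e` in copy `j` of the graph. Node `j * n + u` stands for vertex `u` in
copy `j`, and there are `T` copies. The label is a placeholder that exceeds all initial labels. -/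
def edgeEntry {n : ℕ} (T β : ℕ) (cst : ℕ → ℕ) (w : Sym2 (Fin n) → ℕ) (j : ℕ)
    (e : Fin n × Fin n) : Entry :=
  ⟨j * n + e.1, j * n + e.2, T * n * cst (w s(e.1, e.2)), β - 1, 0⟩

/-- The record of node `s`, which carries the initial label. -/
def selfEntry (ν Λ c s : ℕ) : Entry := ⟨s, s, 0, initLabel ν Λ c s, 0⟩

/-- The record that is created in cell `p`, given the code `v` of an edge and the coin `c`. The
first `2 * T * m` cells are for the `T` copies of the `m` edges in both orientations, the following
`T * n` cells for the nodes. -/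
def createEntry (n m T β Λ : ℕ) (cst : ℕ → ℕ) (p v c : ℕ) : ℕ :=
  if p < 2 * T * m then
    let e := orient (p % (2 * T) % 2) ((v - 1) % β, (v - 1) / β % β)
    Entry.code β ⟨p % (2 * T) / 2 * n + e.1, p % (2 * T) / 2 * n + e.2,
      T * n * cst ((v - 1) / β / β), β - 1, 0⟩
  else if p < 2 * T * m + T * n then Entry.code β (selfEntry (T * n) Λ c (p - 2 * T * m))
  else 0

/-- The records that are created from the edges `ed` and the coins `z`. -/
def createdEntry {n m : ℕ} (T β Λ : ℕ) (cst : ℕ → ℕ) (w : Sym2 (Fin n) → ℕ)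
    (ed : Fin m → Fin n × Fin n) (z : ℕ → ℕ) (p : Fin (2 * T * m + T * n)) : Entry :=
  if h : (p : ℕ) < 2 * T * m then
    edgeEntry T β cst w (p % (2 * T) / 2)
      (orient (p % (2 * T) % 2) (ed ⟨p / (2 * T), Nat.div_lt_of_lt_mul h⟩))
  else selfEntry (T * n) Λ (z p) (p - 2 * T * m)

variable {n m T β Λ : ℕ} {cst : ℕ → ℕ} {w : Sym2 (Fin n) → ℕ} {G : SimpleGraph (Fin n)}
  {ed : Fin m → Fin n × Fin n} {z : ℕ → ℕ}

theorem createEntry_edgeCode (hn : n ≤ β) {p : ℕ} (hp : p < 2 * T * m) (e : Fin n × Fin n)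
    (c : ℕ) : createEntry n m T β Λ cst p (edgeCode β w e) c =
      (edgeEntry T β cst w (p % (2 * T) / 2) (orient (p % (2 * T) % 2) e)).code β := by
  have he₁ : (e.1 : ℕ) < β := e.1.2.trans_le hn
  have he₂ : (e.2 : ℕ) < β := e.2.2.trans_le hn
  have hβ : 0 < β := (Nat.zero_le _).trans_lt he₁
  have hmod : (edgeCode β w e - 1) % β = e.1 := by
    rw [edgeCode, Nat.add_sub_cancel_left, Nat.add_mul_mod_self_left, Nat.mod_eq_of_lt he₁]
  have hdiv : (edgeCode β w e - 1) / β = e.2 + β * w s(e.1, e.2) := by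
    rw [edgeCode, Nat.add_sub_cancel_left, Nat.add_mul_div_left _ _ hβ, Nat.div_eq_of_lt he₁,
      zero_add]
  have hdivmod : (edgeCode β w e - 1) / β % β = e.2 := by
    rw [hdiv, Nat.add_mul_mod_self_left, Nat.mod_eq_of_lt he₂]
  have hdivdiv : (edgeCode β w e - 1) / β / β = w s(e.1, e.2) := by
    rw [hdiv, Nat.add_mul_div_left _ _ hβ, Nat.div_eq_of_lt he₂, zero_add]
  simp only [createEntry, hp, if_true, hmod, hdivmod, hdivdiv, orient_natCast, edgeEntry,
    sym2_mk_orient]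

theorem createEntry_eq (hn : n ≤ β) {x : ℕ → ℕ} (hx : ∀ p (hp : p < 2 * T * m),
    x p = edgeCode β w (ed ⟨p / (2 * T), Nat.div_lt_of_lt_mul hp⟩)) (p : ℕ) :
    createEntry n m T β Λ cst p (x p) (z p) =
      entryArray β (createdEntry T β Λ cst w ed z) p := by
  rcases lt_or_ge p (2 * T * m) with hp | hp
  · have hpN : p < 2 * T * m + T * n := by omega
    simp only [hx p hp, createEntry_edgeCode hn hp, entryArray, pad, hpN, dif_pos, createdEntry, hp]
  · simp only [createEntry, hp.not_gt, if_false, entryArray, pad, createdEntry, dif_neg,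
      not_false_eq_true]
    split_ifs <;> rfl

theorem node_lt {j : ℕ} (hj : j < T) (u : Fin n) : j * n + u < T * n := by
  rw [add_comm, mul_comm j, mul_comm T]
  exact Entry.add_mul_lt u.2 hj

/-- The records are, without repetition, those of the arcs of `T` copies of `G` and of the nodes of
these copies. -/
structure RepresentsCopies {N : ℕ} (T β Λ : ℕ) (cst : ℕ → ℕ) (G : SimpleGraph (Fin n))
    (w : Sym2 (Fin n) → ℕ) (ζ : ℕ → ℕ) (E : Fin N → Entry) : Prop where
  edge_or_self : ∀ p, (∃ j < T, ∃ u v, G.Adj u v ∧ E p = edgeEntry T β cst w j (u, v)) ∨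
    ∃ s < T * n, E p = selfEntry (T * n) Λ (ζ s) s
  exists_edge : ∀ j < T, ∀ u v, G.Adj u v → ∃ p, E p = edgeEntry T β cst w j (u, v)
  exists_self : ∀ s < T * n, ∃ p, E p = selfEntry (T * n) Λ (ζ s) s
  inj : ∀ {p q}, (E p).src = (E q).src → (E p).tgt = (E q).tgt → p = q

section Created

theorem createdEntry_edge {p : Fin (2 * T * m + T * n)} (r : Fin m) (j : Fin T) (b : Fin 2)
    (hp : (p : ℕ) = r * (2 * T) + (2 * j + b)) :
    createdEntry T β Λ cst w ed z p = edgeEntry T β cst w j (orient b (ed r)) := by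
  have ho : 2 * (j : ℕ) + b < 2 * T := by omega
  have hlt : (p : ℕ) < 2 * T * m := by
    rw [hp, add_comm, mul_comm (r : ℕ)]
    exact Entry.add_mul_lt ho r.2
  have hdiv : (p : ℕ) / (2 * T) = r := by rw [hp, address_div ho]
  have hmod : (p : ℕ) % (2 * T) = 2 * j + b := by rw [hp, address_mod ho]
  have hj : (2 * (j : ℕ) + b) / 2 = j := by omega
  have hb : (2 * (j : ℕ) + b) % 2 = b := by omega
  simp only [createdEntry, hlt, dif_pos, hdiv, hmod, hj, hb, Fin.eta]

theorem createdEntry_self {p : Fin (2 * T * m + T * n)} {s : ℕ} (hp : (p : ℕ) = 2 * T * m + s) :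
    createdEntry T β Λ cst w ed z p = selfEntry (T * n) Λ (z (2 * T * m + s)) s := by
  rw [createdEntry, dif_neg (by omega), hp, Nat.add_sub_cancel_left]

theorem exists_index_eq (p : Fin (2 * T * m + T * n)) :
    (∃ (r : Fin m) (j : Fin T) (b : Fin 2), (p : ℕ) = r * (2 * T) + (2 * j + b)) ∨
      ∃ s < T * n, (p : ℕ) = 2 * T * m + s := by
  rcases lt_or_ge (p : ℕ) (2 * T * m) with hp | hp
  · have hT : 0 < 2 * T := Nat.pos_of_ne_zero fun h => by simp [h] at hp
    have hmod := Nat.mod_lt (p : ℕ) hT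
    have hsum := Nat.div_add_mod' (p : ℕ) (2 * T)
    exact Or.inl ⟨⟨p / (2 * T), Nat.div_lt_of_lt_mul hp⟩, ⟨p % (2 * T) / 2, by omega⟩,
      ⟨p % (2 * T) % 2, Nat.mod_lt _ two_pos⟩, by simp only; omega⟩
  · exact Or.inr ⟨p - 2 * T * m, by omega, by omega⟩

theorem exists_createdEntry_eq_edgeEntry (r : Fin m) (j : Fin T) (b : Fin 2) :
    ∃ p, createdEntry T β Λ cst w ed z p = edgeEntry T β cst w j (orient b (ed r)) := by
  have hlt : r * (2 * T) + (2 * j + b) < 2 * T * m := by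
    rw [add_comm, mul_comm (r : ℕ)]
    exact Entry.add_mul_lt (by omega) r.2
  exact ⟨⟨_, hlt.trans_le (Nat.le_add_right _ _)⟩, createdEntry_edge r j b rfl⟩

theorem edgeEntry_inj {j j' : ℕ} {e e' : Fin n × Fin n}
    (hsrc : (edgeEntry T β cst w j e).src = (edgeEntry T β cst w j' e').src)
    (htgt : (edgeEntry T β cst w j e).tgt = (edgeEntry T β cst w j' e').tgt) :
    j = j' ∧ e = e' := by
  obtain ⟨hj, h₁⟩ := address_inj e.1.2 e'.1.2 hsrc
  obtain ⟨-, h₂⟩ := address_inj e.2.2 e'.2.2 htgt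
  exact ⟨hj, Prod.ext (Fin.ext h₁) (Fin.ext h₂)⟩

variable (hed : IsEdgeEnumeration G ed)
include hed

theorem adj_orient (b : ℕ) (r : Fin m) : G.Adj (orient b (ed r)).1 (orient b (ed r)).2 := by
  rw [← SimpleGraph.mem_edgeSet, sym2_mk_orient]
  exact hed.adj r

theorem orient_inj {r r' : Fin m} {b b' : Fin 2} (h : orient b (ed r) = orient b' (ed r')) :
    r = r' ∧ b = b' := by
  obtain rfl : r = r' := hed.inj (by rw [← sym2_mk_orient b, h, sym2_mk_orient])
  have hne : ed r ≠ (ed r).swap := fun heq => (hed.adj r).ne (congrArg Prod.fst heq)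
  fin_cases b <;> fin_cases b' <;> simp_all [orient, hne.symm]

theorem exists_orient_eq {u v : Fin n} (huv : G.Adj u v) :
    ∃ (r : Fin m) (b : Fin 2), orient b (ed r) = (u, v) := by
  obtain ⟨r, hr⟩ := hed.exists_eq huv
  rcases Sym2.eq_iff.1 hr with ⟨h₁, h₂⟩ | ⟨h₁, h₂⟩
  · exact ⟨r, 0, Prod.ext h₁ h₂⟩
  · exact ⟨r, 1, Prod.ext h₂ h₁⟩

theorem createdEntry_injective {p q : Fin (2 * T * m + T * n)}
    (hsrc : (createdEntry T β Λ cst w ed z p).src = (createdEntry T β Λ cst w ed z q).src)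
    (htgt : (createdEntry T β Λ cst w ed z p).tgt = (createdEntry T β Λ cst w ed z q).tgt) :
    p = q := by
  have hne : ∀ (j b : ℕ) (r : Fin m), (edgeEntry T β cst w j (orient b (ed r))).src ≠
      (edgeEntry T β cst w j (orient b (ed r))).tgt := fun j b r h =>
    (adj_orient hed b r).ne (Fin.ext (Nat.add_left_cancel h))
  rcases exists_index_eq p with ⟨r, j, b, hp⟩ | ⟨s, -, hp⟩ <;>
    rcases exists_index_eq q with ⟨r', j', b', hq⟩ | ⟨s', -, hq⟩
  · rw [createdEntry_edge r j b hp, createdEntry_edge r' j' b' hq] at hsrc htgt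
    obtain ⟨hj, he⟩ := edgeEntry_inj hsrc htgt
    obtain ⟨rfl, rfl⟩ := orient_inj hed he
    exact Fin.ext (by rw [hp, hq, hj])
  · rw [createdEntry_edge r j b hp, createdEntry_self hq] at hsrc htgt
    exact absurd (hsrc.trans htgt.symm) (hne j b r)
  · rw [createdEntry_self hp, createdEntry_edge r' j' b' hq] at hsrc htgt
    exact absurd (hsrc.symm.trans htgt) (hne j' b' r')
  · rw [createdEntry_self hp, createdEntry_self hq] at hsrc
    exact Fin.ext (by rw [hp, hq]; exact congrArg _ hsrc)

theorem representsCopies_createdEntry : RepresentsCopies T β Λ cst G w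
    (fun s => z (2 * T * m + s)) (createdEntry T β Λ cst w ed z) where
  edge_or_self p := by
    rcases exists_index_eq p with ⟨r, j, b, hp⟩ | ⟨s, hs, hp⟩
    · exact Or.inl ⟨j, j.2, _, _, adj_orient hed b r, createdEntry_edge r j b hp⟩
    · exact Or.inr ⟨s, hs, createdEntry_self hp⟩
  exists_edge j hj u v huv := by
    obtain ⟨r, b, hrb⟩ := exists_orient_eq hed huv
    exact hrb ▸ exists_createdEntry_eq_edgeEntry r ⟨j, hj⟩ b
  exists_self s hs := ⟨⟨2 * T * m + s, by omega⟩, createdEntry_self rfl⟩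
  inj := createdEntry_injective hed

end Created

/-- The bounds that the numbers occurring in the algorithm have to satisfy. There are `N` records
of numbers less than `β`, and `A` bounds the labels. -/
structure Bounds (N K n T β Λ B A : ℕ) (cst : ℕ → ℕ) (G : SimpleGraph (Fin n))
    (w : Sym2 (Fin n) → ℕ) (ζ : ℕ → ℕ) : Prop where
  payload : (β ^ 5 + 1) * (N + 1) < K
  size_le : N ≤ β
  node_le : T * n ≤ N
  key_le : T * n * (T * n) ≤ 2 ^ B
  init_le : ∀ s < T * n, initLabel (T * n) Λ (ζ s) s ≤ A
  lab_lt : A < β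
  cost_lt : ∀ u v, G.Adj u v → A + T * n * cst (w s(u, v)) < β

/-- In every copy of `G`, `L` are the labels of the Bellman–Ford algorithm. -/
def IsCopywiseBellmanFord (T Λ : ℕ) (cst : ℕ → ℕ) (G : SimpleGraph (Fin n))
    (w : Sym2 (Fin n) → ℕ) (ζ : ℕ → ℕ) (L : ℕ → ℕ → ℕ) : Prop :=
  ∀ j < T, IsBellmanFord G (fun e => T * n * cst (w e))
    (fun u => initLabel (T * n) Λ (ζ (j * n + u)) (j * n + u)) fun i u => L i (j * n + u)

namespace RepresentsCopies

variable {N K B A : ℕ} {ζ : ℕ → ℕ} {E : Fin N → Entry}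
  (hE : RepresentsCopies T β Λ cst G w ζ E)
include hE

theorem isArcList : IsArcList (T * n) E where
  src_lt p := by
    obtain ⟨j, hj, u, v, -, hp⟩ | ⟨s, hs, hp⟩ := hE.edge_or_self p <;> rw [hp]
    exacts [node_lt hj u, hs]
  tgt_lt p := by
    obtain ⟨j, hj, u, v, -, hp⟩ | ⟨s, hs, hp⟩ := hE.edge_or_self p <;> rw [hp]
    exacts [node_lt hj v, hs]
  inj := hE.inj
  exists_reverse p := by
    obtain ⟨j, hj, u, v, huv, hp⟩ | ⟨s, -, hp⟩ := hE.edge_or_self p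
    · obtain ⟨q, hq⟩ := hE.exists_edge j hj v u huv.symm
      exact ⟨q, by rw [hq, hp]; rfl, by rw [hq, hp]; rfl,
        by rw [hq, hp, edgeEntry, edgeEntry, Sym2.eq_swap]⟩
    · exact ⟨p, by rw [hp]; rfl, by rw [hp]; rfl, rfl⟩

theorem add_cost_lt (hb : Bounds N K n T β Λ B A cst G w ζ) (p : Fin N) :
    A + (E p).cost < β := by
  obtain ⟨j, -, u, v, huv, hp⟩ | ⟨s, -, hp⟩ := hE.edge_or_self p <;> rw [hp]
  exacts [hb.cost_lt u v huv, hb.lab_lt]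

theorem bounded (hb : Bounds N K n T β Λ B A cst G w ζ) (p : Fin N) : (E p).Bounded β where
  src := (hE.isArcList.src_lt p).trans_le (hb.node_le.trans hb.size_le)
  tgt := (hE.isArcList.tgt_lt p).trans_le (hb.node_le.trans hb.size_le)
  cost := (Nat.le_add_left _ _).trans_lt (hE.add_cost_lt hb p)
  lab := by
    obtain ⟨j, -, u, v, -, hp⟩ | ⟨s, hs, hp⟩ := hE.edge_or_self p <;> rw [hp]
    exacts [Nat.sub_lt ((Nat.zero_le A).trans_lt hb.lab_lt) one_pos,
      (hb.init_le s hs).trans_lt hb.lab_lt]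
  ptr := by
    have hβ := (Nat.zero_le A).trans_lt hb.lab_lt
    obtain ⟨j, -, u, v, -, hp⟩ | ⟨s, -, hp⟩ := hE.edge_or_self p <;> rw [hp]
    exacts [hβ, hβ]

theorem exists_loop (hb : Bounds N K n T β Λ B A cst G w ζ) {s : ℕ} (hs : s < T * n) :
    ∃ p, (E p).src = s ∧ (E p).tgt = s ∧ (E p).cost = 0 ∧ (E p).lab ≤ A := by
  obtain ⟨p, hp⟩ := hE.exists_self s hs
  refine ⟨p, ?_⟩
  rw [hp]
  exact ⟨rfl, rfl, rfl, hb.init_le s hs⟩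

theorem isLeast_initLabel (hb : Bounds N K n T β Λ B A cst G w ζ) {s : ℕ} (hs : s < T * n) :
    IsLeast {x | ∃ p, (E p).tgt = s ∧ x = (E p).lab} (initLabel (T * n) Λ (ζ s) s) := by
  refine ⟨?_, ?_⟩
  · obtain ⟨p, hp⟩ := hE.exists_self s hs
    exact ⟨p, by rw [hp]; rfl, by rw [hp]; rfl⟩
  · rintro x ⟨p, htgt, rfl⟩
    obtain ⟨j, -, u, v, -, hp⟩ | ⟨s', -, hp⟩ := hE.edge_or_self p <;> rw [hp] at htgt ⊢
    · exact (hb.init_le s hs).trans (Nat.le_sub_one_of_lt hb.lab_lt)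
    · exact (congrArg (fun s => initLabel (T * n) Λ (ζ s) s) htgt).ge

theorem setOf_arc_eq (l : ℕ → ℕ) {j : ℕ} (hj : j < T) (u : Fin n) :
    {x | ∃ p, (E p).src = j * n + u ∧ x = l (E p).tgt + (E p).cost} =
      {x | x = l (j * n + u) ∨
        ∃ v : Fin n, G.Adj u v ∧ x = l (j * n + v) + T * n * cst (w s(u, v))} := by
  ext x
  constructor
  · rintro ⟨p, hsrc, rfl⟩
    obtain ⟨j', -, u', v, huv, hp⟩ | ⟨s, -, hp⟩ := hE.edge_or_self p <;> rw [hp] at hsrc ⊢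
    · obtain ⟨rfl, hu⟩ := address_inj u'.2 u.2 hsrc
      obtain rfl : u' = u := Fin.ext hu
      exact Or.inr ⟨v, huv, rfl⟩
    · exact Or.inl (congrArg l hsrc)
  · rintro (rfl | ⟨v, huv, rfl⟩)
    · obtain ⟨p, hp⟩ := hE.exists_self _ (node_lt hj u)
      exact ⟨p, by rw [hp]; rfl, by rw [hp]; rfl⟩
    · obtain ⟨p, hp⟩ := hE.exists_edge j hj u v huv
      exact ⟨p, by rw [hp]; rfl, by rw [hp]; rfl⟩

theorem isCopywiseBellmanFord (hb : Bounds N K n T β Λ B A cst G w ζ) {L : ℕ → ℕ → ℕ}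
    (hL : IsArcBellmanFord (T * n) E L) : IsCopywiseBellmanFord T Λ cst G w ζ L := fun _ hj =>
  ⟨fun u => (hL.zero _ (node_lt hj u)).unique (hE.isLeast_initLabel hb (node_lt hj u)),
    fun i u => hE.setOf_arc_eq (L i) hj u ▸ hL.succ i _ (node_lt hj u)⟩

end RepresentsCopies

/-- All rounds between input and output. -/
def coverRounds (M d H n m T β Λ B I : ℕ) (cst : ℕ → ℕ) : List (Round M (2 * d)) :=
  spreadRounds M d H m (2 * T) (β ^ 3 + 1) ++
    ([routeRound M d (fun p _ => p) (createEntry n m T β Λ cst)] ++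
      (linkRounds M d H (2 * T * m + T * n) β B (T * n) ++
        bellmanFordRounds M d H (2 * T * m + T * n) β I))

theorem length_coverRounds (M d H n m T β Λ B I : ℕ) (cst : ℕ → ℕ) :
    (coverRounds M d H n m T β Λ B I cst).length =
      2 * H + 5 + (1 + (2 * (B * (H + 3)) + 2 + ((2 * H + 7) * I + (2 * H + 6)))) := by
  simp only [coverRounds, List.length_append, length_spreadRounds, List.length_singleton,
    length_linkRounds, length_bellmanFordRounds]

/-- The coin for cell `p`. -/
def cellCoin {M : ℕ} (d : ℕ) (c : Fin M → ℕ → ℕ) (p : ℕ) : ℕ :=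
  if h : p / d < M then c ⟨p / d, h⟩ (p % d) else 0

section Exec

variable {M d H mem K B A I : ℕ} (hP : Params M d H mem K) (hN : 2 * T * m + T * n ≤ M * d)
include hP

theorem exec_createEntry (hn : n ≤ β) {x : ℕ → ℕ} (hx : ∀ p (hp : p < 2 * T * m),
    x p = edgeCode β w (ed ⟨p / (2 * T), Nat.div_lt_of_lt_mul hp⟩)) {c : ℕ → Fin M → ℕ → ℕ}
    (hE : ∀ p, (createdEntry T β Λ cst w ed (cellCoin d (c 0)) p).code β < K) :
    Exec mem K [routeRound M d (fun p _ => p) (createEntry n m T β Λ cst)] c (ofArray M d x)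
      (ofArray M d (entryArray β (createdEntry T β Λ cst w ed (cellCoin d (c 0))))) := by
  have hc : ∀ (i : Fin M) (o : Fin d), c 0 i o = cellCoin d (c 0) (i * d + o) := fun i o => by
    simp only [cellCoin, address_div o.2, address_mod o.2, i.2, dif_pos]
  refine ⟨stepOK_routeRound hc (fun p _ p' _ h => h)
    ((Nat.le_mul_of_pos_left d two_pos).trans hP.mem_le) hP.pos fun p _ => ?_, ?_⟩
  · rw [createEntry_eq hn hx]
    exact pad_lt hP.pos hE p
  · refine (step_routeRound hc).trans (ofArray_congr fun q hq => ?_)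
    rw [routeArray, Finset.sum_ite_eq' (Finset.range (M * d)) q, if_pos (Finset.mem_range.2 hq),
      createEntry_eq hn hx]

include hN in
theorem exists_exec_coverRounds (hT : 0 < T) {D : Fin M → List (Fin n × Fin n)}
    (hD : IsEdgeDistribution G D) (hlen : ∀ i, (D i).length ≤ d) (hm : G.edgeSet.ncard = m)
    (hw : ∀ e ∈ G.edgeSet, w e < β) {c : ℕ → Fin M → ℕ → ℕ}
    (hb : Bounds (2 * T * m + T * n) K n T β Λ B A cst G w
      fun s => cellCoin d (c (2 * H + 5)) (2 * T * m + s)) :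
    ∃ (E : Fin (2 * T * m + T * n) → Entry) (L : ℕ → ℕ → ℕ),
      Exec mem K (coverRounds M d H n m T β Λ B I cst) c
        (fun i => readInput M d β i (edgeInput w D i)) (ofArray M d (entryArray β E)) ∧
      IsLabeledBy (T * n) β E (L I) ∧
      IsCopywiseBellmanFord T Λ cst G w
        (fun s => cellCoin d (c (2 * H + 5)) (2 * T * m + s)) L := by
  have hnβ : n ≤ β := (Nat.le_mul_of_pos_left n hT).trans (hb.node_le.trans hb.size_le)
  have hK : (β ^ 3 + 1) * (m + 1) < K := by
    have hβ : 0 < β := (Nat.zero_le A).trans_lt hb.lab_lt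
    have hmT : m ≤ 2 * T * m := Nat.le_mul_of_pos_left m (by omega)
    refine lt_of_le_of_lt (Nat.mul_le_mul ?_ (by omega)) hb.payload
    exact Nat.add_le_add_right (Nat.pow_le_pow_right hβ (by norm_num)) _
  obtain ⟨ed, hed, hcode⟩ := exists_isEdgeEnumeration (β := β) (w := w) hD hlen hm
  have hspread := spreadRounds_computes (inputArray_lt hD hnβ hw) hP (w := 2 * T) (by omega) hK
    (hm ▸ count_inputArray hD hlen)
  have hE := representsCopies_createdEntry (T := T) (β := β) (Λ := Λ) (cst := cst) (w := w)
    (z := cellCoin d (c (2 * H + 5))) hed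
  obtain ⟨E, L, hcomp, hlab, hL⟩ := exists_bellmanFord_computes hP hN hb.payload hb.size_le
    hb.key_le (hE.bounded hb) hE.isArcList (hE.add_cost_lt hb)
    (fun _ hs => hE.exists_loop hb hs) I
  refine ⟨E, L, ?_, hlab, hE.isCopywiseBellmanFord hb hL⟩
  rw [readInput_eq]
  refine (hspread c).append (Exec.append ?_ (hcomp _))
  have hlength := length_spreadRounds M d H m (2 * T) (β ^ 3 + 1)
  convert exec_createEntry hP hnβ (fun p hp => ?_) fun p => ?_ using 3
  · rw [hlength, zero_add]
  · rw [if_pos hp]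
    exact hcode ⟨p / (2 * T), Nat.div_lt_of_lt_mul hp⟩
  · simp only [hlength, zero_add]
    exact code_lt_of_bounded hb.payload (hE.bounded hb p)

end Exec

end CellMachine

/-! ### The output clusters -/

namespace CellMachine

theorem mem_wordPairs_flatMap {ι : Type*} (P : ι → Prop) [DecidablePred P] (a b : ι → ℕ)
    (l : List ι) (x y : ℕ) :
    (x, y) ∈ wordPairs (l.flatMap fun o => if P o then [a o, b o] else []) ↔
      ∃ o ∈ l, P o ∧ a o = x ∧ b o = y := by
  induction l with
  | nil => simp [wordPairs]
  | cons o l ih =>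
    by_cases h : P o
    · simp [h, wordPairs, ih, eq_comm]
    · simp [h, ih]

/-- The output of a machine: for every record that stands for a node of one of the copies, the
vertex and the name of its cluster. -/
def writeOutput {d : ℕ} (n β ν : ℕ) (x : Fin (2 * d) → ℕ) : List ℕ :=
  (List.finRange d).flatMap fun o =>
    if x (mainSlot o) ≠ 0 ∧
        (Entry.dec β (x (mainSlot o))).src = (Entry.dec β (x (mainSlot o))).tgt then
      [(Entry.dec β (x (mainSlot o))).src % n, (Entry.dec β (x (mainSlot o))).lab % ν]
    else []

theorem length_writeOutput_le {d : ℕ} (n β ν : ℕ) (x : Fin (2 * d) → ℕ) :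
    (writeOutput n β ν x).length ≤ 2 * d := by
  rw [writeOutput, List.length_flatMap]
  refine (List.sum_le_card_nsmul _ 2 fun y hy => ?_).trans (by simp [mul_comm])
  obtain ⟨o, -, rfl⟩ := List.mem_map.1 hy
  split_ifs <;> simp

theorem lt_of_mem_writeOutput {d n β ν Q : ℕ} (hn : 0 < n) (hν : 0 < ν) (hnQ : n ≤ Q) (hνQ : ν ≤ Q)
    {x : Fin (2 * d) → ℕ} {y : ℕ} (hy : y ∈ writeOutput n β ν x) : y < Q := by
  obtain ⟨o, -, ho⟩ := List.mem_flatMap.1 hy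
  split_ifs at ho
  · simp only [List.mem_cons, List.not_mem_nil, or_false] at ho
    rcases ho with rfl | rfl
    · exact (Nat.mod_lt _ hn).trans_le hnQ
    · exact (Nat.mod_lt _ hν).trans_le hνQ
  · simp at ho

/-- The clusters of all the copies, where `lab (j * n + v)` is the label of vertex `v` in copy
`j`. -/
def copyClusters (n T : ℕ) (lab : ℕ → ℕ) (c : ℕ) : Set (Fin n) :=
  {v | ∃ j < T, lab (j * n + v) % (T * n) = c}

section OutputClusters

variable {M d n T β N : ℕ} {E : Fin N → Entry}

theorem mem_outputClusters_writeOutput {ν : ℕ} (hN : N ≤ M * d) (hE : ∀ p, (E p).Bounded β)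
    (v : Fin n) (c : ℕ) :
    v ∈ outputClusters n (fun i => writeOutput n β ν (ofArray M d (entryArray β E) i)) c ↔
      ∃ p, (E p).src = (E p).tgt ∧ (E p).src % n = v ∧ (E p).lab % ν = c := by
  have harray : ∀ p : Fin N, entryArray β E p = (E p).code β := pad_val _
  simp only [outputClusters, Set.mem_ofPred_eq, writeOutput, mem_wordPairs_flatMap,
    ofArray_mainSlot]
  constructor
  · rintro ⟨i, o, -, ⟨hne, hself⟩, hsrc, hlab⟩
    have hp : (i * d + o : ℕ) < N := by
      by_contra hp
      exact hne (pad_of_le _ (not_lt.1 hp))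
    rw [harray ⟨_, hp⟩, Entry.dec_code (hE _)] at hself hsrc hlab
    exact ⟨⟨_, hp⟩, hself, hsrc, hlab⟩
  · rintro ⟨p, hself, hsrc, hlab⟩
    have hpM : (p : ℕ) < M * d := p.2.trans_le hN
    have hd : 0 < d := Nat.pos_of_mul_pos_left ((Nat.zero_le _).trans_lt hpM)
    refine ⟨⟨p / d, Nat.div_lt_of_lt_mul (by rwa [mul_comm])⟩, ⟨p % d, Nat.mod_lt _ hd⟩,
      List.mem_finRange _, ?_⟩
    simp only [Nat.div_add_mod', harray, Entry.dec_code (hE p)]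
    exact ⟨⟨Entry.code_ne_zero _ _, hself⟩, hsrc, hlab⟩

theorem outputClusters_writeOutput (hN : N ≤ M * d) {lab : ℕ → ℕ}
    (hE : IsLabeledBy (T * n) β E lab) :
    outputClusters n (fun i => writeOutput n β (T * n) (ofArray M d (entryArray β E) i)) =
      copyClusters n T lab := by
  ext c v
  rw [mem_outputClusters_writeOutput hN hE.bounded]
  constructor
  · rintro ⟨p, -, hsrc, hlab⟩
    refine ⟨(E p).src / n, Nat.div_lt_of_lt_mul (by rw [mul_comm]; exact hE.src_lt p), ?_⟩
    rw [← hsrc, Nat.div_add_mod', ← hE.lab_eq, hlab]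
  · rintro ⟨j, hj, hlab⟩
    obtain ⟨p, hsrc, htgt⟩ := hE.exists_self _ (node_lt hj v)
    refine ⟨p, hsrc.trans htgt.symm, ?_, by rw [hE.lab_eq, hsrc, hlab]⟩
    rw [hsrc, address_mod v.2]

end OutputClusters

end CellMachine

namespace ShiftedClustering

open CellMachine

section CopyClusters

variable {n T S : ℕ} {G : SimpleGraph (Fin n)} {κ : Sym2 (Fin n) → ℕ} {sh lab : ℕ → ℕ}

theorem exists_path_in_copyClusters
    (hlab : ∀ j < T, IsCenterLabeling G κ (T * n) (fun u => sh (j * n + u)) (fun u => j * n + u)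
      fun u => lab (j * n + u))
    (hpos : ∀ e ∈ G.edgeSet, 0 < κ e) (hS : ∀ s, sh s ≤ S) {c : ℕ} {x y : Fin n}
    (hx : x ∈ copyClusters n T lab c) (hy : y ∈ copyClusters n T lab c) :
    ∃ p : G.Walk x y, p.IsPath ∧ (∀ z ∈ p.support, z ∈ copyClusters n T lab c) ∧
      walkWeight κ p ≤ 2 * S := by
  obtain ⟨j, hj, hx⟩ := hx
  obtain ⟨j', hj', hy⟩ := hy
  -- The name `j * n + v` of the common center determines the copy.
  obtain rfl : j = j' := by
    obtain ⟨v, hv⟩ := (hlab j hj).exists_mod_eq hpos (fun u => node_lt hj u) x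
    obtain ⟨v', hv'⟩ := (hlab j' hj').exists_mod_eq hpos (fun u => node_lt hj' u) y
    have hcenter : j * n + v = j' * n + v' := by rw [← hv, ← hv', hx, hy]
    rw [← address_div (i := j) v.2, hcenter, address_div v'.2]
  obtain ⟨p, hp, hmem, hweight⟩ := (hlab j hj).exists_path_in_cluster hpos (fun u => node_lt hj u)
    (fun u u' huu => Fin.ext (Nat.add_left_cancel huu)) (fun u => hS _) (hx.trans hy.symm)
  exact ⟨p, hp, fun z hz => ⟨j, hj, (hmem z hz).trans hx⟩, hweight⟩

theorem setOf_mem_copyClusters (v : Fin n) :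
    {c | v ∈ copyClusters n T lab c} =
      ((Finset.range T).image fun j => lab (j * n + v) % (T * n) : Finset ℕ) := by
  ext c
  simp [copyClusters]

theorem ncard_setOf_mem_copyClusters_le (v : Fin n) :
    {c | v ∈ copyClusters n T lab c}.ncard ≤ T := by
  rw [setOf_mem_copyClusters, Set.ncard_coe_finset]
  exact Finset.card_image_le.trans (Finset.card_range T).le

end CopyClusters

/-- The cost of an edge of weight `x`: hops and weight are balanced such that `h` hops cost as much
as weight `r`. For `r = 0` an edge costs more than twice any shift, where shifts are determined by
coins of `b` bits. -/
def edgeCost (b h r x : ℕ) : ℕ := if r = 0 then 2 * b + 1 else h * x + r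

/-- The unit of the random shifts: larger than twice the cost of a walk with `h` hops and weight
`r`. -/
def shiftUnit (h r : ℕ) : ℕ := 2 * (2 * (h * r)) + 1

theorem edgeCost_pos {b h r : ℕ} (x : ℕ) : 0 < edgeCost b h r x := by
  unfold edgeCost
  split_ifs <;> omega

theorem edgeCost_of_pos {b h r : ℕ} (hr : 0 < r) : edgeCost b h r = fun x => h * x + r := by
  funext x
  simp [edgeCost, hr.ne']

section EdgeCost

variable {n T b h r : ℕ} {G : SimpleGraph (Fin n)} {w : Sym2 (Fin n) → ℕ} {ζ : ℕ → ℕ}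

theorem walkWeight_edgeCost_le (hw : ∀ e ∈ G.edgeSet, 1 ≤ w e) {u v : Fin n} (p : G.Walk u v)
    (hlen : p.length ≤ h) (hweight : walkWeight w p ≤ r) :
    walkWeight (fun e => edgeCost b h r (w e)) p ≤ 2 * (h * r) := by
  rcases Nat.eq_zero_or_pos r with rfl | hr
  · have hlength := length_mul_le_walkWeight hw p
    rw [walkWeight_eq_zero_of_length_eq_zero (by omega)]
    exact Nat.zero_le _
  · rw [edgeCost_of_pos hr, walkWeight_mul_add, two_mul]
    exact Nat.add_le_add (Nat.mul_le_mul_left h hweight) (Nat.mul_le_mul_right r hlen)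

theorem walkWeight_le_of_edgeCost (hh : 0 < h) {u v : Fin n} (p : G.Walk u v)
    (hp : walkWeight (fun e => edgeCost b h r (w e)) p ≤ 2 * (b * shiftUnit h r)) :
    walkWeight w p ≤ 10 * b * r := by
  rcases Nat.eq_zero_or_pos r with rfl | hr
  · have hlength := length_mul_le_walkWeight (G := G) (w := fun e => edgeCost b h 0 (w e))
      (k := 2 * b + 1) (fun e _ => by simp [edgeCost]) p
    have hlt : p.length * (2 * b + 1) < 1 * (2 * b + 1) :=
      (hlength.trans hp).trans_lt (by simp [shiftUnit])
    rw [walkWeight_eq_zero_of_length_eq_zero (Nat.lt_one_iff.1 (Nat.lt_of_mul_lt_mul_right hlt))]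
    exact Nat.zero_le _
  · rw [edgeCost_of_pos hr, walkWeight_mul_add] at hp
    refine Nat.le_of_mul_le_mul_left (?_ : h * _ ≤ h * _) hh
    calc h * walkWeight w p ≤ 2 * (b * (4 * (h * r) + 1)) := by
          rw [shiftUnit] at hp
          linarith [Nat.zero_le (p.length * r)]
      _ ≤ 2 * (b * (4 * (h * r) + h * r)) := by
          have : 0 < h * r := Nat.mul_pos hh hr
          gcongr
          omega
      _ = h * (10 * b * r) := by ring

theorem mul_shiftUnit_lt (hh : 0 < h) :
    b * shiftUnit h r < (5 * b * h + 1) * if r = 0 then 2 * b + 1 else r := by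
  unfold shiftUnit
  split_ifs with hr
  · subst hr
    nlinarith [Nat.zero_le (5 * b * h * (2 * b + 1))]
  · have hr : 0 < r := Nat.pos_of_ne_zero hr
    have : b * 1 ≤ b * (h * r) := Nat.mul_le_mul_left _ (Nat.mul_pos hh hr)
    nlinarith

theorem isCenterLabeling_of_isCopywiseBellmanFord {L : ℕ → ℕ → ℕ} (hh : 0 < h)
    (hb : ∀ s, Nat.size (ζ s) ≤ b)
    (hL : IsCopywiseBellmanFord T (shiftUnit h r) (edgeCost b h r) G w ζ L) {j : ℕ} (hj : j < T) :
    IsCenterLabeling G (fun e => edgeCost b h r (w e)) (T * n)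
      (fun u => Nat.size (ζ (j * n + u)) * shiftUnit h r) (fun u => j * n + u)
      fun u => L (5 * b * h) (j * n + u) := by
  refine (hL j hj).isShiftedDistance (k := T * n * if r = 0 then 2 * b + 1 else r)
    (fun e _ => Nat.mul_le_mul_left _ ?_) fun u => ?_
  · unfold edgeCost
    split_ifs <;> omega
  · calc T * n * (Nat.size (ζ (j * n + u)) * shiftUnit h r) + (j * n + u)
        ≤ T * n * (b * shiftUnit h r) + T * n := by
          have := (node_lt hj u).le
          have := hb (j * n + u)
          gcongr
      _ = T * n * (b * shiftUnit h r + 1) := by ring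
      _ ≤ (5 * b * h + 1) * (T * n * if r = 0 then 2 * b + 1 else r) := by
          rw [mul_left_comm]
          exact Nat.mul_le_mul_left _ (mul_shiftUnit_lt hh)

theorem length_le_and_walkWeight_le_of_isPath {a ℓ : ℕ} {W : ℝ}
    (hw : ∀ e ∈ G.edgeSet, w e ≤ n ^ a) {u v : Fin n} {p : G.Walk u v} (hp : p.IsPath)
    (hlen : p.length ≤ ℓ) (hweight : (walkWeight w p : ℝ) ≤ W) :
    p.length ≤ min ℓ n ∧ walkWeight w p ≤ min ⌊W⌋₊ (n ^ (a + 1)) := by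
  have hn : p.length ≤ n := by simpa using hp.length_lt.le
  refine ⟨le_min hlen hn, le_min (Nat.le_floor hweight) ?_⟩
  rw [pow_succ']
  exact (walkWeight_le_length_mul hw p).trans (Nat.mul_le_mul_right _ hn)

/-- Every vertex sees, in one of the `T` copies, a center whose shifted distance, with the coins
`ζ`, beats those of all the other centers by a whole shift unit. Distances are capped above all the
shifts. -/
def HasWinners (T b h r : ℕ) (G : SimpleGraph (Fin n)) (w : Sym2 (Fin n) → ℕ) (ζ : ℕ → ℕ) : Prop :=
  ∀ u, ∃ j < T, ∃ v : Fin n, ∀ x : Fin n, x ≠ v →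
    Nat.size (ζ (j * n + v)) * shiftUnit h r +
        walkDist G (fun e => edgeCost b h r (w e)) (b * shiftUnit h r + 1) u v + shiftUnit h r ≤
      Nat.size (ζ (j * n + x)) * shiftUnit h r +
        walkDist G (fun e => edgeCost b h r (w e)) (b * shiftUnit h r + 1) u x

theorem isLimitedNeighborhoodCover_copyClusters {a ℓ : ℕ} {W C : ℝ} {L : ℕ → ℕ → ℕ} (hW : 0 < W)
    (hn : 0 < n) (hℓ : 0 < ℓ) (hw : ∀ e ∈ G.edgeSet, 1 ≤ w e ∧ w e ≤ n ^ a)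
    (hh : h = min ℓ n) (hr : r = min ⌊W⌋₊ (n ^ (a + 1))) (hb : ∀ s, Nat.size (ζ s) ≤ b)
    (hL : IsCopywiseBellmanFord T (shiftUnit h r) (edgeCost b h r) G w ζ L)
    (hwin : HasWinners T b h r G w ζ)
    (hCb : (10 * b : ℕ) ≤ C * Real.log n) (hCT : T ≤ C * Real.log n) :
    IsLimitedNeighborhoodCover G w ℓ W C (copyClusters n T (L (5 * b * h))) := by
  have hh0 : 0 < h := by omega
  have hlab := fun j hj => isCenterLabeling_of_isCopywiseBellmanFord (j := j) hh0 hb hL hj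
  have hpos : ∀ e ∈ G.edgeSet, 0 < edgeCost b h r (w e) := fun e _ => edgeCost_pos _
  have hshift : ∀ s, Nat.size (ζ s) * shiftUnit h r ≤ b * shiftUnit h r :=
    fun s => Nat.mul_le_mul_right _ (hb s)
  refine ⟨fun c x hx y hy => ?_, fun v => ?_, fun u => ?_⟩
  · obtain ⟨p, hp, hmem, hcost⟩ := exists_path_in_copyClusters
      (sh := fun s => Nat.size (ζ s) * shiftUnit h r) hlab hpos hshift hx hy
    have hrW : (r : ℝ) ≤ W := by
      rw [hr]
      exact (Nat.cast_le.2 (min_le_left _ _)).trans (Nat.floor_le hW.le)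
    refine ⟨p, hp, hmem, ?_⟩
    calc (walkWeight w p : ℝ) ≤ ((10 * b * r : ℕ) : ℝ) :=
          Nat.cast_le.2 (walkWeight_le_of_edgeCost hh0 p hcost)
      _ = ((10 * b : ℕ) : ℝ) * r := Nat.cast_mul _ _
      _ ≤ (C * Real.log n) * W :=
          mul_le_mul hCb hrW (Nat.cast_nonneg _) ((Nat.cast_nonneg _).trans hCb)
      _ = C * W * Real.log n := mul_right_comm _ _ _
  · exact ⟨setOf_mem_copyClusters (lab := L (5 * b * h)) v ▸ Finset.finite_toSet _,
      (Nat.cast_le.2 (ncard_setOf_mem_copyClusters_le v)).trans hCT⟩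
  · obtain ⟨j, hj, v, hv⟩ := hwin u
    refine ⟨j * n + v, fun y ⟨p, hp, hpℓ, hpW⟩ => ⟨j, hj, ?_⟩⟩
    obtain ⟨hlen, hweight⟩ := length_le_and_walkWeight_le_of_isPath (fun e he => (hw e he).2) hp
      hpℓ hpW
    rw [← hh] at hlen
    rw [← hr] at hweight
    exact (hlab j hj).mod_eq_of_gap hpos (fun u => node_lt hj u) (fun u => hshift (j * n + u))
      (Nat.lt_succ_self _) hv p (walkWeight_edgeCost_le (fun e he => (hw e he).1) p hlen hweight)

end EdgeCost

end ShiftedClustering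

/-! ### The algorithm -/

namespace ShiftedClustering

open CellMachine

/-- The numerical conditions under which the algorithm works: there are `T` copies of the graph,
words have `b` bits, `h` and `r` are the effective hop bound and radius. Machines hold `d` cells
with values less than `K`, and the fields of a record are less than `β`; the sort keys of records
have `B` bits. -/
structure Admissible (a n m M d H mem K T β b B h r : ℕ) : Prop where
  params : Params M d H mem K
  cells : 2 * T * m + T * n ≤ M * d
  copies_pos : 0 < T
  vertices_pos : 0 < n
  input_le : 3 * d ≤ mem
  word : 2 * d * K ≤ 2 ^ b
  payload : (β ^ 5 + 1) * (2 * T * m + T * n + 1) < K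
  size_le : 2 * T * m + T * n ≤ β
  key_le : T * n * (T * n) ≤ 2 ^ B
  weight_lt : n ^ a < β
  cost_lt : ∀ x ≤ n ^ a,
    T * n * (b * shiftUnit h r) + T * n + T * n * edgeCost b h r x < β

/-- The algorithm for limited neighborhood covers: Bellman–Ford on `T` copies of the graph with
randomly shifted start labels. -/
abbrev coverAlgorithm (n m M d H mem T β b B h r : ℕ) : MPCAlgorithm :=
  toAlgorithm mem (2 ^ b) (readInput M d β)
    (coverRounds M d H n m T β (shiftUnit h r) B (5 * b * h) (edgeCost b h r))
    (writeOutput n β (T * n))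

theorem one_sub_le_successProb {A : MPCAlgorithm} [Nonempty A.Coins]
    {init : Fin A.machines → List ℕ} {good : (Fin A.machines → List ℕ) → Prop}
    {bad : A.Coins → Prop} {ε : ℝ} (hgood : ∀ ω, ¬ bad ω → good (A.output init ω))
    (hbad : (Nat.card {ω // bad ω} : ℝ) ≤ ε * Nat.card A.Coins) :
    1 - ε ≤ A.successProb init good := by
  have hsum : Nat.card A.Coins ≤
      Nat.card {ω // good (A.output init ω)} + Nat.card {ω // bad ω} := by
    rw [← Nat.card_sum]
    refine Nat.card_le_card_of_surjective (Sum.elim (fun x => x.1) fun x => x.1) fun ω => ?_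
    by_cases hω : bad ω
    · exact ⟨Sum.inr ⟨ω, hω⟩, rfl⟩
    · exact ⟨Sum.inl ⟨ω, hgood ω hω⟩, rfl⟩
  have hsum' : (Nat.card A.Coins : ℝ) ≤
      Nat.card {ω // good (A.output init ω)} + Nat.card {ω // bad ω} := mod_cast hsum
  rw [MPCAlgorithm.successProb, le_div_iff₀ (Nat.cast_pos.2 Nat.card_pos)]
  linarith

section Input

variable {n M : ℕ} {G : SimpleGraph (Fin n)} {w : Sym2 (Fin n) → ℕ}
  {D : Fin M → List (Fin n × Fin n)}

theorem length_edgeInput (i : Fin M) : (edgeInput w D i).length = 3 * (D i).length := by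
  simp [edgeInput, List.length_flatMap, mul_comm]

theorem lt_of_mem_edgeInput {Q : ℕ} (hD : IsEdgeDistribution G D) (hn : n ≤ Q)
    (hw : ∀ e ∈ G.edgeSet, w e < Q) {i : Fin M} {x : ℕ} (hx : x ∈ edgeInput w D i) : x < Q := by
  obtain ⟨e, he, hx⟩ := List.mem_flatMap.1 hx
  simp only [List.mem_cons, List.not_mem_nil, or_false] at hx
  rcases hx with rfl | rfl | rfl
  · exact e.1.2.trans_le hn
  · exact e.2.2.trans_le hn
  · exact hw _ (edge_mem_of_mem hD he)

theorem readInput_edgeInput_lt {d β K : ℕ} (hD : IsEdgeDistribution G D) (hn : n ≤ β)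
    (hw : ∀ e ∈ G.edgeSet, w e < β) (hK : β ^ 3 + 1 ≤ K) (i : Fin M) (s : Fin (2 * d)) :
    readInput M d β i (edgeInput w D i) s < K := by
  have heq := congrFun (congrFun (readInput_eq (d := d) (β := β) w D) i) s
  rw [heq, ofArray]
  split_ifs
  · exact (inputArray_lt hD hn hw _).trans_le hK
  · omega

end Input

section Coins

variable {a n m M d H mem K T β b B h r : ℕ}

/-- The coin that shifts node `s`. -/
def shiftCoin (ω : (coverAlgorithm n m M d H mem T β b B h r).Coins) (s : ℕ) : ℕ :=
  cellCoin d (roundCoins ω (2 * H + 5)) (2 * T * m + s)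

theorem shiftCoin_lt (ω : (coverAlgorithm n m M d H mem T β b B h r).Coins) (s : ℕ) :
    shiftCoin ω s < 2 ^ b := by
  unfold shiftCoin cellCoin roundCoins coinFun
  split_ifs
  · exact Fin.is_lt _
  all_goals positivity

theorem size_shiftCoin_le (ω : (coverAlgorithm n m M d H mem T β b B h r).Coins) (s : ℕ) :
    Nat.size (shiftCoin ω s) ≤ b :=
  Nat.size_le.2 (shiftCoin_lt ω s)

/-- The coins of an algorithm as one family of words. -/
def flatCoins (A : MPCAlgorithm) :
    A.Coins ≃ (Fin A.rounds × Fin A.machines × Fin A.memory → Fin A.wordSize) :=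
  ((Equiv.refl (Fin A.rounds)).arrowCongr (Equiv.curry _ _ _).symm).trans (Equiv.curry _ _ _).symm

theorem exists_flatCoins_eq_shiftCoin (hd : 0 < d) (hmem : d ≤ mem)
    (hcells : 2 * T * m + T * n ≤ M * d) :
    ∃ e : Fin T × Fin n → Fin (coverAlgorithm n m M d H mem T β b B h r).rounds ×
        Fin (coverAlgorithm n m M d H mem T β b B h r).machines ×
        Fin (coverAlgorithm n m M d H mem T β b B h r).memory, Function.Injective e ∧
      ∀ ω (j : Fin T) (x : Fin n), (flatCoins _ ω (e (j, x)) : ℕ) = shiftCoin ω (j * n + x) := by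
  have hdiv : ∀ (j : Fin T) (x : Fin n), (2 * T * m + (j * n + x)) / d < M := fun j x => by
    have := node_lt j.2 x
    exact Nat.div_lt_of_lt_mul (by rw [mul_comm d]; omega)
  have hmod : ∀ p, p % d < mem := fun p => (Nat.mod_lt _ hd).trans_le hmem
  have hround : 2 * H + 5 + 1 < (coverRounds M d H n m T β (shiftUnit h r) B (5 * b * h)
      (edgeCost b h r)).length + 2 := by
    rw [length_coverRounds]
    omega
  refine ⟨fun y => (⟨2 * H + 5 + 1, hround⟩, ⟨(2 * T * m + (y.1 * n + y.2)) / d, hdiv y.1 y.2⟩,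
    ⟨(2 * T * m + (y.1 * n + y.2)) % d, hmod _⟩), ?_, fun ω j x => ?_⟩
  · rintro ⟨j, x⟩ ⟨j', x'⟩ heq
    simp only [Prod.mk.injEq, Fin.mk.injEq, true_and] at heq
    have hcell : 2 * T * m + (j * n + x) = 2 * T * m + (j' * n + x') := by
      rw [← Nat.div_add_mod (2 * T * m + (j * n + x)) d, heq.1, heq.2, Nat.div_add_mod]
    obtain ⟨hj, hx⟩ := address_inj x.2 x'.2 (Nat.add_left_cancel hcell)
    exact Prod.ext (Fin.ext hj) (Fin.ext hx)
  · rw [shiftCoin, cellCoin, dif_pos (hdiv j x), ← coinFun_eq_roundCoins ω hround]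
    exact (show coinFun _ _ = _ from dif_pos (hmod _)).symm

end Coins

section CoverAlgorithm

variable {a n m M d H mem K T β b B h r : ℕ}

namespace Admissible

variable (hA : Admissible a n m M d H mem K T β b B h r)
include hA

theorem le_two_pow : 2 * K ≤ 2 ^ b :=
  (Nat.mul_le_mul_right K (Nat.le_mul_of_pos_right 2 hA.params.block_pos)).trans hA.word

theorem vertices_le : n ≤ T * n := Nat.le_mul_of_pos_left n hA.copies_pos

theorem base_pos : 0 < β := (Nat.zero_le _).trans_lt hA.weight_lt

theorem size_lt : 2 * T * m + T * n < K :=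
  (Nat.lt_succ_self _).trans
    ((Nat.le_mul_of_pos_left _ (Nat.succ_pos (β ^ 5))).trans_lt hA.payload)

theorem pow_three_lt : β ^ 3 + 1 < K :=
  calc β ^ 3 + 1 ≤ β ^ 5 + 1 :=
        Nat.add_le_add_right (Nat.pow_le_pow_right hA.base_pos (by norm_num)) 1
    _ ≤ (β ^ 5 + 1) * (2 * T * m + T * n + 1) := Nat.le_mul_of_pos_right _ (Nat.succ_pos _)
    _ < K := hA.payload

theorem base_le_two_pow : β ≤ 2 ^ b := by
  have := Nat.le_self_pow (n := 3) (by norm_num) β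
  have := hA.pow_three_lt
  have := hA.le_two_pow
  omega

end Admissible

variable (hA : Admissible a n m M d H mem K T β b B h r) {G : SimpleGraph (Fin n)}
  {w : Sym2 (Fin n) → ℕ} {D : Fin M → List (Fin n × Fin n)}
  (hm : G.edgeSet.ncard = m) (hw : ∀ e ∈ G.edgeSet, w e ≤ n ^ a) (hD : IsEdgeDistribution G D)
  (hlen : ∀ i, (D i).length ≤ d)
include hA hw

theorem bounds_shiftCoin (ω : (coverAlgorithm n m M d H mem T β b B h r).Coins) :
    Bounds (2 * T * m + T * n) K n T β (shiftUnit h r) B (T * n * (b * shiftUnit h r) + T * n)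
      (edgeCost b h r) G w (shiftCoin ω) where
  payload := hA.payload
  size_le := hA.size_le
  node_le := Nat.le_add_left _ _
  key_le := hA.key_le
  init_le s hs := Nat.add_le_add
    (Nat.mul_le_mul_left _ (Nat.mul_le_mul_right _ (size_shiftCoin_le ω s))) hs.le
  lab_lt := (Nat.le_add_right _ _).trans_lt (hA.cost_lt 0 (Nat.zero_le _))
  cost_lt _ _ huv := hA.cost_lt _ (hw _ (G.mem_edgeSet.2 huv))

include hm hD hlen

theorem exists_exec_coverAlgorithm (ω : (coverAlgorithm n m M d H mem T β b B h r).Coins) :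
    ∃ (E : Fin (2 * T * m + T * n) → Entry) (L : ℕ → ℕ → ℕ),
      Exec mem K (coverRounds M d H n m T β (shiftUnit h r) B (5 * b * h) (edgeCost b h r))
        (roundCoins ω) (fun i => readInput M d β i (edgeInput w D i))
        (ofArray M d (entryArray β E)) ∧
      IsLabeledBy (T * n) β E (L (5 * b * h)) ∧
      IsCopywiseBellmanFord T (shiftUnit h r) (edgeCost b h r) G w (shiftCoin ω) L :=
  exists_exec_coverRounds hA.params hA.cells hA.copies_pos hD hlen hm
    (fun e he => (hw e he).trans_lt hA.weight_lt) (bounds_shiftCoin hA hw ω)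

theorem coverAlgorithm_obeysLimits :
    (coverAlgorithm n m M d H mem T β b B h r).ObeysLimits (edgeInput w D) := by
  choose E L hexec _ _ using exists_exec_coverAlgorithm hA hm hw hD hlen
  have hnβ : n ≤ β := hA.vertices_le.trans ((Nat.le_add_left _ _).trans hA.size_le)
  have hTn : T * n ≤ 2 ^ b := (Nat.le_add_left _ _).trans (hA.size_le.trans hA.base_le_two_pow)
  have hwβ : ∀ e ∈ G.edgeSet, w e < β := fun e he => (hw e he).trans_lt hA.weight_lt
  refine toAlgorithm_obeysLimits hA.params.mem_le hA.word (fun i => ?_)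
    (fun i x hx => (lt_of_mem_edgeInput hD hnβ hwβ hx).trans_le hA.base_le_two_pow)
    (readInput_edgeInput_lt hD hnβ hwβ hA.pow_three_lt.le) hexec fun ω i => ⟨?_, fun x hx => ?_⟩
  · rw [length_edgeInput]
    exact (Nat.mul_le_mul_left 3 (hlen i)).trans hA.input_le
  · exact (length_writeOutput_le _ _ _ _).trans hA.params.mem_le
  · exact lt_of_mem_writeOutput hA.vertices_pos (Nat.mul_pos hA.copies_pos hA.vertices_pos)
      (hA.vertices_le.trans hTn) hTn hx

variable {ℓ : ℕ} {W C : ℝ} (hW : 0 < W) (hℓ : 0 < ℓ) (hh : h = min ℓ n)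
  (hr : r = min ⌊W⌋₊ (n ^ (a + 1))) (hw₁ : ∀ e ∈ G.edgeSet, 1 ≤ w e)
  (hCb : (10 * b : ℕ) ≤ C * Real.log n) (hCT : T ≤ C * Real.log n)
include hW hℓ hh hr hw₁ hCb hCT

theorem isLimitedNeighborhoodCover_output
    {ω : (coverAlgorithm n m M d H mem T β b B h r).Coins}
    (hwin : HasWinners T b h r G w (shiftCoin ω)) :
    IsLimitedNeighborhoodCover G w ℓ W C (outputClusters n
      ((coverAlgorithm n m M d H mem T β b B h r).output (edgeInput w D) ω)) := by
  obtain ⟨E, L, hexec, hE, hL⟩ := exists_exec_coverAlgorithm hA hm hw hD hlen ω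
  rw [output_toAlgorithm_eq hexec, outputClusters_writeOutput hA.cells hE]
  exact isLimitedNeighborhoodCover_copyClusters hW hA.vertices_pos hℓ
    (fun e he => ⟨hw₁ e he, hw e he⟩) hh hr (size_shiftCoin_le ω) hL hwin hCb hCT

theorem one_sub_le_successProb_coverAlgorithm :
    1 - n * (3 / 4 : ℝ) ^ T ≤
      (coverAlgorithm n m M d H mem T β b B h r).successProb (edgeInput w D) fun out =>
        IsLimitedNeighborhoodCover G w ℓ W C (outputClusters n out) := by
  obtain ⟨e, he, hcoin⟩ := exists_flatCoins_eq_shiftCoin (n := n) (m := m) (H := H) (T := T)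
    (β := β) (b := b) (B := B) (h := h) (r := r) hA.params.block_pos
    ((Nat.le_mul_of_pos_left d three_pos).trans hA.input_le) hA.cells
  have : Nonempty (coverAlgorithm n m M d H mem T β b B h r).Coins :=
    ⟨fun _ _ _ => ⟨0, by positivity⟩⟩
  have hQ : 2 * Fintype.card (Fin n) ≤ 2 ^ b := by
    have := hA.vertices_le
    have := hA.size_lt
    have := hA.le_two_pow
    rw [Fintype.card_fin]
    omega
  have hbad := card_exists_forall_not_exists_isWinner_le (Λ := shiftUnit h r) (flatCoins _) he hQ
    (Nat.succ_pos _) fun u =>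
      walkDist G (fun e => edgeCost b h r (w e)) (b * shiftUnit h r + 1) u
  rw [Fintype.card_fin, Fintype.card_fin] at hbad
  refine one_sub_le_successProb (fun ω hω => ?_) hbad
  refine isLimitedNeighborhoodCover_output hA hm hw hD hlen hW hℓ hh hr hw₁ hCb hCT fun u => ?_
  push Not at hω
  obtain ⟨j, v, hv⟩ := hω u
  simp only [IsWinner, hcoin] at hv
  exact ⟨j, j.2, v, hv⟩

end CoverAlgorithm

end ShiftedClustering

/-! ### The choice of the parameters -/

namespace ShiftedClustering

open CellMachine

/-- The power of two that all the polynomial bounds refer to. -/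
def scale (n : ℕ) : ℕ := 2 ^ Nat.clog 2 n

/-- The number of copies of the graph, such that `(3 / 4) ^ numCopies k n ≤ n ^ (-(k + 1))`. -/
def numCopies (k n : ℕ) : ℕ := 3 * (k + 1) * Nat.clog 2 n

/-- The number of bits of a word. -/
def wordBits (a k n : ℕ) : ℕ := 32 * (a + k + 20) * Nat.clog 2 n

/-- The strict bound `β` on the fields of a record. -/
def fieldBound (a k n : ℕ) : ℕ := scale n ^ (4 * (a + k + 20))

/-- The number of machines, each of which can hold `s` edges. -/
def numMachines (k n m s : ℕ) : ℕ := 4 * numCopies k n * m / s + 1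

/-- The height of the trees of machines, along which data are aggregated. -/
noncomputable def treeHeight (k : ℕ) (γ : ℝ) : ℕ := 2 * ⌈((2 * (k + 8) : ℕ) : ℝ) / γ⌉₊

/-- The constant of the theorem. -/
def coverConstant (a k : ℕ) : ℕ := 3000 * (a + k + 20) * (4 * k + 37)

/-- The algorithm of the theorem: `coverAlgorithm` with the choice of parameters above. -/
noncomputable abbrev limitedCoverAlgorithm (a k : ℕ) (γ : ℝ) (n m ℓ : ℕ) (W : ℝ) : MPCAlgorithm :=
  coverAlgorithm n m (numMachines k n m ⌊(n : ℝ) ^ γ⌋₊) (max 2 ⌊(n : ℝ) ^ γ⌋₊) (treeHeight k γ)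
    (3 * max 2 ⌊(n : ℝ) ^ γ⌋₊) (numCopies k n) (fieldBound a k n) (wordBits a k n) (wordBits a k n)
    (min ℓ n) (min ⌊W⌋₊ (n ^ (a + 1)))

section Bounds

variable {a k n m s h r : ℕ} (hn : 2 ≤ n)

theorem le_scale (n : ℕ) : n ≤ scale n := Nat.le_pow_clog one_lt_two n

theorem clog_le_scale (n : ℕ) : Nat.clog 2 n ≤ scale n := Nat.lt_two_pow_self.le

theorem two_pow_wordBits (a k n : ℕ) : 2 ^ wordBits a k n = fieldBound a k n ^ 8 := by
  rw [fieldBound, scale, ← pow_mul, ← pow_mul, wordBits]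
  congr 1
  ring

include hn

theorem clog_pos : 0 < Nat.clog 2 n := Nat.clog_pos one_lt_two hn

theorem two_le_scale : 2 ≤ scale n := hn.trans (le_scale n)

theorem scale_le : scale n ≤ n ^ 2 := by
  have hpred := Nat.pow_pred_clog_lt_self one_lt_two hn
  calc 2 ^ Nat.clog 2 n = 2 ^ (Nat.clog 2 n).pred * 2 := by
        rw [← pow_succ, ← Nat.succ_eq_add_one, Nat.succ_pred_eq_of_pos (clog_pos hn)]
    _ ≤ n * n := Nat.mul_le_mul hpred.le hn
    _ = n ^ 2 := (sq n).symm

theorem one_le_scale_pow (i : ℕ) : 1 ≤ scale n ^ i :=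
  Nat.one_le_pow _ _ (two_pos.trans_le (two_le_scale hn))

theorem scale_pow_le {i j : ℕ} (hij : i ≤ j) : scale n ^ i ≤ scale n ^ j :=
  Nat.pow_le_pow_right (two_pos.trans_le (two_le_scale hn)) hij

theorem scale_pow_lt {i j : ℕ} (hij : i < j) : scale n ^ i < scale n ^ j :=
  Nat.pow_lt_pow_right (two_le_scale hn) hij

theorem mul_scale_pow_le {c i : ℕ} (hc : c ≤ 2 ^ i) (j : ℕ) :
    c * scale n ^ j ≤ scale n ^ (j + i) := by
  rw [pow_add, mul_comm]
  exact Nat.mul_le_mul_left _ (hc.trans (Nat.pow_le_pow_left (two_le_scale hn) i))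

theorem numCopies_pos (k : ℕ) : 0 < numCopies k n := Nat.mul_pos (by omega) (clog_pos hn)

theorem numCopies_le : numCopies k n ≤ scale n ^ (k + 3) := by
  have hk : 3 * (k + 1) ≤ 2 ^ (k + 2) := by
    have : k + 1 ≤ 2 ^ k := Nat.lt_two_pow_self
    rw [pow_add]
    omega
  calc numCopies k n ≤ 3 * (k + 1) * scale n ^ 1 := by
        rw [pow_one]
        exact Nat.mul_le_mul_left _ (clog_le_scale n)
    _ ≤ scale n ^ (1 + (k + 2)) := mul_scale_pow_le hn hk 1
    _ = scale n ^ (k + 3) := by ring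

theorem numCopies_mul_vertices_le : numCopies k n * n ≤ scale n ^ (k + 4) := by
  rw [show k + 4 = k + 3 + 1 from rfl, pow_succ]
  exact Nat.mul_le_mul (numCopies_le hn) (le_scale n)

theorem numCopies_mul_edges_le (hmn : m ≤ n ^ 2) : numCopies k n * m ≤ scale n ^ (k + 5) :=
  calc numCopies k n * m ≤ scale n ^ (k + 3) * scale n ^ 2 :=
        Nat.mul_le_mul (numCopies_le hn) (hmn.trans (Nat.pow_le_pow_left (le_scale n) 2))
    _ = scale n ^ (k + 5) := by rw [← pow_add]

theorem numMachines_le (hmn : m ≤ n ^ 2) : numMachines k n m s ≤ scale n ^ (k + 8) :=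
  calc numMachines k n m s ≤ 4 * numCopies k n * m + 1 :=
        Nat.add_le_add_right (Nat.div_le_self _ _) 1
    _ ≤ 8 * scale n ^ (k + 5) := by
        have := numCopies_mul_edges_le (k := k) hn hmn
        have := one_le_scale_pow hn (k + 5)
        rw [mul_assoc]
        omega
    _ ≤ scale n ^ (k + 8) := mul_scale_pow_le hn (by norm_num : 8 ≤ 2 ^ 3) (k + 5)

theorem numRecords_le (hmn : m ≤ n ^ 2) :
    2 * numCopies k n * m + numCopies k n * n ≤ scale n ^ (k + 7) :=
  calc 2 * numCopies k n * m + numCopies k n * n ≤ 4 * scale n ^ (k + 5) := by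
        have := numCopies_mul_edges_le (k := k) hn hmn
        have := (numCopies_mul_vertices_le (k := k) hn).trans
          (scale_pow_le hn (by omega : k + 4 ≤ k + 5))
        rw [mul_assoc]
        omega
    _ ≤ scale n ^ (k + 7) := mul_scale_pow_le hn (by norm_num : 4 ≤ 2 ^ 2) (k + 5)

theorem wordBits_le : wordBits a k n ≤ scale n ^ (a + k + 26) :=
  calc wordBits a k n ≤ 32 * scale n ^ (a + k + 20) * scale n :=
        Nat.mul_le_mul (Nat.mul_le_mul_left _ (Nat.lt_two_pow_self.le.trans
          (Nat.pow_le_pow_left (two_le_scale hn) _))) (clog_le_scale n)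
    _ = 32 * scale n ^ (a + k + 21) := by ring
    _ ≤ scale n ^ (a + k + 26) := mul_scale_pow_le hn (by norm_num : 32 ≤ 2 ^ 5) _

theorem shiftUnit_le (hh : h ≤ n) (hr : r ≤ n ^ (a + 1)) : shiftUnit h r ≤ scale n ^ (a + 5) := by
  have hhr : h * r ≤ scale n ^ (a + 2) := by
    rw [pow_succ' _ (a + 1)]
    exact Nat.mul_le_mul (hh.trans (le_scale n)) (hr.trans (Nat.pow_le_pow_left (le_scale n) _))
  calc shiftUnit h r ≤ 5 * scale n ^ (a + 2) := by
        have := one_le_scale_pow hn (a + 2)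
        unfold shiftUnit
        omega
    _ ≤ scale n ^ (a + 5) := mul_scale_pow_le hn (by norm_num : 5 ≤ 2 ^ 3) _

theorem edgeCost_le (hh : h ≤ n) (hr : r ≤ n ^ (a + 1)) {x : ℕ} (hx : x ≤ n ^ a) :
    edgeCost (wordBits a k n) h r x ≤ scale n ^ (2 * a + k + 31) := by
  have hcost : edgeCost (wordBits a k n) h r x ≤ 2 * wordBits a k n + 1 + (h * x + r) := by
    unfold edgeCost
    split_ifs <;> omega
  have hhx : h * x ≤ n ^ (a + 1) := by
    rw [pow_succ']
    exact Nat.mul_le_mul hh hx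
  have hpow : n ^ (a + 1) ≤ scale n ^ (2 * a + k + 27) :=
    (Nat.pow_le_pow_left (le_scale n) _).trans (scale_pow_le hn (by omega))
  calc edgeCost (wordBits a k n) h r x ≤ 5 * scale n ^ (2 * a + k + 27) := by
        have := (wordBits_le (a := a) (k := k) hn).trans
          (scale_pow_le hn (by omega : _ ≤ 2 * a + k + 27))
        have := one_le_scale_pow hn (2 * a + k + 27)
        omega
    _ ≤ scale n ^ (2 * a + k + 31) := mul_scale_pow_le hn (by norm_num : 5 ≤ 2 ^ 4) _

theorem shift_add_edgeCost_lt (hh : h ≤ n) (hr : r ≤ n ^ (a + 1)) {x : ℕ} (hx : x ≤ n ^ a) :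
    numCopies k n * n * (wordBits a k n * shiftUnit h r) + numCopies k n * n +
      numCopies k n * n * edgeCost (wordBits a k n) h r x < fieldBound a k n := by
  have hshift : wordBits a k n * shiftUnit h r ≤ scale n ^ (2 * a + k + 31) := by
    rw [show 2 * a + k + 31 = a + k + 26 + (a + 5) by omega, pow_add]
    exact Nat.mul_le_mul (wordBits_le hn) (shiftUnit_le hn hh hr)
  calc _ = numCopies k n * n *
          (wordBits a k n * shiftUnit h r + 1 + edgeCost (wordBits a k n) h r x) := by ring
    _ ≤ scale n ^ (k + 4) * (4 * scale n ^ (2 * a + k + 31)) := by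
        have := edgeCost_le (k := k) hn hh hr hx
        have := one_le_scale_pow hn (2 * a + k + 31)
        exact Nat.mul_le_mul (numCopies_mul_vertices_le hn) (by omega)
    _ = 4 * scale n ^ (2 * a + 2 * k + 35) := by ring
    _ ≤ scale n ^ (2 * a + 2 * k + 35 + 2) := mul_scale_pow_le hn (by norm_num : 4 ≤ 2 ^ 2) _
    _ < fieldBound a k n := scale_pow_lt hn (by omega)

theorem scale_pow_le_fieldBound {i : ℕ} (hi : i ≤ 4 * (a + k + 20)) :
    scale n ^ i ≤ fieldBound a k n := scale_pow_le hn hi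

theorem eight_le_fieldBound : 8 ≤ fieldBound a k n :=
  (Nat.pow_le_pow_left (two_le_scale hn) 3).trans (scale_pow_le_fieldBound hn (by omega))

theorem two_mul_max_le (hsn : s ≤ n) : 2 * max 2 s ≤ scale n ^ 3 :=
  calc 2 * max 2 s ≤ 4 * scale n ^ 1 := by
        have := le_scale n
        rw [pow_one]
        omega
    _ ≤ scale n ^ 3 := mul_scale_pow_le hn (by norm_num : 4 ≤ 2 ^ 2) 1

theorem payload_lt (hmn : m ≤ n ^ 2) :
    (fieldBound a k n ^ 5 + 1) * (2 * numCopies k n * m + numCopies k n * n + 1) <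
      fieldBound a k n ^ 7 := by
  have hβ := eight_le_fieldBound (a := a) (k := k) hn
  have hN := (numRecords_le (k := k) hn hmn).trans
    (scale_pow_le_fieldBound (a := a) (k := k) hn (by omega))
  have hβ5 : 1 ≤ fieldBound a k n ^ 5 := Nat.one_le_pow _ _ (by omega)
  calc (fieldBound a k n ^ 5 + 1) * (2 * numCopies k n * m + numCopies k n * n + 1)
      ≤ (2 * fieldBound a k n ^ 5) * (2 * fieldBound a k n) := Nat.mul_le_mul (by omega) (by omega)
    _ = 4 * fieldBound a k n ^ 6 := by ring
    _ < fieldBound a k n * fieldBound a k n ^ 6 :=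
        Nat.mul_lt_mul_of_pos_right (by omega) (by positivity)
    _ = fieldBound a k n ^ 7 := by ring

end Bounds

theorem edges_lt_numMachines_mul {s : ℕ} (k n m : ℕ) (hs : 0 < s) :
    4 * numCopies k n * m < numMachines k n m s * s := by
  rw [numMachines, add_mul, one_mul]
  exact Nat.lt_div_mul_add hs

theorem numRecords_le_numMachines_mul {k n m s : ℕ} (hs : 0 < s) (hnm : n ≤ 2 * m) :
    2 * numCopies k n * m + numCopies k n * n ≤ numMachines k n m s * max 2 s :=
  calc 2 * numCopies k n * m + numCopies k n * n
      ≤ 2 * numCopies k n * m + numCopies k n * (2 * m) := by gcongr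
    _ = 4 * numCopies k n * m := by ring
    _ ≤ numMachines k n m s * s := (edges_lt_numMachines_mul k n m hs).le
    _ ≤ numMachines k n m s * max 2 s := by gcongr; exact le_max_right 2 s

theorem admissible {a k n m s h r H : ℕ} (hn : 2 ≤ n) (hnm : n ≤ 2 * m) (hmn : m ≤ n ^ 2)
    (hs : 0 < s) (hsn : s ≤ n) (hH : numMachines k n m s ≤ max 2 s ^ H) (hh : h ≤ n)
    (hr : r ≤ n ^ (a + 1)) :
    Admissible a n m (numMachines k n m s) (max 2 s) H (3 * max 2 s) (fieldBound a k n ^ 7)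
      (numCopies k n) (fieldBound a k n) (wordBits a k n) (wordBits a k n) h r where
  params :=
    { block_pos := by omega
      mem_le := by omega
      height := hH
      size_lt :=
        calc numMachines k n m s * max 2 s ≤ scale n ^ (k + 8) * scale n ^ 3 :=
              Nat.mul_le_mul (numMachines_le hn hmn) ((Nat.le_mul_of_pos_left _ two_pos).trans
                (two_mul_max_le hn hsn))
          _ = scale n ^ (k + 11) := by rw [← pow_add]
          _ < fieldBound a k n := scale_pow_lt hn (by omega)
          _ ≤ fieldBound a k n ^ 7 := Nat.le_self_pow (by norm_num) _ }
  cells := numRecords_le_numMachines_mul hs hnm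
  copies_pos := numCopies_pos hn k
  vertices_pos := by omega
  input_le := le_rfl
  word := by
    rw [two_pow_wordBits, pow_succ' _ 7]
    exact Nat.mul_le_mul_right _
      ((two_mul_max_le hn hsn).trans (scale_pow_le_fieldBound hn (by omega)))
  payload := payload_lt hn hmn
  size_le := (numRecords_le hn hmn).trans (scale_pow_le_fieldBound hn (by omega))
  key_le := by
    have hTn : numCopies k n * n ≤ fieldBound a k n :=
      (numCopies_mul_vertices_le hn).trans (scale_pow_le_fieldBound hn (by omega))
    have := eight_le_fieldBound (a := a) (k := k) hn
    calc numCopies k n * n * (numCopies k n * n) ≤ fieldBound a k n * fieldBound a k n :=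
          Nat.mul_le_mul hTn hTn
      _ = fieldBound a k n ^ 2 := (sq _).symm
      _ ≤ fieldBound a k n ^ 8 := Nat.pow_le_pow_right (by omega) (by norm_num)
      _ = 2 ^ wordBits a k n := (two_pow_wordBits a k n).symm
  weight_lt := (Nat.pow_le_pow_left (le_scale n) a).trans_lt (scale_pow_lt hn (by omega))
  cost_lt _ hx := shift_add_edgeCost_lt hn hh hr hx

theorem mul_three_quarters_pow_numCopies_le {k n : ℕ} (hn : 0 < n) :
    (n : ℝ) * (3 / 4 : ℝ) ^ numCopies k n ≤ 1 / (n : ℝ) ^ k := by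
  have hpow : (3 / 4 : ℝ) ^ numCopies k n ≤ 1 / (n : ℝ) ^ (k + 1) :=
    calc (3 / 4 : ℝ) ^ numCopies k n = ((3 / 4 : ℝ) ^ 3) ^ ((k + 1) * Nat.clog 2 n) := by
          rw [numCopies, ← pow_mul, mul_assoc]
      _ ≤ (1 / 2 : ℝ) ^ ((k + 1) * Nat.clog 2 n) :=
          pow_le_pow_left₀ (by norm_num) (by norm_num) _
      _ = 1 / (scale n : ℝ) ^ (k + 1) := by
          rw [scale, one_div_pow, Nat.cast_pow, ← pow_mul, mul_comm (Nat.clog 2 n), Nat.cast_ofNat]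
      _ ≤ 1 / (n : ℝ) ^ (k + 1) := by
          gcongr
          exact le_scale n
  calc (n : ℝ) * (3 / 4 : ℝ) ^ numCopies k n ≤ n * (1 / (n : ℝ) ^ (k + 1)) := by gcongr
    _ = 1 / (n : ℝ) ^ k := by
        rw [pow_succ]
        field_simp

theorem pow_le_max_floor_rpow_pow {γ : ℝ} (hγ : 0 < γ) {n : ℕ} (hn : 1 ≤ n) (E : ℕ) :
    n ^ E ≤ max 2 ⌊(n : ℝ) ^ γ⌋₊ ^ (2 * ⌈(E : ℝ) / γ⌉₊) := by
  set d := max 2 ⌊(n : ℝ) ^ γ⌋₊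
  have hd : (n : ℝ) ^ γ ≤ (d : ℝ) ^ 2 := by
    have hfloor : ⌊(n : ℝ) ^ γ⌋₊ + 1 ≤ d ^ 2 := by
      have : 2 ≤ d := le_max_left _ _
      have : ⌊(n : ℝ) ^ γ⌋₊ ≤ d := le_max_right _ _
      nlinarith
    exact (Nat.lt_floor_add_one _).le.trans (by exact_mod_cast hfloor)
  have hceil : (n : ℝ) ^ (E : ℝ) ≤ ((n : ℝ) ^ γ) ^ ⌈(E : ℝ) / γ⌉₊ := by
    rw [← Real.rpow_natCast, ← Real.rpow_mul (by positivity)]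
    refine Real.rpow_le_rpow_of_exponent_le (by exact_mod_cast hn) ?_
    rw [← div_le_iff₀' hγ]
    exact Nat.le_ceil _
  have hpow : (n : ℝ) ^ E ≤ (d : ℝ) ^ (2 * ⌈(E : ℝ) / γ⌉₊) := by
    rw [← Real.rpow_natCast, pow_mul]
    exact hceil.trans (pow_le_pow_left₀ (by positivity) hd _)
  exact_mod_cast hpow

theorem numMachines_le_pow_treeHeight {γ : ℝ} (hγ : 0 < γ) {k n m s : ℕ} (hn : 2 ≤ n)
    (hmn : m ≤ n ^ 2) :
    numMachines k n m s ≤ max 2 ⌊(n : ℝ) ^ γ⌋₊ ^ treeHeight k γ :=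
  calc numMachines k n m s ≤ scale n ^ (k + 8) := numMachines_le hn hmn
    _ ≤ (n ^ 2) ^ (k + 8) := Nat.pow_le_pow_left (scale_le hn) _
    _ = n ^ (2 * (k + 8)) := by rw [← pow_mul]
    _ ≤ _ := pow_le_max_floor_rpow_pow hγ (by omega) _

theorem floor_rpow_pos {γ : ℝ} (hγ : 0 ≤ γ) {n : ℕ} (hn : 1 ≤ n) : 0 < ⌊(n : ℝ) ^ γ⌋₊ :=
  Nat.floor_pos.2 (Real.one_le_rpow (by exact_mod_cast hn) hγ)

theorem floor_rpow_le {γ : ℝ} (hγ : γ ≤ 1) {n : ℕ} (hn : 1 ≤ n) : ⌊(n : ℝ) ^ γ⌋₊ ≤ n :=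
  Nat.floor_le_of_le (by
    simpa using Real.rpow_le_rpow_of_exponent_le (by exact_mod_cast hn : (1 : ℝ) ≤ n) hγ)

theorem admissible_limitedCoverAlgorithm {a k n m : ℕ} {γ : ℝ} (hγ : 0 < γ) (hγ1 : γ ≤ 1)
    (hn : 2 ≤ n) (hnm : n ≤ 2 * m) (hmn : m ≤ n ^ 2) (ℓ : ℕ) (W : ℝ) :
    Admissible a n m (numMachines k n m ⌊(n : ℝ) ^ γ⌋₊) (max 2 ⌊(n : ℝ) ^ γ⌋₊) (treeHeight k γ)
      (3 * max 2 ⌊(n : ℝ) ^ γ⌋₊) (fieldBound a k n ^ 7) (numCopies k n) (fieldBound a k n)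
      (wordBits a k n) (wordBits a k n) (min ℓ n) (min ⌊W⌋₊ (n ^ (a + 1))) :=
  admissible hn hnm hmn (floor_rpow_pos hγ.le (by omega)) (floor_rpow_le hγ1 (by omega))
    (numMachines_le_pow_treeHeight hγ hn hmn) (min_le_right _ _) (min_le_right _ _)

section Resources

variable {a k n m ℓ : ℕ} {γ W : ℝ}

theorem mul_le_coverConstant {c : ℕ} (hc : c ≤ 3000) (a k : ℕ) :
    c * (a + k + 20) ≤ coverConstant a k :=
  (Nat.mul_le_mul_right _ hc).trans (Nat.le_mul_of_pos_right _ (Nat.succ_pos _))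

theorem one_le_two_mul_log (hn : 2 ≤ n) : 1 ≤ 2 * Real.log n := by
  have : Real.log 2 ≤ Real.log n := Real.log_le_log (by norm_num) (by exact_mod_cast hn)
  have := Real.log_two_gt_d9
  linarith

theorem clog_le_mul_log (hn : 2 ≤ n) : (Nat.clog 2 n : ℝ) ≤ 3 * Real.log n := by
  have hpred : ((Nat.clog 2 n - 1 : ℕ) : ℝ) * Real.log 2 ≤ Real.log n := by
    rw [← Real.log_pow]
    refine Real.log_le_log (by positivity) ?_
    exact_mod_cast (Nat.pow_pred_clog_lt_self one_lt_two hn).le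
  rw [Nat.cast_sub (clog_pos hn), Nat.cast_one] at hpred
  have := one_le_two_mul_log hn
  have := Real.log_two_gt_d9
  have : Real.log 2 ≤ Real.log n := Real.log_le_log (by norm_num) (by exact_mod_cast hn)
  have : (0 : ℝ) ≤ Nat.clog 2 n := Nat.cast_nonneg _
  nlinarith

theorem wordBits_le_mul_log (hn : 2 ≤ n) :
    (wordBits a k n : ℝ) ≤ 96 * (a + k + 20 : ℕ) * Real.log n :=
  calc (wordBits a k n : ℝ) = 32 * (a + k + 20 : ℕ) * (Nat.clog 2 n : ℝ) := by
        rw [wordBits, Nat.cast_mul, Nat.cast_mul, Nat.cast_ofNat]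
    _ ≤ 32 * (a + k + 20 : ℕ) * (3 * Real.log n) := by
        gcongr
        exact clog_le_mul_log hn
    _ = 96 * (a + k + 20 : ℕ) * Real.log n := by ring

theorem numCopies_le_mul_log (hn : 2 ≤ n) (a : ℕ) :
    (numCopies k n : ℝ) ≤ 9 * (a + k + 20 : ℕ) * Real.log n :=
  calc (numCopies k n : ℝ) = 3 * (k + 1 : ℕ) * (Nat.clog 2 n : ℝ) := by
        rw [numCopies, Nat.cast_mul, Nat.cast_mul, Nat.cast_ofNat]
    _ ≤ 3 * (a + k + 20 : ℕ) * (3 * Real.log n) := by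
        have hk : k + 1 ≤ a + k + 20 := by omega
        have hlog := clog_le_mul_log hn
        gcongr ?_ * (Nat.cast ?_) * ?_
    _ = 9 * (a + k + 20 : ℕ) * Real.log n := by ring

theorem ten_mul_wordBits_le_coverConstant_mul_log (hn : 2 ≤ n) :
    ((10 * wordBits a k n : ℕ) : ℝ) ≤ coverConstant a k * Real.log n :=
  calc ((10 * wordBits a k n : ℕ) : ℝ) ≤ 10 * (96 * (a + k + 20 : ℕ) * Real.log n) := by
        rw [Nat.cast_mul, Nat.cast_ofNat]
        gcongr
        exact wordBits_le_mul_log hn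
    _ = (960 * (a + k + 20) : ℕ) * Real.log n := by push_cast; ring
    _ ≤ coverConstant a k * Real.log n := by
        gcongr
        exact mul_le_coverConstant (by norm_num) a k

theorem numCopies_le_coverConstant_mul_log (hn : 2 ≤ n) :
    (numCopies k n : ℝ) ≤ coverConstant a k * Real.log n :=
  calc (numCopies k n : ℝ) ≤ 9 * (a + k + 20 : ℕ) * Real.log n := numCopies_le_mul_log hn a
    _ = (9 * (a + k + 20) : ℕ) * Real.log n := by push_cast; ring
    _ ≤ coverConstant a k * Real.log n := by
        gcongr
        exact mul_le_coverConstant (by norm_num) a k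

theorem length_coverRounds_add_two_le {M d H T b h β Λ : ℕ} {cst : ℕ → ℕ} (hb : 0 < b)
    (hh : 0 < h) :
    (coverRounds M d H n m T β Λ b (5 * b * h) cst).length + 2 ≤ 30 * (b * h * (H + 3)) := by
  have hsetup : H + 3 ≤ b * h * (H + 3) := Nat.le_mul_of_pos_left _ (Nat.mul_pos hb hh)
  have hsort : b * (H + 3) ≤ b * h * (H + 3) :=
    Nat.mul_le_mul_right _ (Nat.le_mul_of_pos_right _ hh)
  have hiterate : (2 * H + 7) * (5 * b * h) ≤ 15 * (b * h * (H + 3)) :=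
    calc (2 * H + 7) * (5 * b * h) ≤ (3 * (H + 3)) * (5 * b * h) :=
          Nat.mul_le_mul_right _ (by omega)
      _ = 15 * (b * h * (H + 3)) := by ring
  rw [length_coverRounds]
  omega

theorem treeHeight_add_three_le (hγ : 0 < γ) (hγ1 : γ ≤ 1) (k : ℕ) :
    (treeHeight k γ : ℝ) + 3 ≤ (4 * k + 37 : ℕ) / γ := by
  have hceil := Nat.ceil_lt_add_one (a := ((2 * (k + 8) : ℕ) : ℝ) / γ) (by positivity)
  have hinv : 1 ≤ 1 / γ := by rwa [le_div_iff₀ hγ, one_mul]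
  rw [treeHeight]
  push_cast at hceil ⊢
  calc _ ≤ 2 * (2 * ((k : ℝ) + 8) / γ) + 5 * (1 / γ) := by linarith
    _ = (4 * k + 37) / γ := by ring

theorem rounds_limitedCoverAlgorithm_le (hγ : 0 < γ) (hγ1 : γ ≤ 1) (hn : 2 ≤ n) (hℓ : 0 < ℓ) :
    ((limitedCoverAlgorithm a k γ n m ℓ W).rounds : ℝ) ≤
      coverConstant a k * ((ℓ : ℝ) / γ * Real.log n) := by
  have hb : 0 < wordBits a k n := Nat.mul_pos (by omega) (clog_pos hn)
  calc ((limitedCoverAlgorithm a k γ n m ℓ W).rounds : ℝ)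
      ≤ ((30 * (wordBits a k n * min ℓ n * (treeHeight k γ + 3)) : ℕ) : ℝ) :=
        Nat.cast_le.2 (length_coverRounds_add_two_le hb (by omega))
    _ = 30 * (wordBits a k n * (min ℓ n : ℕ) * (treeHeight k γ + 3)) := by push_cast; ring
    _ ≤ 30 * (96 * (a + k + 20 : ℕ) * Real.log n * ℓ * ((4 * k + 37 : ℕ) / γ)) := by
        have := wordBits_le_mul_log (a := a) (k := k) hn
        have := treeHeight_add_three_le hγ hγ1 k
        have := min_le_left ℓ n
        gcongr
    _ = (2880 * (a + k + 20) * (4 * k + 37) : ℕ) * ((ℓ : ℝ) / γ * Real.log n) := by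
        push_cast
        ring
    _ ≤ coverConstant a k * ((ℓ : ℝ) / γ * Real.log n) := by
        unfold coverConstant
        gcongr
        norm_num

theorem memory_limitedCoverAlgorithm_le (hγ : 0 ≤ γ) (hn : 1 ≤ n) :
    ((limitedCoverAlgorithm a k γ n m ℓ W).memory : ℝ) ≤ coverConstant a k * (n : ℝ) ^ γ := by
  have hone : 1 ≤ (n : ℝ) ^ γ := Real.one_le_rpow (by exact_mod_cast hn) hγ
  have hmax : (max 2 ⌊(n : ℝ) ^ γ⌋₊ : ℕ) ≤ 2 * (n : ℝ) ^ γ := by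
    have := Nat.floor_le (zero_le_one.trans hone)
    rw [Nat.cast_max, Nat.cast_ofNat]
    exact max_le (by linarith) (by linarith)
  have hC : 6 ≤ coverConstant a k :=
    (Nat.le_mul_of_pos_right 6 (Nat.succ_pos _)).trans (mul_le_coverConstant (by norm_num) a k)
  calc ((3 * max 2 ⌊(n : ℝ) ^ γ⌋₊ : ℕ) : ℝ) ≤ 3 * (2 * (n : ℝ) ^ γ) := by
        rw [Nat.cast_mul, Nat.cast_ofNat]
        gcongr
    _ = (6 : ℕ) * (n : ℝ) ^ γ := by push_cast; ring
    _ ≤ coverConstant a k * (n : ℝ) ^ γ := by gcongr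

theorem numMachines_mul_le {s : ℕ} (hn : 2 ≤ n) (hnm : n ≤ 2 * m) (hs : 0 < s) (hsn : s ≤ n) :
    numMachines k n m s * (3 * max 2 s) ≤ 36 * (numCopies k n * m) := by
  have hMs : numMachines k n m s * s ≤ 6 * (numCopies k n * m) := by
    have hdiv : 4 * numCopies k n * m / s * s ≤ 4 * numCopies k n * m := Nat.div_mul_le_self _ _
    have hsm : s ≤ 2 * (numCopies k n * m) := (hsn.trans hnm).trans
      (Nat.mul_le_mul_left _ (Nat.le_mul_of_pos_left _ (numCopies_pos hn k)))
    rw [numMachines, add_mul, one_mul]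
    rw [mul_assoc 4] at hdiv ⊢
    omega
  calc numMachines k n m s * (3 * max 2 s) ≤ numMachines k n m s * (6 * s) :=
        Nat.mul_le_mul_left _ (by omega)
    _ = 6 * (numMachines k n m s * s) := by ring
    _ ≤ 36 * (numCopies k n * m) := by omega

theorem machines_mul_memory_limitedCoverAlgorithm_le (hγ : 0 ≤ γ) (hγ1 : γ ≤ 1) (hn : 2 ≤ n)
    (hnm : n ≤ 2 * m) :
    ((limitedCoverAlgorithm a k γ n m ℓ W).machines : ℝ) *
        (limitedCoverAlgorithm a k γ n m ℓ W).memory ≤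
      coverConstant a k * (m * Real.log n ^ 2) := by
  have hs := floor_rpow_pos hγ (by omega : 1 ≤ n)
  have hsn := floor_rpow_le hγ1 (by omega : 1 ≤ n)
  rw [← Nat.cast_mul]
  calc _ ≤ ((36 * (numCopies k n * m) : ℕ) : ℝ) :=
        Nat.cast_le.2 (numMachines_mul_le hn hnm hs hsn)
    _ = 36 * (numCopies k n * m) * 1 := by push_cast; ring
    _ ≤ 36 * (9 * (a + k + 20 : ℕ) * Real.log n * m) * (2 * Real.log n) := by
        gcongr
        · exact numCopies_le_mul_log hn a
        · exact one_le_two_mul_log hn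
    _ = (648 * (a + k + 20) : ℕ) * (m * Real.log n ^ 2) := by push_cast; ring
    _ ≤ coverConstant a k * (m * Real.log n ^ 2) := by
        gcongr
        exact mul_le_coverConstant (by norm_num) a k

theorem wordSize_limitedCoverAlgorithm_le (hn : 2 ≤ n) :
    (limitedCoverAlgorithm a k γ n m ℓ W).wordSize ≤ n ^ coverConstant a k :=
  calc 2 ^ wordBits a k n = scale n ^ (32 * (a + k + 20)) := by
        rw [scale, ← pow_mul, wordBits, mul_comm]
    _ ≤ (n ^ 2) ^ (32 * (a + k + 20)) := Nat.pow_le_pow_left (scale_le hn) _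
    _ = n ^ (64 * (a + k + 20)) := by rw [← pow_mul, ← mul_assoc, show 2 * 32 = 64 from rfl]
    _ ≤ n ^ coverConstant a k :=
        Nat.pow_le_pow_right (by omega) (mul_le_coverConstant (by norm_num) a k)

theorem edges_le_machines_mul (hγ : 0 ≤ γ) (hn : 2 ≤ n) :
    m ≤ (limitedCoverAlgorithm a k γ n m ℓ W).machines * ⌊(n : ℝ) ^ γ⌋₊ :=
  (Nat.le_mul_of_pos_left m (Nat.mul_pos four_pos (numCopies_pos hn k))).trans
    (edges_lt_numMachines_mul k n m (floor_rpow_pos hγ (by omega))).le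

end Resources

theorem ncard_edgeSet_le_sq {n : ℕ} (G : SimpleGraph (Fin n)) : G.edgeSet.ncard ≤ n ^ 2 := by
  classical
  rw [← SimpleGraph.coe_edgeFinset, Set.ncard_coe_finset]
  refine G.card_edgeFinset_le_card_choose_two.trans ?_
  rw [Fintype.card_fin]
  exact Nat.choose_le_pow n 2

end ShiftedClustering

open ShiftedClustering

theorem mainTheorem6 (a k : ℕ) :
    ∃ C : ℕ, ∀ (γ : ℝ), 0 < γ → γ ≤ 1 → ∀ (n m ℓ : ℕ) (W : ℝ),
      2 ≤ n → n ≤ 2 * m → 1 ≤ ℓ → 0 < W →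
      ∃ A : MPCAlgorithm,
        -- rounds, memory per machine, overall memory (in words), words of `O(log n)` bits
        (A.rounds : ℝ) ≤ C * ((ℓ : ℝ) / γ * Real.log n) ∧
        (A.memory : ℝ) ≤ C * (n : ℝ) ^ γ ∧
        (A.machines : ℝ) * (A.memory : ℝ) ≤ C * (m * Real.log n ^ 2) ∧
        A.wordSize ≤ n ^ C ∧
        -- there are enough machines to hold the input with at most `n ^ γ` edges on each
        m ≤ A.machines * ⌊(n : ℝ) ^ γ⌋₊ ∧
        ∀ (G : SimpleGraph (Fin n)) (w : Sym2 (Fin n) → ℕ),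
          G.edgeSet.ncard = m →
          (∀ e ∈ G.edgeSet, 1 ≤ w e ∧ w e ≤ n ^ a) →
          ∀ D : Fin A.machines → List (Fin n × Fin n),
            IsEdgeDistribution G D →
            (∀ i, (D i).length ≤ ⌊(n : ℝ) ^ γ⌋₊) →
            A.ObeysLimits (edgeInput w D) ∧
            1 - 1 / (n : ℝ) ^ k ≤ A.successProb (edgeInput w D) fun out =>
              IsLimitedNeighborhoodCover G w ℓ W C (outputClusters n out) := by
  refine ⟨coverConstant a k, fun γ hγ hγ1 n m ℓ W hn hnm hℓ hW =>
    ⟨limitedCoverAlgorithm a k γ n m ℓ W, rounds_limitedCoverAlgorithm_le hγ hγ1 hn hℓ,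
      memory_limitedCoverAlgorithm_le hγ.le (by omega),
      machines_mul_memory_limitedCoverAlgorithm_le hγ.le hγ1 hn hnm,
      wordSize_limitedCoverAlgorithm_le hn, edges_le_machines_mul hγ.le hn,
      fun G w hm hw D hD hlen => ?_⟩⟩
  have hA := admissible_limitedCoverAlgorithm (a := a) (k := k) hγ hγ1 hn hnm
    (hm ▸ ncard_edgeSet_le_sq G) ℓ W
  have hwa : ∀ e ∈ G.edgeSet, w e ≤ n ^ a := fun e he => (hw e he).2
  have hlen' : ∀ i, (D i).length ≤ max 2 ⌊(n : ℝ) ^ γ⌋₊ := fun i =>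
    (hlen i).trans (le_max_right _ _)
  refine ⟨coverAlgorithm_obeysLimits hA hm hwa hD hlen', ?_⟩
  calc 1 - 1 / (n : ℝ) ^ k ≤ 1 - n * (3 / 4 : ℝ) ^ numCopies k n :=
        sub_le_sub_left (mul_three_quarters_pow_numCopies_le (by omega)) 1
    _ ≤ _ := one_sub_le_successProb_coverAlgorithm hA hm hwa hD hlen' hW hℓ rfl rfl
        (fun e he => (hw e he).1) (ten_mul_wordBits_le_coverConstant_mul_log hn)
        (numCopies_le_coverConstant_mul_log hn)
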